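/- Let $v_0:\mathbb R^3\to\mathbb R^3$ be a real-analytic, divergence-free vector field, $2\pi$-periodic in each coordinate, with vorticity $\omega=\nabla\times v_0=\sum_{p\in\mathbb Z^3}\widehat\omega_p e^{ip\cdot a}$. For $\sigma\ge 0$ put $$\Gamma_\sigma=\sum_{p\in\mathbb Z^3}e^{\sigma|p|}\,|\widehat\omega_p|\in[0,\infty],\qquad T_c=\frac{8-5\sqrt2}{3}\approx 0.3096,$$ where $|\cdot|$ is the Euclidean (Hermitian) norm, $T_c/0=\infty$ and $T_c/\infty=0$. Here $(v,p)$ is called a classical periodic Euler solution on $[0,T)$ with initial velocity $v_0$ if $v$ is $C^1$ on $[0,T)\times\mathbb R^3$, $p(\cdot,t)$ is $C^1$ for each $t$, both are $2\pi$-periodic in space, and $\partial_t v+(v\cdot\nabla)v=-\nabla p$, $\nabla\cdot v=0$, $v(\cdot,0)=v_0$. Its Lagrangian map $x(a,t)$ is the solution of $\partial_t x(a,t)=v(x(a,t),t)$, $x(a,0)=a$. (i) There is a classical periodic Euler solution with initial velocity $v_0$, together with its Lagrangian map, on $[0,T_c/\Gamma_0)$. Now let $x$ be the Lagrangian map of any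 classical periodic Euler solution with initial velocity $v_0$ on some interval $[0,T)$, $0<T\le\infty$. Write $\xi^{(s)}(a)=\frac1{s!}\,\partial_t^s\big(x(a,t)-a\big)\big|_{t=0}$. (ii) For a scalar periodic function $f$ put $\|f\|_\sigma=\sum_p e^{\sigma|p|}|\widehat f_p|$, for a vector field $\|\nabla f\|_\sigma=\max_{i,j}\|\partial_i f_j\|_\sigma$, and let $$\widetilde\zeta_\sigma(t)=\sum_{s\ge1}\|\nabla\xi^{(s)}\|_\sigma t^s,\qquad \zeta_\sigma(t)=\sum_{s\ge1}\Big(\sum_p|p|\,e^{\sigma|p|}\,|\widehat\xi^{(s)}_p|\Big)t^s .$$ For every $\sigma>0$ with $\Gamma_\sigma<\infty$ and every $t\ge0$, in $[0,\infty]$, $$\widetilde\zeta_\sigma\le 6\widetilde\zeta_\sigma^3+12\widetilde\zeta_\sigma^2+t\,\|\nabla v_0\|_\sigma,\qquad \zeta_\sigma\le\frac{\zeta_\sigma^3}{6}+\frac{\zeta_\sigma^2}{\sqrt2}+t\,\Gamma_\sigma,$$ and $\zeta_\sigma$ is bounded on $[0,T_c/\Gamma_\sigma)$. (iii) There is a function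 $X$ of $(z,\tau)\in\mathbb C^3\times\mathbb C$ with values in $\mathbb C^3$ such that $X(a,t)=x(a,t)$ for all $a\in\mathbb R^3$ and $0\le t<\min(T,T_c/\Gamma_0)$, and such that: - for every $\sigma>0$ with $\Gamma_\sigma<\infty$, $X$ is jointly analytic in space and time on $\{|\mathrm{Im}\,z|<\sigma,\ |\tau|<T_c/\Gamma_\sigma\}$, so that for these times the singularities of the Lagrangian map, if any, lie at distance at least $\sigma$ from the real space; - $X$ is jointly analytic at every point $(a,\tau)$ with $a\in\mathbb R^3$, $\tau\in\mathbb C$, $|\tau|<T_c/\Gamma_0$, so that the Lagrangian map is spatio-temporally analytic for $t<T_c/\Gamma_0$. -/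

import Mathlib

open Set MeasureTheory
open scoped ENNReal Nat Real

noncomputable section

namespace PeriodicEuler

/-- Real Euclidean three-space. -/
abbrev E3 : Type := EuclideanSpace ℝ (Fin 3)

/-- Complex three-space with its Hermitian norm. -/
abbrev C3 : Type := EuclideanSpace ℂ (Fin 3)

/-- The point of `C3` with real coordinates `a`. -/
def toC3 (a : E3) : C3 := WithLp.toLp 2 fun i => (a i : ℂ)

/-- The imaginary part of `z`; its norm is the distance from `z` to the real space. -/
def imPart (z : C3) : E3 := WithLp.toLp 2 fun i => (z i).im

/-- The function `f` is `2π`-periodic in each of the three coordinates. -/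
def IsPeriodic {F : Type*} (f : E3 → F) : Prop :=
  ∀ (i : Fin 3) (a : E3), f (a + EuclideanSpace.single i (2 * π)) = f a

/-- The partial derivative `∂ᵢ f`. -/
def partialD {F : Type*} [NormedAddCommGroup F] [NormedSpace ℝ F] (i : Fin 3) (f : E3 → F)
    (a : E3) : F :=
  fderiv ℝ f a (EuclideanSpace.single i 1)

/-- The divergence of a vector field. -/
def divergence (f : E3 → E3) (a : E3) : ℝ := ∑ i, partialD i f a i

/-- The curl of a vector field. -/
def curl (f : E3 → E3) (a : E3) : E3 :=
  !₂[partialD 1 f a 2 - partialD 2 f a 1,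
     partialD 2 f a 0 - partialD 0 f a 2,
     partialD 0 f a 1 - partialD 1 f a 0]

/-! ### Fourier coefficients and Gevrey norms -/

/-- The periodicity cell `[0, 2π]³`. -/
def cell : Set E3 := {a | ∀ i, a i ∈ Icc 0 (2 * π)}

/-- The Euclidean length `|p|` of an integer wave vector. -/
def waveLength (p : Fin 3 → ℤ) : ℝ := √(∑ i, (p i : ℝ) ^ 2)

/-- The Fourier coefficient `(2π)⁻³ ∫ f(a) e^{-i p·a} da` of a real function. -/
def fourierCoef (f : E3 → ℝ) (p : Fin 3 → ℤ) : ℂ :=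
  ((2 * π : ℂ) ^ 3)⁻¹ *
    ∫ a in cell, (f a : ℂ) * Complex.exp (-Complex.I * ∑ i, (p i : ℂ) * (a i : ℂ))

/-- The Fourier coefficient of a real vector field, a vector of `C3`. -/
def fourierCoefVec (f : E3 → E3) (p : Fin 3 → ℤ) : C3 :=
  WithLp.toLp 2 fun j => fourierCoef (fun a => f a j) p

/-- `∑ₚ e^{σ|p|} |f̂ₚ|` for a scalar function, as an extended nonnegative real. -/
def gevreyNorm (σ : ℝ) (f : E3 → ℝ) : ℝ≥0∞ :=
  ∑' p : Fin 3 → ℤ, ENNReal.ofReal (Real.exp (σ * waveLength p)) * ‖fourierCoef f p‖ₑ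

/-- The norm `max_{i,j} ‖∂ᵢ fⱼ‖_σ` of the gradient of a vector field. -/
def gradGevreyNorm (σ : ℝ) (f : E3 → E3) : ℝ≥0∞ :=
  ⨆ (i : Fin 3) (j : Fin 3), gevreyNorm σ (fun a => partialD i f a j)

/-- `Γ_σ = ∑ₚ e^{σ|p|} |ω̂ₚ|`, where `ω` is the vorticity of the velocity field `v₀`
and `|ω̂ₚ|` is the Hermitian norm in `C3`. -/
def vorticityGevrey (v₀ : E3 → E3) (σ : ℝ) : ℝ≥0∞ :=
  ∑' p : Fin 3 → ℤ,
    ENNReal.ofReal (Real.exp (σ * waveLength p)) * ‖fourierCoefVec (curl v₀) p‖ₑ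

/-- The critical dimensionless time `T_c = (8 - 5√2)/3 ≈ 0.3096`. -/
def criticalT : ℝ≥0∞ := ENNReal.ofReal ((8 - 5 * √2) / 3)

/-- The time `T_c / Γ_σ`, infinite if `Γ_σ = 0` (and zero if `Γ_σ = ∞`). -/
def criticalTime (v₀ : E3 → E3) (σ : ℝ) : ℝ≥0∞ := criticalT / vorticityGevrey v₀ σ

/-! ### Euler flow and its Lagrangian map -/

/-- The time interval `[0, T)`, with `T ≤ ∞`. -/
def timeInterval (T : ℝ≥0∞) : Set ℝ := {t | 0 ≤ t ∧ ENNReal.ofReal t < T}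

/-- `(v, p)` is a classical space-periodic solution, on the time interval `[0, T)`, of the
incompressible Euler equations with initial velocity `v₀`. -/
structure IsEulerSolution (v₀ : E3 → E3) (T : ℝ≥0∞) (v : ℝ → E3 → E3) (p : ℝ → E3 → ℝ) :
    Prop where
  velocity_C1 : ContDiffOn ℝ 1 (fun y : ℝ × E3 => v y.1 y.2) (timeInterval T ×ˢ univ)
  pressure_C1 : ∀ t ∈ timeInterval T, ContDiff ℝ 1 (p t)
  velocity_periodic : ∀ t ∈ timeInterval T, IsPeriodic (v t)
  pressure_periodic : ∀ t ∈ timeInterval T, IsPeriodic (p t)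
  momentum : ∀ t ∈ timeInterval T, ∀ y : E3,
    HasDerivWithinAt (fun τ => v τ y) (-(fderiv ℝ (v t) y (v t y)) - gradient (p t) y)
      (timeInterval T) t
  incompressible : ∀ t ∈ timeInterval T, ∀ y : E3, divergence (v t) y = 0
  initial : v 0 = v₀

/-- `x` is the Lagrangian map of the velocity field `v` on the time interval `[0, T)`:
`∂ₜ x(t, a) = v(t, x(t, a))` and `x(0, a) = a`. -/
structure IsLagrangianMap (T : ℝ≥0∞) (v : ℝ → E3 → E3) (x : ℝ → E3 → E3) : Prop where
  initial : ∀ a, x 0 a = a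
  trajectory : ∀ a, ∀ t ∈ timeInterval T,
    HasDerivWithinAt (fun τ => x τ a) (v t (x t a)) (timeInterval T) t

/-- The `s`-th Taylor coefficient `ξ⁽ˢ⁾(a)`, at time `0`, of the displacement `x(t, a) - a` of a map
given on `[0, T)`. -/
def displacementCoef (T : ℝ≥0∞) (x : ℝ → E3 → E3) (s : ℕ) (a : E3) : E3 :=
  ((s ! : ℝ)⁻¹) • iteratedDerivWithin s (fun t => x t a - a) (timeInterval T) 0

/-- The generating function `∑_{s ≥ 1} ‖∇ ξ⁽ˢ⁾‖_σ tˢ` of a sequence of vector fields. -/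
def gradGenFun (ξ : ℕ → E3 → E3) (σ t : ℝ) : ℝ≥0∞ :=
  ∑' s : ℕ, gradGevreyNorm σ (ξ (s + 1)) * ENNReal.ofReal t ^ (s + 1)

/-- The generating function `∑_{s ≥ 1} (∑ₚ |p| e^{σ|p|} |ξ̂⁽ˢ⁾ₚ|) tˢ`. -/
def fourierGenFun (ξ : ℕ → E3 → E3) (σ t : ℝ) : ℝ≥0∞ :=
  ∑' s : ℕ, (∑' p : Fin 3 → ℤ,
      ENNReal.ofReal (waveLength p * Real.exp (σ * waveLength p)) *
        ‖fourierCoefVec (ξ (s + 1)) p‖ₑ) * ENNReal.ofReal t ^ (s + 1)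

/-- The complex space-time domain `{(z, τ) : |Im z| < σ, |τ| < T_c / Γ_σ}`. -/
def complexDomain (v₀ : E3 → E3) (σ : ℝ) : Set (C3 × ℂ) :=
  {y | ‖imPart y.1‖ < σ ∧ ‖y.2‖ₑ < criticalTime v₀ σ}

end PeriodicEuler

end

open PeriodicEuler

open Set MeasureTheory
open scoped ENNReal Nat Real

noncomputable section

namespace PeriodicEuler

section

/-! ### Integration over the periodicity cell -/

section Periodic

/-! In Lagrangian coordinates the Euler equations say that `det ∇x = 1` and that Cauchy's invariants
`∑ₗ ∇ẋₗ × ∇xₗ` keep their initial value, the vorticity. With `x = a + ξ` expanded in powers of `t`,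
this becomes a recursion: the divergence and the curl of `ξ⁽ˢ⁾` are quadratic and cubic expressions
in the gradients of lower orders. Recovering a gradient from a divergence and a curl is an operation
of order zero: on a Fourier mode, `|p| |ξ̂ₚ|` is at most the Euclidean norm of the pair (divergence,
curl), see `norm_helmholtz_le`. Hence no derivative is lost from one order to the next, which is why
the flow is analytic in time.

The solution is therefore constructed: `xi` is defined by the recursion in Fourier space. The
weights `e^{σ|p|} tˢ` are submultiplicative, so convolutions are bounded by products, and the
generating function satisfies `ζ ≤ tΓ + ζ²/√2 + ζ³/6` (`modeGenFun_xi_le`). The polynomial `ζ -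
ζ²/√2 - ζ³/6` has maximum `T_c` on `ζ ≥ 0`, attained at `2 - √2`, and induction on the order of
truncation keeps `ζ ≤ 2 - √2` as long as `tΓ ≤ T_c` (`modeGenFun_xi_le_of_le`). Estimating entry by
entry instead of mode by mode gives the inequality with constants 6 and 12 (`gradSeries_xi_le`).

Absolute convergence makes the sum of the series jointly analytic in complex space-time
(`analyticAt_series`). Summing the recursion back gives `det ∇x = 1` (`trace_gradTerm`) and the
closedness of the form `⟨ẍ, dx⟩` (`closed_accTerm`). The displacement has Lipschitz constant at most
`ζ₀ ≤ 2 - √2 < 1`, so `a ↦ x` is invertible and an Eulerian velocity exists. Differentiating `det ∇x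
= 1` in time makes it divergence-free. The closed form has a potential, which is periodic because
the acceleration has mean zero and the cofactors of `∇x` have the identity as mean
(`exists_periodic_potential`); minus this potential is the pressure.

An energy estimate shows that classical solutions are unique (`IsEulerSolution.unique`), and so are
their trajectories. Every Lagrangian map with the given data thus agrees with the constructed one on
the common time interval, and its Taylor coefficients at time zero are those of the recursion.
Finally, analyticity of `v₀` makes `Γ_σ` finite for some `σ > 0`, and convexity of the exponential
makes `Γ` continuous enough at `σ = 0` that each `t < T_c/Γ₀` still admits a strip of positive width
(`exists_gevrey_index`). -/

theorem IsPeriodic.comp {F G : Type*} {f : E3 → F} (hp : IsPeriodic f) (g : F → G) :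
    IsPeriodic (fun a => g (f a)) := fun i a => congrArg g (hp i a)

theorem IsPeriodic.add_zsmul {F : Type*} {f : E3 → F} (hp : IsPeriodic f) (i : Fin 3) (n : ℤ) (a : E3) :
    f (a + EuclideanSpace.single i (n * (2 * π))) = f a := by
  have h : Function.Periodic f (EuclideanSpace.single i (2 * π)) := hp i
  have := h.zsmul n a
  have e : n • EuclideanSpace.single (𝕜 := ℝ) i (2 * π) =
      EuclideanSpace.single i (n * (2 * π)) := by
    ext j
    by_cases h : j = i <;> simp [h]
  rwa [e] at this

/-- Every point is congruent to a point of the cell. -/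
theorem exists_mem_cell {F : Type*} (a : E3) :
    ∃ b ∈ cell, ∀ f : E3 → F, IsPeriodic f → f b = f a := by
  have hπ : 0 < 2 * π := by positivity
  set n : Fin 3 → ℤ := fun i => -⌊a i / (2 * π)⌋ with hn
  refine ⟨(a + EuclideanSpace.single 0 (n 0 * (2 * π)) + EuclideanSpace.single 1 (n 1 * (2 * π)) +
    EuclideanSpace.single 2 (n 2 * (2 * π)) : E3), fun i => ?_, fun f hf => ?_⟩
  · have h1 : (a + EuclideanSpace.single 0 (n 0 * (2 * π)) +
        EuclideanSpace.single 1 (n 1 * (2 * π)) + EuclideanSpace.single 2 (n 2 * (2 * π)) : E3) i =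
        Int.fract (a i / (2 * π)) * (2 * π) := by
      have h2 : a i = a i / (2 * π) * (2 * π) := by field_simp
      fin_cases i <;>
      · simp only [← Int.self_sub_floor, sub_mul, ← h2, hn]
        simp
        ring
    rw [h1]
    exact ⟨mul_nonneg (Int.fract_nonneg _) hπ.le,
      mul_le_of_le_one_left hπ.le (Int.fract_lt_one _).le⟩
  · rw [hf.add_zsmul, hf.add_zsmul, hf.add_zsmul]

end Periodic

section Cell

variable {F : Type*} [NormedAddCommGroup F] [NormedSpace ℝ F]

theorem isCompact_cell : IsCompact cell := by
  have h : cell = WithLp.ofLp (p := 2) ⁻¹' (Icc 0 (fun _ : Fin 3 => 2 * π)) := by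
    ext a
    simp [cell, Pi.le_def, forall_and]
  rw [h]
  exact (PiLp.homeomorph 2 (fun _ : Fin 3 => ℝ)).isCompact_preimage.2 isCompact_Icc

theorem measurableSet_cell : MeasurableSet cell := isCompact_cell.measurableSet

theorem setIntegral_cell (f : E3 → F) :
    ∫ a in cell, f a = ∫ x in Icc 0 (fun _ : Fin 3 => 2 * π), f (WithLp.toLp 2 x) := by
  have h : WithLp.toLp (V := Fin 3 → ℝ) 2 ⁻¹' cell = Icc 0 (fun _ : Fin 3 => 2 * π) := by
    ext a
    simp [cell, Pi.le_def, forall_and]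
  rw [← h, (PiLp.volume_preserving_toLp (Fin 3)).setIntegral_preimage_emb
    (MeasurableEquiv.toLp 2 (Fin 3 → ℝ)).measurableEmbedding]

theorem volume_cell : volume cell = ENNReal.ofReal ((2 * π) ^ 3) := by
  have h : WithLp.toLp (V := Fin 3 → ℝ) 2 ⁻¹' cell = Icc 0 (fun _ : Fin 3 => 2 * π) := by
    ext a
    simp [cell, Pi.le_def, forall_and]
  rw [← (PiLp.volume_preserving_toLp (Fin 3)).measure_preimage_emb
    (MeasurableEquiv.toLp 2 (Fin 3 → ℝ)).measurableEmbedding, h, Real.volume_Icc_pi]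
  simp [ENNReal.ofReal_pow, Real.pi_pos.le]

omit [NormedSpace ℝ F] in
theorem integrableOn_cell {f : E3 → F} (hf : Continuous f) : IntegrableOn f cell :=
  hf.continuousOn.integrableOn_compact isCompact_cell

theorem continuous_partialD {f : E3 → F} (hf : ContDiff ℝ 1 f) (i : Fin 3) :
    Continuous (partialD i f) :=
  (hf.continuous_fderiv one_ne_zero).clm_apply continuous_const

/-- The divergence theorem on the cube, for the field whose only nonzero component is `f` in
direction `i`: opposite faces cancel by periodicity. All later integrations by parts rest on this.
-/
theorem integral_cell_partialD {f : E3 → F} (hf : ContDiff ℝ 1 f) (hp : IsPeriodic f) (i : Fin 3) :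
    ∫ a in cell, partialD i f a = 0 := by
  rw [setIntegral_cell]
  let e : E3 ≃L[ℝ] (Fin 3 → ℝ) := PiLp.continuousLinearEquiv 2 ℝ (fun _ : Fin 3 => ℝ)
  have hd : ∀ x : Fin 3 → ℝ, HasFDerivAt (fun x => f (WithLp.toLp 2 x))
      ((fderiv ℝ f (WithLp.toLp 2 x)) ∘L (e.symm : (Fin 3 → ℝ) →L[ℝ] E3)) x := fun x =>
    ((hf.differentiable one_ne_zero _).hasFDerivAt).comp x
      (e.symm : (Fin 3 → ℝ) →L[ℝ] E3).hasFDerivAt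
  have key := integral_divergence_of_hasFDerivAt_off_countable' (E := F) (n := 2)
    (0 : Fin 3 → ℝ) (fun _ => 2 * π) (fun _ => by simp [Real.pi_pos.le])
    (fun j x => if j = i then f (WithLp.toLp 2 x) else 0)
    (fun j x => if j = i then (fderiv ℝ f (WithLp.toLp 2 x)) ∘L
      (e.symm : (Fin 3 → ℝ) →L[ℝ] E3) else 0) ∅ countable_empty
    (fun j => by
      split_ifs
      · exact (hf.continuous.comp e.symm.continuous).continuousOn
      · exact continuousOn_const)
    (fun x _ j => by
      split_ifs
      · exact hd x
      · exact hasFDerivAt_const _ _)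
    (by
      refine Continuous.integrableOn_Icc ?_
      refine continuous_finsetSum _ fun j _ => ?_
      split_ifs
      · exact (((hf.continuous_fderiv one_ne_zero).comp e.symm.continuous).clm_comp
          continuous_const).clm_apply continuous_const
      · exact continuous_const)
  have hl : ∀ x : Fin 3 → ℝ, (∑ j, (if j = i then (fderiv ℝ f (WithLp.toLp 2 x)) ∘L
      (e.symm : (Fin 3 → ℝ) →L[ℝ] E3) else 0) (Pi.single j 1)) =
      partialD i f (WithLp.toLp 2 x) := by
    intro x
    rw [Finset.sum_eq_single i (fun j _ hj => by simp [hj]) (by simp)]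
    simp only [if_true, partialD]
    rfl
  simp only [hl] at key
  rw [key]
  refine Finset.sum_eq_zero fun j _ => ?_
  rw [sub_eq_zero]
  congr 1
  ext y
  split_ifs with h
  · subst h
    refine Eq.trans ?_ (hp j _)
    congr 1
    ext l
    rcases Fin.eq_self_or_eq_succAbove j l with rfl | ⟨m, rfl⟩
    · simp
    · simp [Fin.succAbove_ne]
  · rfl

theorem IsPeriodic.partialD {f : E3 → F} (hp : IsPeriodic f) (j : Fin 3) :
    IsPeriodic (partialD j f) := fun i a => by
  unfold PeriodicEuler.partialD
  rw [← fderiv_comp_add_right]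
  congr 2
  funext b
  exact hp i b

theorem IsPeriodic.fderiv {f : E3 → F} (hp : IsPeriodic f) :
    IsPeriodic (fderiv ℝ f) := fun i a => by
  rw [← fderiv_comp_add_right]
  congr 1
  funext b
  exact hp i b

end Cell

/-! ### Characters and Fourier coefficients -/

/-- The character `e^{i p·z}` on complex space. -/
def character (p : Fin 3 → ℤ) (z : C3) : ℂ := Complex.exp (Complex.I * ∑ j, (p j : ℂ) * z j)

theorem character_add (p q : Fin 3 → ℤ) (z : C3) :
    character (p + q) z = character p z * character q z := by
  rw [character, character, character, ← Complex.exp_add, ← mul_add, ← Finset.sum_add_distrib]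
  simp [add_mul]

theorem character_zero (z : C3) : character 0 z = 1 := by simp [character]

theorem norm_character_toC3 (p : Fin 3 → ℤ) (a : E3) : ‖character p (toC3 a)‖ = 1 := by
  have h : Complex.I * ∑ j, (p j : ℂ) * (toC3 a) j = ((∑ j, (p j : ℝ) * a j : ℝ) : ℂ) * Complex.I := by
    simp [toC3, mul_comm]
  rw [character, h, Complex.norm_exp_ofReal_mul_I]

theorem hasFDerivAt_character_toC3 (p : Fin 3 → ℤ) (a : E3) :
    HasFDerivAt (fun a => character p (toC3 a))
      ((Complex.I * character p (toC3 a)) • ∑ j, (p j : ℂ) •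
        (Complex.ofRealCLM ∘L (EuclideanSpace.proj j : E3 →L[ℝ] ℝ))) a := by
  have h1 : HasFDerivAt (fun a : E3 => Complex.I * ∑ j, (p j : ℂ) * (toC3 a) j)
      (Complex.I • ∑ j, (p j : ℂ) •
        (Complex.ofRealCLM ∘L (EuclideanSpace.proj j : E3 →L[ℝ] ℝ))) a := by
    refine HasFDerivAt.const_mul (HasFDerivAt.fun_sum fun j _ => HasFDerivAt.const_mul ?_ _) _
    exact (Complex.ofRealCLM ∘L (EuclideanSpace.proj j : E3 →L[ℝ] ℝ)).hasFDerivAt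
  have h2 := h1.cexp
  refine h2.congr_fderiv ?_
  rw [smul_smul, mul_comm]
  rfl

theorem contDiff_character_toC3 (p : Fin 3 → ℤ) {n : WithTop ℕ∞} :
    ContDiff ℝ n (fun a => character p (toC3 a)) := by
  unfold character
  refine ContDiff.cexp (contDiff_const.mul (ContDiff.sum fun j _ => contDiff_const.mul ?_))
  exact (Complex.ofRealCLM ∘L (EuclideanSpace.proj j : E3 →L[ℝ] ℝ)).contDiff

theorem partialD_character (p : Fin 3 → ℤ) (j : Fin 3) (a : E3) :
    partialD j (fun a => character p (toC3 a)) a =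
      Complex.I * p j * character p (toC3 a) := by
  rw [partialD, (hasFDerivAt_character_toC3 p a).fderiv]
  simp only [smul_apply, sum_apply, ContinuousLinearMap.comp_apply,
    PiLp.proj_apply, PiLp.single_apply, smul_eq_mul, Complex.ofRealCLM_apply]
  rw [Finset.sum_eq_single j (fun l _ hl => by simp [hl]) (by simp)]
  simp
  ring

theorem isPeriodic_character (p : Fin 3 → ℤ) : IsPeriodic (fun a => character p (toC3 a)) := by
  intro i a
  have h : Complex.I * ∑ j, (p j : ℂ) * (toC3 (a + EuclideanSpace.single i (2 * π))) j =
      Complex.I * ∑ j, (p j : ℂ) * (toC3 a) j + (p i : ℂ) * (2 * π * Complex.I) := by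
    simp only [toC3, PiLp.add_apply, Complex.ofReal_add, mul_add, Finset.sum_add_distrib]
    congr 1
    rw [Finset.sum_eq_single i (fun l _ hl => by simp [hl]) (by simp)]
    simp
    ring
  simp only [character]
  rw [h, Complex.exp_add, Complex.exp_int_mul_two_pi_mul_I, mul_one]

/-- The Fourier coefficient of a complex function. -/
def fourierCoefC (f : E3 → ℂ) (p : Fin 3 → ℤ) : ℂ :=
  ((2 * π : ℂ) ^ 3)⁻¹ * ∫ a in cell, f a * character (-p) (toC3 a)

theorem fourierCoef_eq (f : E3 → ℝ) (p : Fin 3 → ℤ) :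
    fourierCoef f p = fourierCoefC (fun a => (f a : ℂ)) p := by
  simp [fourierCoef, fourierCoefC, character, toC3]

theorem partialD_ofReal {f : E3 → ℝ} (hf : Differentiable ℝ f) (j : Fin 3) (a : E3) :
    partialD j (fun a => (f a : ℂ)) a = (partialD j f a : ℝ) := by
  have := (Complex.ofRealCLM.hasFDerivAt (x := f a)).comp a (hf a).hasFDerivAt
  rw [partialD, show (fun a => (f a : ℂ)) = Complex.ofRealCLM ∘ f from rfl, this.fderiv]
  rfl

theorem partialD_mul {f g : E3 → ℂ} (hf : Differentiable ℝ f) (hg : Differentiable ℝ g)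
    (j : Fin 3) (a : E3) :
    partialD j (fun a => f a * g a) a = partialD j f a * g a + f a * partialD j g a := by
  rw [partialD, fderiv_fun_mul (hf a) (hg a)]
  simp [partialD]
  ring

theorem fourierCoefC_partialD {f : E3 → ℂ} (hf : ContDiff ℝ 1 f) (hp : IsPeriodic f) (j : Fin 3)
    (p : Fin 3 → ℤ) :
    fourierCoefC (partialD j f) p = Complex.I * p j * fourierCoefC f p := by
  have hc := contDiff_character_toC3 (-p) (n := 1)
  have h := integral_cell_partialD (hf.mul hc)
    (fun i a => congrArg₂ (· * ·) (hp i a) (isPeriodic_character (-p) i a)) j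
  simp only [partialD_mul (hf.differentiable one_ne_zero) (hc.differentiable one_ne_zero),
    partialD_character] at h
  have e1 : IntegrableOn (fun a => partialD j f a * character (-p) (toC3 a)) cell :=
    integrableOn_cell ((continuous_partialD hf j).mul hc.continuous)
  have e2 : IntegrableOn
      (fun a => f a * (Complex.I * ((-p) j : ℤ) * character (-p) (toC3 a))) cell :=
    integrableOn_cell (hf.continuous.mul (continuous_const.mul hc.continuous))
  rw [integral_add e1 e2] at h
  have h2 : ∀ a : E3, f a * (Complex.I * ((-p) j : ℤ) * character (-p) (toC3 a)) =
      (-(Complex.I * p j)) * (f a * character (-p) (toC3 a)) := fun a => by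
    simp; ring
  simp only [h2] at h
  rw [integral_const_mul] at h
  rw [fourierCoefC, fourierCoefC, eq_neg_of_add_eq_zero_left h]
  ring

/-- If `p j ≠ 0`, the character is, up to the factor `i pⱼ`, its own derivative in direction `j`,
and derivatives of periodic functions integrate to zero. -/
theorem integral_cell_character (p : Fin 3 → ℤ) :
    ∫ a in cell, character p (toC3 a) = if p = 0 then (2 * π : ℂ) ^ 3 else 0 := by
  split_ifs with h
  · simp [h, character_zero, Measure.real, volume_cell, Real.pi_pos.le]
  · obtain ⟨j, hj⟩ := Function.ne_iff.1 h
    have := integral_cell_partialD (contDiff_character_toC3 p) (isPeriodic_character p) j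
    simp only [partialD_character] at this
    rw [integral_const_mul] at this
    simpa [Complex.I_ne_zero, show p j ≠ 0 from hj] using this

theorem two_pi_cube_ne_zero : ((2 * π : ℂ) ^ 3) ≠ 0 := by
  simp [Real.pi_ne_zero]

theorem continuous_character_toC3 (p : Fin 3 → ℤ) : Continuous fun a => character p (toC3 a) :=
  (contDiff_character_toC3 p (n := 0)).continuous

/-- The Fourier coefficients of an absolutely convergent Fourier series. -/
theorem fourierCoefC_tsum {c : (Fin 3 → ℤ) → ℂ} (hc : Summable fun p => ‖c p‖) (q : Fin 3 → ℤ) :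
    fourierCoefC (fun a => ∑' p, c p * character p (toC3 a)) q = c q := by
  have h1 : ∀ a : E3, (∑' p, c p * character p (toC3 a)) * character (-q) (toC3 a) =
      ∑' p, c p * character (p - q) (toC3 a) := fun a => by
    rw [← tsum_mul_right]
    exact tsum_congr fun p => by rw [mul_assoc, ← character_add, sub_eq_add_neg]
  have : IsFiniteMeasure (volume.restrict cell) :=
    ⟨by simpa using isCompact_cell.measure_lt_top⟩
  rw [fourierCoefC]
  simp only [h1]
  rw [← integral_tsum_of_summable_integral_norm (F := fun p a => c p * character (p - q) (toC3 a))
    (fun p => integrableOn_cell (continuous_const.mul (continuous_character_toC3 _)))]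
  · simp only [integral_const_mul, integral_cell_character, sub_eq_zero]
    rw [tsum_eq_single q (fun p hp => by simp [hp])]
    simp only [if_true]
    field_simp [two_pi_cube_ne_zero]
  · simp only [norm_mul, norm_character_toC3, mul_one, integral_const]
    exact hc.const_smul _

end

section

/-! ### Fourier inversion -/

/-- A periodic function induces a function on the unit torus. -/
theorem exists_torus_lift {f : E3 → ℂ} (hf : Continuous f) (hp : IsPeriodic f) :
    ∃ g : C(UnitAddTorus (Fin 3), ℂ), ∀ x : Fin 3 → ℝ,
      g (fun i => (x i : UnitAddCircle)) = f (WithLp.toLp 2 fun i => 2 * π * x i) := by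
  let F0 : (Fin 3 → ℝ) → ℂ := fun x => f (WithLp.toLp 2 fun i => 2 * π * x i)
  have hF0 : Continuous F0 := hf.comp ((PiLp.continuous_toLp 2 _).comp (by fun_prop))
  let q : (Fin 3 → ℝ) → UnitAddTorus (Fin 3) := Pi.map fun _ x => (x : UnitAddCircle)
  have hq : IsOpenQuotientMap q :=
    IsOpenQuotientMap.piMap fun _ => QuotientAddGroup.isOpenQuotientMap_mk
  have hwd : ∀ x y, q x = q y → F0 x = F0 y := by
    intro x y hxy
    have h : ∀ i, ∃ n : ℤ, x i = y i + n := fun i => by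
      have h1 : ((x i : ℝ) : UnitAddCircle) = (y i : ℝ) := congrFun hxy i
      obtain ⟨n, hn⟩ := (AddCircle.coe_eq_zero_iff (1 : ℝ) (x := x i - y i)).1
        (by rw [AddCircle.coe_sub, h1, sub_self])
      exact ⟨n, by simp at hn; linarith⟩
    choose n hn using h
    have : (WithLp.toLp 2 fun i => 2 * π * x i : E3) = (WithLp.toLp 2 fun i => 2 * π * y i) +
        EuclideanSpace.single 0 (n 0 * (2 * π)) + EuclideanSpace.single 1 (n 1 * (2 * π)) +
        EuclideanSpace.single 2 (n 2 * (2 * π)) := by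
      ext i
      fin_cases i <;>
      · simp [hn]
        ring
    simp only [F0]
    rw [this, hp.add_zsmul, hp.add_zsmul, hp.add_zsmul]
  have hg : ∀ x, F0 (Function.surjInv hq.surjective (q x)) = F0 x := fun x =>
    hwd _ _ (Function.surjInv_eq hq.surjective _)
  -- By `hwd` any choice of representatives gives the same function; continuity is tested after
  -- composition with the quotient map `q`.
  refine ⟨⟨fun y => F0 (Function.surjInv hq.surjective y), ?_⟩, hg⟩
  rw [hq.isQuotientMap.continuous_iff]
  convert hF0 using 1
  funext x
  exact hg x

theorem mFourier_coe (p : Fin 3 → ℤ) (x : Fin 3 → ℝ) :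
    UnitAddTorus.mFourier p (fun i => (x i : UnitAddCircle)) =
      character p (toC3 (WithLp.toLp 2 fun i => 2 * π * x i)) := by
  simp only [UnitAddTorus.mFourier, ContinuousMap.coe_mk, fourier_coe_apply, character, toC3,
    ← Complex.exp_sum, Finset.mul_sum]
  congr 1
  refine Finset.sum_congr rfl fun i _ => ?_
  push_cast
  ring

open scoped Pointwise in
-- The dilation by `2π` transports the cell to the unit torus, where Fourier inversion for summable
-- coefficients applies.
theorem hasSum_fourierCoefC {f : E3 → ℂ} (hf : Continuous f) (hp : IsPeriodic f)
    (hs : Summable fun p => ‖fourierCoefC f p‖) (a : E3) :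
    HasSum (fun p => fourierCoefC f p * character p (toC3 a)) (f a) := by
  obtain ⟨g, hg⟩ := exists_torus_lift hf hp
  have hπ : (2 * π) ≠ 0 := by positivity
  have hc : ∀ p, UnitAddTorus.mFourierCoeff g p = fourierCoefC f p := by
    intro p
    rw [UnitAddTorus.mFourierCoeff_eq_integral g p 0]
    simp only [hg, mFourier_coe, Pi.zero_apply, zero_add]
    have e1 : {x : Fin 3 → ℝ | ∀ i, x i ∈ Ioc (0 : ℝ) 1} = univ.pi fun i => Ioc 0 1 := by
      ext; simp
    have e2 : ((2 * π) • Icc (0 : Fin 3 → ℝ) (fun _ => 1) : Set (Fin 3 → ℝ)) =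
        Icc 0 (fun _ => 2 * π) := by
      ext x
      rw [mem_smul_set_iff_inv_smul_mem₀ hπ]
      simp only [mem_Icc, Pi.le_def, Pi.smul_apply, smul_eq_mul, Pi.zero_apply]
      refine and_congr (forall_congr' fun i => ?_) (forall_congr' fun i => ?_)
      · rw [mul_nonneg_iff_of_pos_left (by positivity)]
      · rw [inv_mul_le_iff₀ (by positivity), mul_one]
    have e3 : (univ.pi fun _ : Fin 3 => Ioc (0 : ℝ) 1) =ᵐ[volume] Icc (0 : Fin 3 → ℝ) fun _ => 1 :=
      Measure.univ_pi_Ioc_ae_eq_Icc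
    rw [e1, setIntegral_congr_set e3]
    have := Measure.setIntegral_comp_smul (volume : Measure (Fin 3 → ℝ))
      (fun x => character (-p) (toC3 (WithLp.toLp 2 x)) • f (WithLp.toLp 2 x))
      (Icc 0 (fun _ => 1)) hπ
    rw [e2] at this
    refine this.trans ?_
    rw [fourierCoefC, setIntegral_cell]
    simp only [Module.finrank_fintype_fun_eq_card, Fintype.card_fin, smul_eq_mul,
      Complex.real_smul]
    rw [abs_of_pos (by positivity)]
    push_cast
    simp only [mul_comm (f _)]
  have h1 := UnitAddTorus.hasSum_mFourier_series_apply_of_summable (f := g)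
    (by rw [funext hc]; exact hs.of_norm) (fun i => ((a i / (2 * π) : ℝ) : UnitAddCircle))
  have h2 : (WithLp.toLp 2 fun i => 2 * π * (a i / (2 * π)) : E3) = a := by
    ext i
    simp
    field_simp
  simpa only [hc, hg, mFourier_coe, h2, smul_eq_mul] using h1

/-! ### Exponential decay of the Fourier coefficients of an analytic function -/

theorem abs_le_waveLength (p : Fin 3 → ℤ) (j : Fin 3) : |(p j : ℝ)| ≤ waveLength p :=
  Real.abs_le_sqrt (Finset.single_le_sum (f := fun i => (p i : ℝ) ^ 2)
    (fun _ _ => sq_nonneg _) (Finset.mem_univ j))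

theorem exists_waveLength_le (p : Fin 3 → ℤ) : ∃ j, waveLength p ≤ 2 * |(p j : ℝ)| := by
  obtain ⟨j, -, hj⟩ := Finset.exists_max_image Finset.univ (fun i => |(p i : ℝ)|) ⟨0, by simp⟩
  refine ⟨j, Real.sqrt_le_iff.2 ⟨by positivity, ?_⟩⟩
  have : ∀ i, (p i : ℝ) ^ 2 ≤ |(p j : ℝ)| ^ 2 := fun i => by
    rw [← sq_abs]
    exact pow_le_pow_left₀ (abs_nonneg _) (hj i (Finset.mem_univ i)) 2
  rw [Fin.sum_univ_three]
  nlinarith [this 0, this 1, this 2, sq_nonneg |(p j : ℝ)|]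

theorem waveLength_nonneg (p : Fin 3 → ℤ) : 0 ≤ waveLength p := Real.sqrt_nonneg _

theorem summable_prod_int {f : ℤ → ℝ} (hf : Summable f) (h0 : ∀ n, 0 ≤ f n) (n : ℕ) :
    Summable fun p : Fin n → ℤ => ∏ i, f (p i) := by
  induction n with
  | zero => exact Summable.of_finite
  | succ n ih =>
    rw [← (Fin.consEquiv fun _ => ℤ).summable_iff]
    refine (hf.mul_of_nonneg ih h0 fun p => Finset.prod_nonneg fun i _ => h0 _).congr fun x => ?_
    simp [Fin.consEquiv, Fin.prod_univ_succ]

/-- Since each `|pⱼ| ≤ |p|`, the term is at most the product of the three factors `e^{-ε|pⱼ|/3}`,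
each of which is summable over the integers. -/
theorem summable_exp_neg_waveLength {ε : ℝ} (hε : 0 < ε) :
    Summable fun p : Fin 3 → ℤ => Real.exp (-ε * waveLength p) := by
  have hr : Real.exp (-(ε / 3)) < 1 := by rw [Real.exp_lt_one_iff]; linarith
  have h1 : Summable fun n : ℤ => Real.exp (-(ε / 3) * |(n : ℝ)|) := by
    have h2 : Summable fun n : ℕ => Real.exp (-(ε / 3) * |(n : ℝ)|) := by
      refine (summable_geometric_of_lt_one (Real.exp_pos _).le hr).congr fun n => ?_
      rw [← Real.exp_nat_mul, Nat.abs_cast, mul_comm]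
    exact Summable.of_nat_of_neg (by simpa using h2) (by simpa using h2)
  refine (summable_prod_int h1 (fun _ => (Real.exp_pos _).le) 3).of_nonneg_of_le
    (fun _ => (Real.exp_pos _).le) fun p => ?_
  rw [← Real.exp_sum, Fin.sum_univ_three]
  refine Real.exp_le_exp.2 ?_
  nlinarith [abs_le_waveLength p 0, abs_le_waveLength p 1, abs_le_waveLength p 2]

/-- Local Cauchy estimates for a real analytic function. -/
theorem exists_iteratedFDeriv_le_nhds {f : E3 → ℝ} {a : E3} (hf : AnalyticAt ℝ f a) :
    ∃ s ∈ nhds a, ∃ C ρ : ℝ, 0 ≤ C ∧ 0 < ρ ∧ ∀ b ∈ s, ∀ (n : ℕ) (j : Fin 3),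
      |iteratedFDeriv ℝ n f b fun _ => EuclideanSpace.single j 1| ≤ C * n ! / ρ ^ n := by
  obtain ⟨p, r, hp⟩ := hf
  obtain ⟨R, hR0, hRr⟩ := ENNReal.lt_iff_exists_nnreal_btwn.1 hp.r_pos
  have hR : 0 < R := by exact_mod_cast hR0
  -- Half of a radius inside the disc of convergence: re-expansion at a centre at distance less than
  -- `q`, evaluated again at radius `q`, stays within radius `R`.
  set q : NNReal := R / 2 with hq
  have hq0 : 0 < q := by positivity
  have hqq : ((q : ℝ≥0∞) + q) < p.radius := by
    rw [← ENNReal.coe_add, hq, add_halves]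
    exact hRr.trans_le hp.r_le
  have hs := p.changeOriginSeries_summable_aux₁ hqq
  -- The full double series of the re-expansion. It bounds the rescaled Taylor coefficients of every
  -- order at every centre in the ball, so one constant serves all of them.
  set S : NNReal := ∑' s : Σ k l : ℕ, { s : Finset (Fin (k + l)) // s.card = l },
      ‖p (s.1 + s.2.1)‖₊ * q ^ s.2.1 * q ^ s.1 with hS
  refine ⟨Metric.ball a q, Metric.ball_mem_nhds a hq0, S, q, S.2, hq0, fun b hb n j => ?_⟩
  have hx : ‖b - a‖₊ < q := by
    have : dist b a < q := hb
    rwa [dist_eq_norm] at this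
  have hxr : (‖b - a‖₊ : ℝ≥0∞) < r := by
    refine (ENNReal.coe_lt_coe.2 (hx.trans_le ?_)).trans hRr
    exact div_le_self (zero_le) one_le_two
  have hco := hp.changeOrigin hxr
  rw [add_sub_cancel] at hco
  rw [← hco.factorial_smul _ n]
  have hk : ‖p.changeOrigin (b - a) n‖₊ * q ^ n ≤ S := by
    have h1 := p.nnnorm_changeOrigin_le n (hxr.trans_le hp.r_le)
    have h2 := p.changeOriginSeries_summable_aux₂
      ((le_self_add.trans_lt hqq : (q : ℝ≥0∞) < p.radius)) n
    calc ‖p.changeOrigin (b - a) n‖₊ * q ^ n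
        ≤ (∑' s : Σ l : ℕ, { s : Finset (Fin (n + l)) // s.card = l },
            ‖p (n + s.1)‖₊ * q ^ s.1) * q ^ n := by
          gcongr
          refine h1.trans ?_
          refine (NNReal.summable_of_le (fun s => ?_) h2).tsum_le_tsum (fun s => ?_) h2 <;>
          · gcongr
      _ = ∑' s : Σ l : ℕ, { s : Finset (Fin (n + l)) // s.card = l },
            ‖p (n + s.1)‖₊ * q ^ s.1 * q ^ n := by rw [NNReal.tsum_mul_right]
      _ ≤ S := by
          rw [hS, hs.tsum_sigma' (fun k => (NNReal.summable_sigma.1 hs).1 k)]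
          exact ((NNReal.summable_sigma.1 hs).2).le_tsum n (fun _ _ => zero_le)
  have hk' : ‖p.changeOrigin (b - a) n‖ * (q : ℝ) ^ n ≤ S := by exact_mod_cast hk
  have hm : |p.changeOrigin (b - a) n fun _ => EuclideanSpace.single j 1| ≤
      ‖p.changeOrigin (b - a) n‖ := by
    refine ((p.changeOrigin (b - a) n).le_opNorm _).trans ?_
    simp
  rw [nsmul_eq_mul, abs_mul, Nat.abs_cast, le_div_iff₀ (by positivity)]
  have hn : (0 : ℝ) ≤ n ! := by positivity
  have hqn : (0 : ℝ) ≤ (q : ℝ) ^ n := by positivity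
  calc (n ! : ℝ) * |p.changeOrigin (b - a) n fun _ => EuclideanSpace.single j 1| * (q : ℝ) ^ n
      ≤ n ! * ‖p.changeOrigin (b - a) n‖ * (q : ℝ) ^ n := by gcongr
    _ = (‖p.changeOrigin (b - a) n‖ * (q : ℝ) ^ n) * n ! := by ring
    _ ≤ S * n ! := by gcongr

/-- Compactness: the local constants on two sets are merged by taking the larger `C` and the smaller
`ρ`. -/
theorem exists_iteratedFDeriv_le_cell {f : E3 → ℝ} (hf : AnalyticOnNhd ℝ f univ) :
    ∃ C ρ : ℝ, 0 ≤ C ∧ 0 < ρ ∧ ∀ b ∈ cell, ∀ (n : ℕ) (j : Fin 3),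
      |iteratedFDeriv ℝ n f b fun _ => EuclideanSpace.single j 1| ≤ C * n ! / ρ ^ n := by
  refine isCompact_cell.induction_on (p := fun s => ∃ C ρ : ℝ, 0 ≤ C ∧ 0 < ρ ∧ ∀ b ∈ s,
    ∀ (n : ℕ) (j : Fin 3),
      |iteratedFDeriv ℝ n f b fun _ => EuclideanSpace.single j 1| ≤ C * n ! / ρ ^ n)
    ⟨0, 1, le_rfl, one_pos, by simp⟩ ?_ ?_ ?_
  · rintro s t hst ⟨C, ρ, h0, h1, h⟩
    exact ⟨C, ρ, h0, h1, fun b hb => h b (hst hb)⟩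
  · rintro s t ⟨C, ρ, h0, h1, h⟩ ⟨C', ρ', h0', h1', h'⟩
    refine ⟨max C C', min ρ ρ', le_max_of_le_left h0, lt_min h1 h1', fun b hb n j => ?_⟩
    have hmin : 0 < min ρ ρ' := lt_min h1 h1'
    rcases hb with hb | hb
    · refine (h b hb n j).trans ?_
      gcongr
      · exact le_max_left _ _
      · exact min_le_left _ _
    · refine (h' b hb n j).trans ?_
      gcongr
      · exact le_max_right _ _
      · exact min_le_right _ _
  · intro a _
    obtain ⟨s, hs, h⟩ := exists_iteratedFDeriv_le_nhds (hf a (mem_univ a))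
    exact ⟨s, mem_nhdsWithin_of_mem_nhds hs, h⟩

theorem iterate_partialD {f : E3 → ℝ} (hf : AnalyticOnNhd ℝ f univ) (j : Fin 3) (n : ℕ) (a : E3) :
    (partialD j)^[n] f a = iteratedFDeriv ℝ n f a fun _ => EuclideanSpace.single j 1 := by
  induction n generalizing a with
  | zero => simp
  | succ n ih =>
    rw [Function.iterate_succ_apply', iteratedFDeriv_succ_apply_left, partialD,
      show (partialD j)^[n] f = fun b => iteratedFDeriv ℝ n f b fun _ => EuclideanSpace.single j 1
        from funext ih]
    have h1 : DifferentiableAt ℝ (iteratedFDeriv ℝ n f) a :=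
      (hf.iteratedFDeriv n a (mem_univ a)).differentiableAt
    have h2 : HasFDerivAt
        (fun b => iteratedFDeriv ℝ n f b fun _ => EuclideanSpace.single j 1) _ a :=
      (ContinuousMultilinearMap.apply ℝ (fun _ : Fin n => E3) ℝ
        (fun _ => EuclideanSpace.single j 1)).hasFDerivAt.comp a h1.hasFDerivAt
    rw [h2.fderiv]
    rfl

theorem analyticOnNhd_partialD {F : Type*} [NormedAddCommGroup F] [NormedSpace ℝ F]
    [CompleteSpace F] {f : E3 → F} (hf : AnalyticOnNhd ℝ f univ) (j : Fin 3) :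
    AnalyticOnNhd ℝ (partialD j f) univ := fun a ha =>
  (ContinuousLinearMap.apply ℝ F (EuclideanSpace.single j (1 : ℝ))).analyticAt _ |>.comp
    (hf.fderiv a ha)

theorem fourierCoef_partialD {f : E3 → ℝ} (hf : ContDiff ℝ 1 f) (hp : IsPeriodic f) (j : Fin 3)
    (p : Fin 3 → ℤ) :
    fourierCoef (partialD j f) p = Complex.I * p j * fourierCoef f p := by
  rw [fourierCoef_eq, fourierCoef_eq, ← fourierCoefC_partialD (f := fun a => (f a : ℂ))
    (Complex.ofRealCLM.contDiff.comp hf) (hp.comp _)]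
  congr 1
  funext a
  exact (partialD_ofReal (hf.differentiable one_ne_zero) j a).symm

theorem contDiff_of_analyticOnNhd {F : Type*} [NormedAddCommGroup F] [NormedSpace ℝ F]
    [CompleteSpace F] {f : E3 → F} (hf : AnalyticOnNhd ℝ f univ) {n : WithTop ℕ∞} :
    ContDiff ℝ n f := contDiff_iff_contDiffAt.2 fun a => (hf a (mem_univ a)).contDiffAt

theorem fourierCoef_iterate_partialD {f : E3 → ℝ} (hf : AnalyticOnNhd ℝ f univ)
    (hp : IsPeriodic f) (j : Fin 3) (p : Fin 3 → ℤ) (n : ℕ) :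
    fourierCoef ((partialD j)^[n] f) p = (Complex.I * p j) ^ n * fourierCoef f p := by
  have h : ∀ n, AnalyticOnNhd ℝ ((partialD j)^[n] f) univ ∧ IsPeriodic ((partialD j)^[n] f) := by
    intro n
    induction n with
    | zero => exact ⟨hf, hp⟩
    | succ n ih =>
      rw [Function.iterate_succ_apply']
      exact ⟨analyticOnNhd_partialD ih.1 j, ih.2.partialD j⟩
  induction n with
  | zero => simp
  | succ n ih =>
    rw [Function.iterate_succ_apply', fourierCoef_partialD (contDiff_of_analyticOnNhd (h n).1)
      (h n).2, ih]
    ring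

theorem norm_fourierCoef_le {f : E3 → ℝ} {C : ℝ} (h : ∀ a ∈ cell, |f a| ≤ C) (p : Fin 3 → ℤ) :
    ‖fourierCoef f p‖ ≤ C := by
  rw [fourierCoef_eq, fourierCoefC, norm_mul, norm_inv]
  have h1 : ‖∫ a in cell, (f a : ℂ) * character (-p) (toC3 a)‖ ≤ C * volume.real cell := by
    refine norm_setIntegral_le_of_norm_le_const isCompact_cell.measure_lt_top fun a ha => ?_
    simpa [norm_character_toC3] using h a ha
  have h2 : volume.real cell = ‖((2 * π : ℂ) ^ 3)‖ := by
    simp [Measure.real, volume_cell, Real.pi_pos.le, abs_of_pos Real.pi_pos]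
  rw [h2] at h1
  rw [inv_mul_le_iff₀ (norm_pos_iff.2 two_pi_cube_ne_zero), mul_comm]
  exact h1

/-- The Cauchy estimates give `|pⱼ|ⁿ |f̂ₚ| ≤ C n!/ρⁿ` for every `n`. Multiplying by `(ρ/2)ⁿ/n!` and
summing yields `e^{ρ|pⱼ|/2} |f̂ₚ| ≤ 2C`. For the largest component, `|p| ≤ 2|pⱼ|`, whence the rate
`ρ/4`. -/
theorem exists_fourierCoef_decay {f : E3 → ℝ} (hf : AnalyticOnNhd ℝ f univ) (hp : IsPeriodic f) :
    ∃ C δ : ℝ, 0 ≤ C ∧ 0 < δ ∧ ∀ p, ‖fourierCoef f p‖ ≤ C * Real.exp (-δ * waveLength p) := by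
  obtain ⟨C, ρ, hC, hρ, h⟩ := exists_iteratedFDeriv_le_cell hf
  refine ⟨2 * C, ρ / 4, by positivity, by positivity, fun p => ?_⟩
  obtain ⟨j, hj⟩ := exists_waveLength_le p
  have h1 : ∀ n : ℕ, |(p j : ℝ)| ^ n * ‖fourierCoef f p‖ ≤ C * n ! / ρ ^ n := by
    intro n
    have h2 := norm_fourierCoef_le (f := (partialD j)^[n] f) (C := C * n ! / ρ ^ n)
      (fun a ha => by rw [iterate_partialD hf]; exact h a ha n j) p
    rw [fourierCoef_iterate_partialD hf hp] at h2
    simpa using h2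
  have h3 : HasSum (fun n : ℕ => (ρ / 2 * |(p j : ℝ)|) ^ n / n ! * ‖fourierCoef f p‖)
      (Real.exp (ρ / 2 * |(p j : ℝ)|) * ‖fourierCoef f p‖) := by
    have := NormedSpace.expSeries_div_hasSum_exp (ρ / 2 * |(p j : ℝ)|)
    rw [← Real.exp_eq_exp_ℝ] at this
    exact this.mul_right _
  have h4 := hasSum_le (fun n => ?_) h3 (hasSum_geometric_two.mul_left C)
  · have h5 : ‖fourierCoef f p‖ ≤ (2 * C) * Real.exp (-(ρ / 2 * |(p j : ℝ)|)) := by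
      rw [Real.exp_neg, ← div_eq_mul_inv, le_div_iff₀ (Real.exp_pos _)]
      linarith
    refine h5.trans ?_
    gcongr
    nlinarith
  · have h6 := h1 n
    rw [le_div_iff₀ (by positivity)] at h6
    have h7 : (n ! : ℝ) ≠ 0 := by positivity
    calc (ρ / 2 * |(p j : ℝ)|) ^ n / n ! * ‖fourierCoef f p‖
        = (|(p j : ℝ)| ^ n * ‖fourierCoef f p‖ * ρ ^ n) / n ! * (1 / 2) ^ n := by
          rw [mul_pow, div_pow, one_div, inv_pow]; ring
      _ ≤ (C * n !) / n ! * (1 / 2) ^ n := by gcongr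
      _ = C * (1 / 2) ^ n := by field_simp

end

section

/-! ### Vector algebra in complex three-space -/

/-- The bilinear product `∑ uⱼ wⱼ`. -/
def dot (u w : C3) : ℂ := ∑ j, u j * w j

/-- The bilinear cross product. -/
def cross (u w : C3) : C3 :=
  WithLp.toLp 2 fun j => u (j + 1) * w (j + 2) - u (j + 2) * w (j + 1)

/-- The determinant of three vectors. -/
def det3 (u v w : C3) : ℂ := dot u (cross v w)

/-- The wave vector `p`, as a vector of `C3`. -/
def wave (p : Fin 3 → ℤ) : C3 := WithLp.toLp 2 fun j => (p j : ℂ)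

theorem cross_apply (u w : C3) (j : Fin 3) :
    cross u w j = u (j + 1) * w (j + 2) - u (j + 2) * w (j + 1) := rfl

theorem wave_apply (p : Fin 3 → ℤ) (j : Fin 3) : wave p j = p j := rfl

theorem norm_sq_C3 (u : C3) :
    ‖u‖ ^ 2 = Complex.normSq (u 0) + Complex.normSq (u 1) + Complex.normSq (u 2) := by
  rw [EuclideanSpace.norm_sq_eq, Fin.sum_univ_three]
  simp only [Complex.sq_norm]

theorem norm_wave (p : Fin 3 → ℤ) : ‖wave p‖ = waveLength p := by
  rw [EuclideanSpace.norm_eq, waveLength]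
  simp [wave_apply]

/-- Lagrange's identity: `|u|²|w|² - |u × w|²` is the squared modulus of the Hermitian product of
`u` and `w`. -/
theorem norm_cross_le (u w : C3) : ‖cross u w‖ ≤ ‖u‖ * ‖w‖ := by
  refine le_of_sq_le_sq ?_ (by positivity)
  rw [mul_pow, norm_sq_C3, norm_sq_C3, norm_sq_C3]
  have h : Complex.normSq (∑ j, u j * (starRingEnd ℂ) (w j)) =
      (Complex.normSq (u 0) + Complex.normSq (u 1) + Complex.normSq (u 2)) *
        (Complex.normSq (w 0) + Complex.normSq (w 1) + Complex.normSq (w 2)) -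
      (Complex.normSq (cross u w 0) + Complex.normSq (cross u w 1) +
        Complex.normSq (cross u w 2)) := by
    simp only [cross_apply, Complex.normSq_apply, Fin.sum_univ_three]
    simp
    ring
  linarith [Complex.normSq_nonneg (∑ j, u j * (starRingEnd ℂ) (w j))]

theorem norm_dot_le (u w : C3) : ‖dot u w‖ ≤ ‖u‖ * ‖w‖ := by
  have h1 : ‖dot u w‖ ≤ ‖u 0‖ * ‖w 0‖ + ‖u 1‖ * ‖w 1‖ + ‖u 2‖ * ‖w 2‖ := by
    rw [dot]
    refine (norm_sum_le _ _).trans ?_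
    rw [Fin.sum_univ_three, norm_mul, norm_mul, norm_mul]
  refine h1.trans (le_of_sq_le_sq ?_ (by positivity))
  rw [mul_pow, EuclideanSpace.norm_sq_eq, EuclideanSpace.norm_sq_eq, Fin.sum_univ_three,
    Fin.sum_univ_three]
  nlinarith [sq_nonneg (‖u 0‖ * ‖w 1‖ - ‖u 1‖ * ‖w 0‖), sq_nonneg (‖u 0‖ * ‖w 2‖ - ‖u 2‖ * ‖w 0‖),
    sq_nonneg (‖u 1‖ * ‖w 2‖ - ‖u 2‖ * ‖w 1‖)]

theorem norm_det3_le (u v w : C3) : ‖det3 u v w‖ ≤ ‖u‖ * ‖v‖ * ‖w‖ := by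
  refine (norm_dot_le _ _).trans ?_
  rw [mul_assoc]
  gcongr
  exact norm_cross_le _ _

/-- The vector field mode with divergence `d` and curl `c`: the solution `ξ` of `i p·ξ = d`,
`i p × ξ = c`. -/
def helmholtz (p : Fin 3 → ℤ) (d : ℂ) (c : C3) : C3 :=
  ((waveLength p ^ 2 : ℝ) : ℂ)⁻¹ • (-(Complex.I * d) • wave p + Complex.I • cross (wave p) c)

/-- As `p` is real, the gradient part and the curl part are orthogonal, so the two sources combine
by Pythagoras and not by addition. This gain produces the constant `1/√2` in the quadratic term. At
`p = 0` the left side vanishes. -/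
theorem norm_helmholtz_le (p : Fin 3 → ℤ) (d : ℂ) (c : C3) :
    waveLength p * ‖helmholtz p d c‖ ≤ √(‖d‖ ^ 2 + ‖c‖ ^ 2) := by
  rcases (waveLength_nonneg p).eq_or_lt with h0 | h0
  · rw [← h0, zero_mul]
    positivity
  have h1 : ‖-(Complex.I * d) • wave p + Complex.I • cross (wave p) c‖ ^ 2 =
      ‖d‖ ^ 2 * ‖wave p‖ ^ 2 + ‖cross (wave p) c‖ ^ 2 := by
    rw [norm_sq_C3, norm_sq_C3, norm_sq_C3, Complex.sq_norm]
    simp only [PiLp.add_apply, PiLp.smul_apply, smul_eq_mul, cross_apply, wave_apply,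
      Complex.normSq_apply]
    simp
    ring
  have h2 : ‖-(Complex.I * d) • wave p + Complex.I • cross (wave p) c‖ ≤
      waveLength p * √(‖d‖ ^ 2 + ‖c‖ ^ 2) := by
    refine le_of_sq_le_sq ?_ (by positivity)
    rw [h1, mul_pow, Real.sq_sqrt (by positivity), mul_add, norm_wave, mul_comm (‖d‖ ^ 2)]
    gcongr
    rw [← mul_pow, ← norm_wave]
    gcongr
    exact norm_cross_le _ _
  rw [helmholtz, norm_smul, norm_inv, Complex.norm_real, Real.norm_of_nonneg (by positivity)]
  calc waveLength p * ((waveLength p ^ 2)⁻¹ *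
        ‖-(Complex.I * d) • wave p + Complex.I • cross (wave p) c‖)
      ≤ waveLength p * ((waveLength p ^ 2)⁻¹ * (waveLength p * √(‖d‖ ^ 2 + ‖c‖ ^ 2))) := by gcongr
    _ = √(‖d‖ ^ 2 + ‖c‖ ^ 2) := by field_simp

end

section

/-! ### Recursion for the Fourier–Taylor coefficients of the displacement -/

/-- The index `(s, p)` of the monomial `tˢ e^{i p·a}`. -/
abbrev Mode : Type := ℕ × (Fin 3 → ℤ)

/-- Pairs of modes with given sum. -/
abbrev PairFiber (k : Mode) : Type := {x : Mode × Mode // x.1 + x.2 = k}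

/-- Triples of modes with given sum. -/
abbrev TripleFiber (k : Mode) : Type := {x : Mode × Mode × Mode // x.1 + (x.2.1 + x.2.2) = k}

/-- The quadratic interaction in the divergence equation. -/
def quadDiv (f : Mode → C3) (x : Mode × Mode) : ℂ :=
  2⁻¹ * dot (cross (wave x.1.2) (wave x.2.2)) (cross (f x.1) (f x.2))

/-- The quadratic interaction in the curl equation. -/
def quadCurl (f : Mode → C3) (x : Mode × Mode) : C3 :=
  (2⁻¹ * (((x.1.1 : ℂ) - x.2.1) / (x.1.1 + x.2.1)) * dot (f x.1) (f x.2)) •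
    cross (wave x.1.2) (wave x.2.2)

/-- The cubic interaction in the divergence equation. -/
def cubDiv (f : Mode → C3) (x : Mode × Mode × Mode) : ℂ :=
  Complex.I * (6⁻¹ * (det3 (wave x.1.2) (wave x.2.1.2) (wave x.2.2.2) *
    det3 (f x.1) (f x.2.1) (f x.2.2)))

/-- The right-hand side of the divergence equation. -/
def divSource (f : Mode → C3) (k : Mode) : ℂ :=
  ∑' x : PairFiber k, quadDiv f x + ∑' x : TripleFiber k, cubDiv f x

/-- The right-hand side of the curl equation. -/
def curlSource (f : Mode → C3) (k : Mode) : C3 := ∑' x : PairFiber k, quadCurl f x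

/-- The Fourier–Taylor coefficients `ξ̂⁽ˢ⁾ₚ` of the displacement, for the initial velocity with
Fourier coefficients `v`. -/
def coef (v : (Fin 3 → ℤ) → C3) (s : ℕ) (p : Fin 3 → ℤ) : C3 :=
  (if s = 1 then v p else 0) +
    helmholtz p (divSource (fun i => if i.1 < s then coef v i.1 i.2 else 0) (s, p))
      (curlSource (fun i => if i.1 < s then coef v i.1 i.2 else 0) (s, p))
termination_by s

/-- Truncation to modes of order less than `N`. -/
def trunc (f : Mode → C3) (N : ℕ) (i : Mode) : C3 := if i.1 < N then f i else 0

/-- The coefficients `ξ̂⁽ˢ⁾ₚ` as a function of the mode. -/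
def xi (v : (Fin 3 → ℤ) → C3) (k : Mode) : C3 := coef v k.1 k.2

variable (v : (Fin 3 → ℤ) → C3)

theorem xi_eq_trunc (k : Mode) :
    xi v k = (if k.1 = 1 then v k.2 else 0) +
      helmholtz k.2 (divSource (trunc (xi v) k.1) k) (curlSource (trunc (xi v) k.1) k) := by
  rw [xi, coef]
  rfl

theorem cross_zero_left (u : C3) : cross 0 u = 0 := by ext j; simp [cross_apply]
theorem cross_zero_right (u : C3) : cross u 0 = 0 := by ext j; simp [cross_apply]
theorem dot_zero_left (u : C3) : dot 0 u = 0 := by simp [dot]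
theorem dot_zero_right (u : C3) : dot u 0 = 0 := by simp [dot]

theorem helmholtz_zero_source (p : Fin 3 → ℤ) : helmholtz p 0 0 = 0 := by
  simp [helmholtz, cross_zero_right]

theorem xi_order_zero (p : Fin 3 → ℤ) : xi v (0, p) = 0 := by
  have h : trunc (xi v) 0 = 0 := by funext i; simp [trunc]
  rw [xi_eq_trunc, h]
  simp [divSource, curlSource, quadDiv, quadCurl, cubDiv, cross_zero_left, dot_zero_right,
    det3, helmholtz_zero_source]

theorem xi_eq_zero {i : Mode} (h : i.1 = 0) : xi v i = 0 := by
  rw [← Prod.mk.eta (p := i), h, xi_order_zero]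

theorem trunc_xi_eq_zero {i : Mode} (h : i.1 = 0) (N : ℕ) : trunc (xi v) N i = 0 := by
  rw [trunc, xi_eq_zero v h, ite_self]

theorem trunc_eq (f : Mode → C3) {i : Mode} {N : ℕ} (h : i.1 < N) : trunc f N i = f i := if_pos h

theorem quad_trunc {k : Mode} (x : PairFiber k) :
    (trunc (xi v) k.1 x.1.1 = xi v x.1.1 ∧ trunc (xi v) k.1 x.1.2 = xi v x.1.2) ∨
    (trunc (xi v) k.1 x.1.1 = 0 ∧ xi v x.1.1 = 0) ∨
    (trunc (xi v) k.1 x.1.2 = 0 ∧ xi v x.1.2 = 0) := by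
  have hx : x.1.1.1 + x.1.2.1 = k.1 := congrArg Prod.fst x.2
  rcases Nat.eq_zero_or_pos x.1.1.1 with h1 | h1
  · exact Or.inr (Or.inl ⟨trunc_xi_eq_zero v h1 _, xi_eq_zero v h1⟩)
  rcases Nat.eq_zero_or_pos x.1.2.1 with h2 | h2
  · exact Or.inr (Or.inr ⟨trunc_xi_eq_zero v h2 _, xi_eq_zero v h2⟩)
  exact Or.inl ⟨trunc_eq _ (by omega), trunc_eq _ (by omega)⟩

theorem quadDiv_trunc {k : Mode} (x : PairFiber k) :
    quadDiv (trunc (xi v) k.1) x = quadDiv (xi v) x := by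
  rcases quad_trunc v x with ⟨h1, h2⟩ | ⟨h1, h2⟩ | ⟨h1, h2⟩
  · simp [quadDiv, h1, h2]
  · simp [quadDiv, h1, h2, cross_zero_left]
  · simp [quadDiv, h1, h2, cross_zero_right]

theorem quadCurl_trunc {k : Mode} (x : PairFiber k) :
    quadCurl (trunc (xi v) k.1) x = quadCurl (xi v) x := by
  rcases quad_trunc v x with ⟨h1, h2⟩ | ⟨h1, h2⟩ | ⟨h1, h2⟩
  · simp [quadCurl, h1, h2]
  · simp [quadCurl, h1, h2, dot_zero_left]
  · simp [quadCurl, h1, h2, dot_zero_right]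

theorem cubDiv_trunc {k : Mode} (x : TripleFiber k) :
    cubDiv (trunc (xi v) k.1) x = cubDiv (xi v) x := by
  have hx : x.1.1.1 + (x.1.2.1.1 + x.1.2.2.1) = k.1 := congrArg Prod.fst x.2
  simp only [cubDiv, det3]
  rcases Nat.eq_zero_or_pos x.1.1.1 with h1 | h1
  · rw [xi_eq_zero v h1, trunc_xi_eq_zero v h1, dot_zero_left, dot_zero_left]
  rcases Nat.eq_zero_or_pos x.1.2.1.1 with h2 | h2
  · rw [xi_eq_zero v h2, trunc_xi_eq_zero v h2, cross_zero_left, cross_zero_left, dot_zero_right,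
      dot_zero_right]
  rw [trunc_eq _ (by omega : x.1.1.1 < k.1), trunc_eq _ (by omega : x.1.2.1.1 < k.1),
    trunc_eq _ (by omega : x.1.2.2.1 < k.1)]

/-- The truncation needed to define the recursion is invisible: in a pair or triple of total order
`s`, a factor of order `s` comes with a factor of order zero, which vanishes. -/
theorem xi_eq (k : Mode) :
    xi v k = (if k.1 = 1 then v k.2 else 0) +
      helmholtz k.2 (divSource (xi v) k) (curlSource (xi v) k) := by
  rw [xi_eq_trunc]
  simp only [divSource, curlSource, quadDiv_trunc, quadCurl_trunc, cubDiv_trunc]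

/-! ### Bounds for the interactions -/

/-- The size `|p| |fₖ|` of a mode. -/
def modeSize (f : Mode → C3) (k : Mode) : ℝ≥0∞ := ENNReal.ofReal (waveLength k.2) * ‖f k‖ₑ

theorem modeSize_eq (f : Mode → C3) (k : Mode) :
    modeSize f k = ENNReal.ofReal (waveLength k.2 * ‖f k‖) := by
  rw [modeSize, ENNReal.ofReal_mul (waveLength_nonneg _), ofReal_norm]

theorem norm_orderRatio_le (m n : ℕ) : ‖((m : ℂ) - n) / (m + n)‖ ≤ 1 := by
  have e : ((m : ℂ) - n) / (m + n) = (((m : ℝ) - n) / (m + n) : ℝ) := by push_cast; rfl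
  rw [e, Complex.norm_real, Real.norm_eq_abs, abs_div]
  refine div_le_one_of_le₀ ?_ (abs_nonneg _)
  rw [abs_of_nonneg (by positivity : (0 : ℝ) ≤ (m : ℝ) + n), abs_le]
  constructor <;> linarith [Nat.cast_nonneg (α := ℝ) m, Nat.cast_nonneg (α := ℝ) n]

/-- Both interactions are at most half of the product of the mode sizes, and `√(1/4 + 1/4) = 1/√2`.
-/
theorem norm_pair_le (f : Mode → C3) (x : Mode × Mode) :
    √(‖quadDiv f x‖ ^ 2 + ‖quadCurl f x‖ ^ 2) ≤
      (√2)⁻¹ * ((waveLength x.1.2 * ‖f x.1‖) * (waveLength x.2.2 * ‖f x.2‖)) := by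
  set q := waveLength x.1.2
  set r := waveLength x.2.2
  set u := ‖f x.1‖
  set w := ‖f x.2‖
  have hq : 0 ≤ q := waveLength_nonneg _
  have hr : 0 ≤ r := waveLength_nonneg _
  have hcr : ‖cross (wave x.1.2) (wave x.2.2)‖ ≤ q * r := by
    simpa only [norm_wave] using norm_cross_le (wave x.1.2) (wave x.2.2)
  have h1 : ‖quadDiv f x‖ ≤ 2⁻¹ * ((q * r) * (u * w)) := by
    rw [quadDiv, norm_mul]
    have := (norm_dot_le (cross (wave x.1.2) (wave x.2.2)) (cross (f x.1) (f x.2))).trans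
      (mul_le_mul hcr (norm_cross_le (f x.1) (f x.2)) (norm_nonneg _) (by positivity))
    simpa using this
  have h2 : ‖quadCurl f x‖ ≤ 2⁻¹ * ((q * r) * (u * w)) := by
    rw [quadCurl, norm_smul, norm_mul, norm_mul, norm_inv, Complex.norm_ofNat]
    calc 2⁻¹ * ‖((x.1.1 : ℂ) - x.2.1) / (x.1.1 + x.2.1)‖ * ‖dot (f x.1) (f x.2)‖ *
          ‖cross (wave x.1.2) (wave x.2.2)‖ ≤ 2⁻¹ * 1 * (u * w) * (q * r) := by
          gcongr
          · exact norm_orderRatio_le _ _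
          · exact norm_dot_le _ _
      _ = _ := by ring
  refine Real.sqrt_le_iff.2 ⟨by positivity, ?_⟩
  have h3 := pow_le_pow_left₀ (norm_nonneg _) h1 2
  have h4 := pow_le_pow_left₀ (norm_nonneg _) h2 2
  have h5 : ((√2)⁻¹ : ℝ) ^ 2 = 1 / 2 := by rw [inv_pow, Real.sq_sqrt (by norm_num)]; norm_num
  rw [mul_pow, h5]
  nlinarith

theorem norm_cubDiv_le (f : Mode → C3) (x : Mode × Mode × Mode) :
    ‖cubDiv f x‖ ≤ 6⁻¹ * ((waveLength x.1.2 * ‖f x.1‖) * ((waveLength x.2.1.2 * ‖f x.2.1‖) *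
      (waveLength x.2.2.2 * ‖f x.2.2‖))) := by
  have h1 := norm_det3_le (wave x.1.2) (wave x.2.1.2) (wave x.2.2.2)
  have h2 := norm_det3_le (f x.1) (f x.2.1) (f x.2.2)
  simp only [norm_wave] at h1
  rw [cubDiv, norm_mul, norm_mul, norm_mul, Complex.norm_I, norm_inv, Complex.norm_ofNat, one_mul]
  calc 6⁻¹ * (‖det3 (wave x.1.2) (wave x.2.1.2) (wave x.2.2.2)‖ * ‖det3 (f x.1) (f x.2.1) (f x.2.2)‖)
      ≤ 6⁻¹ * ((waveLength x.1.2 * waveLength x.2.1.2 * waveLength x.2.2.2) *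
        (‖f x.1‖ * ‖f x.2.1‖ * ‖f x.2.2‖)) := by
        gcongr
        exact mul_nonneg (mul_nonneg (waveLength_nonneg _) (waveLength_nonneg _))
          (waveLength_nonneg _)
    _ = _ := by ring

/-- `helmholtz p` as a continuous linear map. -/
def helmholtzCLM (p : Fin 3 → ℤ) : ℂ × C3 →L[ℂ] C3 :=
  LinearMap.toContinuousLinearMap
    { toFun := fun x => helmholtz p x.1 x.2
      map_add' := fun x y => by
        ext j
        simp [helmholtz, cross_apply]
        ring
      map_smul' := fun a x => by
        ext j
        simp [helmholtz, cross_apply]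
        ring }

theorem helmholtzCLM_apply (p : Fin 3 → ℤ) (d : ℂ) (c : C3) :
    helmholtzCLM p (d, c) = helmholtz p d c := rfl

theorem modeSize_helmholtz_le (f : Mode → C3) (k : Mode) :
    ENNReal.ofReal (waveLength k.2) * ‖helmholtz k.2 (divSource f k) (curlSource f k)‖ₑ ≤
      (ENNReal.ofReal √2)⁻¹ * ∑' x : PairFiber k, modeSize f x.1.1 * modeSize f x.1.2 +
      6⁻¹ * ∑' x : TripleFiber k, modeSize f x.1.1 * (modeSize f x.1.2.1 * modeSize f x.1.2.2) := by
  have hs2 : (ENNReal.ofReal √2)⁻¹ ≠ 0 := by simp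
  -- If the majorant is infinite there is nothing to prove. Otherwise the source series converge
  -- absolutely, and their `tsum`s are genuine sums and not the default value zero.
  by_cases h2 : ∑' x : PairFiber k, modeSize f x.1.1 * modeSize f x.1.2 = ⊤
  · rw [h2, ENNReal.mul_top hs2, top_add]
    exact le_top
  by_cases h3 : ∑' x : TripleFiber k,
      modeSize f x.1.1 * (modeSize f x.1.2.1 * modeSize f x.1.2.2) = ⊤
  · rw [h3, ENNReal.mul_top (by simp), add_top]
    exact le_top
  simp only [modeSize_eq, ← ENNReal.ofReal_mul (mul_nonneg (waveLength_nonneg _) (norm_nonneg _))]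
    at h2 h3 ⊢
  have s2 := ENNReal.summable_toReal h2
  have s3 := ENNReal.summable_toReal h3
  simp only [ENNReal.toReal_ofReal (mul_nonneg (mul_nonneg (waveLength_nonneg _) (norm_nonneg _))
    (mul_nonneg (waveLength_nonneg _) (norm_nonneg _)))] at s2
  simp only [ENNReal.toReal_ofReal (mul_nonneg (mul_nonneg (waveLength_nonneg _) (norm_nonneg _))
    (mul_nonneg (mul_nonneg (waveLength_nonneg _) (norm_nonneg _))
      (mul_nonneg (waveLength_nonneg _) (norm_nonneg _))))] at s3
  have a1 : Summable fun x : PairFiber k => quadDiv f x :=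
    (s2.mul_left (√2)⁻¹).of_norm_bounded fun x => (Real.le_sqrt_of_sq_le
      (le_add_of_nonneg_right (sq_nonneg _))).trans (norm_pair_le f x)
  have a2 : Summable fun x : PairFiber k => quadCurl f x :=
    (s2.mul_left (√2)⁻¹).of_norm_bounded fun x => (Real.le_sqrt_of_sq_le
      (le_add_of_nonneg_left (sq_nonneg _))).trans (norm_pair_le f x)
  have a3 : Summable fun x : TripleFiber k => cubDiv f x :=
    (s3.mul_left 6⁻¹).of_norm_bounded fun x => norm_cubDiv_le f x
  -- Linearity is used before the triangle inequality: the divergence and curl contributions of one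
  -- pair of modes must stay together for the bound by `1/√2` to apply.
  have e1 : helmholtz k.2 (divSource f k) (curlSource f k) =
      ∑' x : PairFiber k, helmholtz k.2 (quadDiv f x) (quadCurl f x) +
      ∑' x : TripleFiber k, helmholtz k.2 (cubDiv f x) 0 := by
    have b1 := (a1.hasSum.prodMk a2.hasSum).mapL (helmholtzCLM k.2)
    have b2 := (a3.hasSum.prodMk (hasSum_zero (α := C3))).mapL (helmholtzCLM k.2)
    simp only [helmholtzCLM_apply] at b1 b2
    rw [b1.tsum_eq, b2.tsum_eq, ← helmholtzCLM_apply, ← helmholtzCLM_apply, ← helmholtzCLM_apply,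
      ← map_add, Prod.mk_add_mk, add_zero]
    rfl
  rw [e1]
  refine (mul_le_mul_right (enorm_add_le _ _) _).trans ?_
  rw [mul_add]
  refine add_le_add ?_ ?_
  · refine (mul_le_mul_right enorm_tsum_le_tsum_enorm _).trans ?_
    rw [← ENNReal.tsum_mul_left, ← ENNReal.tsum_mul_left]
    refine ENNReal.tsum_le_tsum fun x => ?_
    rw [← ofReal_norm, ← ENNReal.ofReal_mul (waveLength_nonneg _), ← ENNReal.ofReal_inv_of_pos
      (by positivity), ← ENNReal.ofReal_mul (by positivity)]
    exact ENNReal.ofReal_le_ofReal ((norm_helmholtz_le _ _ _).trans (norm_pair_le f x))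
  · refine (mul_le_mul_right enorm_tsum_le_tsum_enorm _).trans ?_
    rw [← ENNReal.tsum_mul_left, ← ENNReal.tsum_mul_left]
    refine ENNReal.tsum_le_tsum fun x => ?_
    have h6 : (6 : ℝ≥0∞)⁻¹ = ENNReal.ofReal 6⁻¹ := by
      rw [ENNReal.ofReal_inv_of_pos (by norm_num)]; simp
    rw [← ofReal_norm, ← ENNReal.ofReal_mul (waveLength_nonneg _), h6,
      ← ENNReal.ofReal_mul (by positivity)]
    refine ENNReal.ofReal_le_ofReal ((norm_helmholtz_le _ _ _).trans ?_)
    simpa using norm_cubDiv_le f x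

/-! ### Generating functions -/

theorem tsum_pairFiber (F : Mode × Mode → ℝ≥0∞) :
    ∑' k, ∑' x : PairFiber k, F x = ∑' x, F x := by
  rw [← (Equiv.sigmaFiberEquiv fun x : Mode × Mode => x.1 + x.2).tsum_eq F, ENNReal.tsum_sigma']
  rfl

theorem tsum_tripleFiber (F : Mode × Mode × Mode → ℝ≥0∞) :
    ∑' k, ∑' x : TripleFiber k, F x = ∑' x, F x := by
  rw [← (Equiv.sigmaFiberEquiv fun x : Mode × Mode × Mode => x.1 + (x.2.1 + x.2.2)).tsum_eq F,
    ENNReal.tsum_sigma']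
  rfl

theorem tsum_mul_prod {α β : Type*} (f : α → ℝ≥0∞) (g : β → ℝ≥0∞) :
    ∑' x : α × β, f x.1 * g x.2 = (∑' a, f a) * ∑' b, g b := by
  rw [ENNReal.tsum_prod', ← ENNReal.tsum_mul_right]
  refine tsum_congr fun a => ?_
  rw [← ENNReal.tsum_mul_left]

/-- The weight `e^{σ|p|} tˢ` of a mode. -/
def weight (σ t : ℝ) (k : Mode) : ℝ≥0∞ :=
  ENNReal.ofReal (Real.exp (σ * waveLength k.2)) * ENNReal.ofReal t ^ k.1

theorem waveLength_add_le (p q : Fin 3 → ℤ) :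
    waveLength (p + q) ≤ waveLength p + waveLength q := by
  have h : wave (p + q) = wave p + wave q := by ext j; simp [wave]
  rw [← norm_wave, ← norm_wave p, ← norm_wave q, h]
  exact norm_add_le _ _

/-- The triangle inequality for `|p|` makes the weights submultiplicative, so that a weighted
convolution is bounded by the product of the weighted sums. -/
theorem weight_add_le {σ : ℝ} (hσ : 0 ≤ σ) (t : ℝ) (i j : Mode) :
    weight σ t (i + j) ≤ weight σ t i * weight σ t j := by
  have h : ENNReal.ofReal (Real.exp (σ * waveLength (i.2 + j.2))) ≤
      ENNReal.ofReal (Real.exp (σ * waveLength i.2)) *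
        ENNReal.ofReal (Real.exp (σ * waveLength j.2)) := by
    rw [← ENNReal.ofReal_mul (Real.exp_pos _).le, ← Real.exp_add, ← mul_add]
    exact ENNReal.ofReal_le_ofReal (Real.exp_le_exp.2
      (mul_le_mul_of_nonneg_left (waveLength_add_le _ _) hσ))
  calc weight σ t (i + j) ≤ (ENNReal.ofReal (Real.exp (σ * waveLength i.2)) *
        ENNReal.ofReal (Real.exp (σ * waveLength j.2))) * ENNReal.ofReal t ^ (i.1 + j.1) :=
        mul_le_mul_left h _
    _ = weight σ t i * weight σ t j := by rw [weight, weight, pow_add]; ring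

theorem tsum_weight_pair_le {σ : ℝ} (hσ : 0 ≤ σ) (t : ℝ) (g h : Mode → ℝ≥0∞) :
    ∑' k, weight σ t k * ∑' x : PairFiber k, g x.1.1 * h x.1.2 ≤
      (∑' k, weight σ t k * g k) * ∑' k, weight σ t k * h k := by
  rw [← tsum_mul_prod, ← tsum_pairFiber]
  refine ENNReal.tsum_le_tsum fun k => ?_
  rw [← ENNReal.tsum_mul_left]
  refine ENNReal.tsum_le_tsum fun x => ?_
  have := weight_add_le hσ t x.1.1 x.1.2
  rw [x.2] at this
  calc weight σ t k * (g x.1.1 * h x.1.2)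
      ≤ (weight σ t x.1.1 * weight σ t x.1.2) * (g x.1.1 * h x.1.2) := mul_le_mul_left this _
    _ = _ := by ring

theorem tsum_weight_triple_le {σ : ℝ} (hσ : 0 ≤ σ) (t : ℝ) (g h l : Mode → ℝ≥0∞) :
    ∑' k, weight σ t k * ∑' x : TripleFiber k, g x.1.1 * (h x.1.2.1 * l x.1.2.2) ≤
      (∑' k, weight σ t k * g k) * ((∑' k, weight σ t k * h k) * ∑' k, weight σ t k * l k) := by
  rw [← tsum_mul_prod, ← tsum_mul_prod (fun k => weight σ t k * g k)
    (fun y : Mode × Mode => (weight σ t y.1 * h y.1) * (weight σ t y.2 * l y.2)),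
    ← tsum_tripleFiber]
  refine ENNReal.tsum_le_tsum fun k => ?_
  rw [← ENNReal.tsum_mul_left]
  refine ENNReal.tsum_le_tsum fun x => ?_
  have h1 := weight_add_le hσ t x.1.1 (x.1.2.1 + x.1.2.2)
  rw [x.2] at h1
  have h2 := h1.trans (mul_le_mul_right (weight_add_le hσ t x.1.2.1 x.1.2.2) _)
  calc weight σ t k * (g x.1.1 * (h x.1.2.1 * l x.1.2.2))
      ≤ (weight σ t x.1.1 * (weight σ t x.1.2.1 * weight σ t x.1.2.2)) *
        (g x.1.1 * (h x.1.2.1 * l x.1.2.2)) := mul_le_mul_left h2 _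
    _ = _ := by ring

/-- The generating function `∑ |p| e^{σ|p|} |fₖ| tˢ` over all modes. -/
def modeGenFun (f : Mode → C3) (σ t : ℝ) : ℝ≥0∞ := ∑' k, weight σ t k * modeSize f k

/-- The Gevrey norm `∑ |p| e^{σ|p|} |vₚ|`. -/
def waveGevrey (v : (Fin 3 → ℤ) → C3) (σ : ℝ) : ℝ≥0∞ :=
  ∑' p, ENNReal.ofReal (Real.exp (σ * waveLength p)) * (ENNReal.ofReal (waveLength p) * ‖v p‖ₑ)

theorem tsum_weight_source_le {σ : ℝ} (hσ : 0 ≤ σ) (t : ℝ) (f : Mode → C3) :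
    ∑' k, weight σ t k *
      ((ENNReal.ofReal √2)⁻¹ * ∑' x : PairFiber k, modeSize f x.1.1 * modeSize f x.1.2 +
      6⁻¹ * ∑' x : TripleFiber k, modeSize f x.1.1 * (modeSize f x.1.2.1 * modeSize f x.1.2.2)) ≤
    (ENNReal.ofReal √2)⁻¹ * modeGenFun f σ t ^ 2 + 6⁻¹ * modeGenFun f σ t ^ 3 := by
  have h2 := tsum_weight_pair_le hσ t (modeSize f) (modeSize f)
  have h3 := tsum_weight_triple_le hσ t (modeSize f) (modeSize f) (modeSize f)
  have e2 : modeGenFun f σ t ^ 2 = modeGenFun f σ t * modeGenFun f σ t := by ring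
  have e3 : modeGenFun f σ t ^ 3 = modeGenFun f σ t * (modeGenFun f σ t * modeGenFun f σ t) := by
    ring
  simp only [mul_add, mul_left_comm (weight _ _ _)]
  rw [ENNReal.tsum_add, ENNReal.tsum_mul_left, ENNReal.tsum_mul_left, e2, e3]
  exact add_le_add (mul_le_mul_right h2 _) (mul_le_mul_right h3 _)

theorem tsum_weight_initial (σ t : ℝ) :
    ∑' k : Mode, weight σ t k * (ENNReal.ofReal (waveLength k.2) *
      ‖if k.1 = 1 then v k.2 else 0‖ₑ) = ENNReal.ofReal t * waveGevrey v σ := by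
  rw [ENNReal.tsum_prod', tsum_eq_single 1 (fun s hs => by simp [hs]), waveGevrey,
    ← ENNReal.tsum_mul_left]
  refine tsum_congr fun p => ?_
  simp only [weight, if_true, pow_one]
  ring

theorem modeSize_xi_le (k : Mode) : modeSize (xi v) k ≤
    ENNReal.ofReal (waveLength k.2) * ‖if k.1 = 1 then v k.2 else 0‖ₑ +
      ENNReal.ofReal (waveLength k.2) * ‖helmholtz k.2 (divSource (trunc (xi v) k.1) k)
        (curlSource (trunc (xi v) k.1) k)‖ₑ := by
  rw [modeSize, xi_eq_trunc, ← mul_add]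
  exact mul_le_mul_right (enorm_add_le _ _) _

theorem modeSize_trunc_mono (f : Mode → C3) {M N : ℕ} (h : M ≤ N) (k : Mode) :
    modeSize (trunc f M) k ≤ modeSize (trunc f N) k := by
  simp only [modeSize, trunc]
  by_cases h1 : k.1 < M
  · rw [if_pos h1, if_pos (h1.trans_le h)]
  · simp [h1]

theorem modeSize_trunc_le (f : Mode → C3) (N : ℕ) (k : Mode) :
    modeSize (trunc f N) k ≤ modeSize f k := by
  simp only [modeSize, trunc]
  split_ifs <;> simp

/-- The cubic inequality for the generating function of the displacement. -/
theorem modeGenFun_xi_le {σ : ℝ} (hσ : 0 ≤ σ) (t : ℝ) :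
    modeGenFun (xi v) σ t ≤ ENNReal.ofReal t * waveGevrey v σ +
      ((ENNReal.ofReal √2)⁻¹ * modeGenFun (xi v) σ t ^ 2 + 6⁻¹ * modeGenFun (xi v) σ t ^ 3) := by
  rw [← tsum_weight_initial]
  refine le_trans ?_ (add_le_add le_rfl (tsum_weight_source_le hσ t _))
  rw [← ENNReal.tsum_add]
  refine ENNReal.tsum_le_tsum fun k => ?_
  rw [← mul_add]
  refine mul_le_mul_right ((modeSize_xi_le v k).trans (add_le_add le_rfl
    ((modeSize_helmholtz_le _ _).trans ?_))) _
  gcongr <;> exact modeSize_trunc_le _ _ _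

/-- The cubic inequality for the full series does not exclude the value `∞`. Here the modes of order
at most `N` are bounded through those of order below `N`, which permits an induction starting from
zero. -/
theorem modeGenFun_trunc_xi_le {σ : ℝ} (hσ : 0 ≤ σ) (t : ℝ) (N : ℕ) :
    modeGenFun (trunc (xi v) (N + 1)) σ t ≤ ENNReal.ofReal t * waveGevrey v σ +
      ((ENNReal.ofReal √2)⁻¹ * modeGenFun (trunc (xi v) N) σ t ^ 2 +
        6⁻¹ * modeGenFun (trunc (xi v) N) σ t ^ 3) := by
  rw [← tsum_weight_initial]
  refine le_trans ?_ (add_le_add le_rfl (tsum_weight_source_le hσ t _))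
  rw [← ENNReal.tsum_add]
  refine ENNReal.tsum_le_tsum fun k => ?_
  rw [← mul_add]
  refine mul_le_mul_right ?_ _
  by_cases hk : k.1 < N + 1
  · rw [modeSize, trunc_eq _ hk]
    refine (modeSize_xi_le v k).trans (add_le_add le_rfl ((modeSize_helmholtz_le _ _).trans ?_))
    gcongr <;> exact modeSize_trunc_mono _ (Nat.lt_succ_iff.1 hk) _
  · simp [modeSize, trunc, hk]

/-- The value `2 - √2` is the positive root of `1 = √2 ζ + ζ²/2`, hence the maximiser of `ζ - ζ²/√2
- ζ³/6` on `ζ ≥ 0`, and `T_c` is the maximum. -/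
theorem criticalT_identity :
    criticalT + ((ENNReal.ofReal √2)⁻¹ * ENNReal.ofReal (2 - √2) ^ 2 +
      6⁻¹ * ENNReal.ofReal (2 - √2) ^ 3) = ENNReal.ofReal (2 - √2) := by
  have h2 : √2 ^ 2 = 2 := Real.sq_sqrt (by norm_num)
  have h0 : 0 < √2 := by positivity
  have h1 : √2 < 3 / 2 := by nlinarith
  have hT : 0 ≤ (8 - 5 * √2) / 3 := by linarith
  have hz : 0 ≤ 2 - √2 := by linarith
  have h6 : (6 : ℝ≥0∞)⁻¹ = ENNReal.ofReal 6⁻¹ := by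
    rw [ENNReal.ofReal_inv_of_pos (by norm_num)]; simp
  rw [criticalT, h6, ← ENNReal.ofReal_inv_of_pos h0, ← ENNReal.ofReal_pow hz,
    ← ENNReal.ofReal_pow hz, ← ENNReal.ofReal_mul (by positivity),
    ← ENNReal.ofReal_mul (by positivity), ← ENNReal.ofReal_add (by positivity) (by positivity),
    ← ENNReal.ofReal_add hT (by positivity)]
  congr 1
  have h3 : (√2)⁻¹ = √2 / 2 := by field_simp; linarith
  rw [h3]
  have h4 : √2 ^ 3 = 2 * √2 := by rw [pow_succ, h2]
  ring_nf
  rw [h2, h4]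
  ring

/-- The generating function stays below the critical value `2 - √2` up to the critical time. -/
theorem modeGenFun_xi_le_of_le {σ : ℝ} (hσ : 0 ≤ σ) {t : ℝ}
    (ht : ENNReal.ofReal t * waveGevrey v σ ≤ criticalT) :
    modeGenFun (xi v) σ t ≤ ENNReal.ofReal (2 - √2) := by
  -- The map `ζ ↦ tΓ + ζ²/√2 + ζ³/6` is monotone and, for `tΓ ≤ T_c`, sends `[0, 2 - √2]` into
  -- itself.
  have h : ∀ N, modeGenFun (trunc (xi v) N) σ t ≤ ENNReal.ofReal (2 - √2) := by
    intro N
    induction N with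
    | zero => simp [modeGenFun, modeSize, trunc]
    | succ N ih =>
      refine (modeGenFun_trunc_xi_le v hσ t N).trans (le_trans ?_ criticalT_identity.le)
      gcongr
  -- Every finite set of modes is contained in some truncation.
  refine ENNReal.summable.tsum_le_of_sum_le fun S => ?_
  refine le_trans ?_ (h (S.sup Prod.fst + 1))
  refine le_trans (Finset.sum_le_sum fun k hk => ?_) (ENNReal.sum_le_tsum S)
  rw [modeSize, modeSize, trunc_eq _ (Nat.lt_succ_iff.2 (Finset.le_sup (f := Prod.fst) hk))]

end

section

/-! ### The inequality for the gradient generating function -/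

/-- The size `|pⱼ| |fₖ,ₗ|` of the entry `∂ⱼ fₗ` of the gradient of a mode. -/
def entrySize (f : Mode → C3) (j l : Fin 3) (k : Mode) : ℝ≥0∞ := ‖(k.2 j : ℂ) * f k l‖ₑ

theorem enorm_mul_le_of_norm_le_one {a : ℂ} (ha : ‖a‖ ≤ 1) (z : ℂ) : ‖a * z‖ₑ ≤ ‖z‖ₑ := by
  rw [enorm_mul]
  refine mul_le_of_le_one_left' ?_
  rw [← ofReal_norm]
  exact ENNReal.ofReal_le_one.2 ha

theorem norm_wave_mul_wave_le (p : Fin 3 → ℤ) (a b : Fin 3) :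
    ‖((waveLength p ^ 2 : ℝ) : ℂ)⁻¹ * ((p a : ℂ) * p b)‖ ≤ 1 := by
  rw [norm_mul, norm_inv, norm_mul, Complex.norm_real, Real.norm_of_nonneg (by positivity),
    Complex.norm_intCast, Complex.norm_intCast]
  have h : |(p a : ℝ)| * |(p b : ℝ)| ≤ waveLength p ^ 2 := by
    rw [sq]
    exact mul_le_mul (abs_le_waveLength p a) (abs_le_waveLength p b) (abs_nonneg _)
      (waveLength_nonneg p)
  exact inv_mul_le_one_of_le₀ h (by positivity)

/-- An entry of the gradient is a combination of the divergence and of two components of the curl,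
with coefficients `pⱼ pₘ/|p|²` of modulus at most one. -/
theorem enorm_wave_mul_helmholtz_le (p : Fin 3 → ℤ) (d : ℂ) (c : C3) (j l : Fin 3) :
    ‖(p j : ℂ) * helmholtz p d c l‖ₑ ≤ ‖d‖ₑ + (‖c (l + 2)‖ₑ + ‖c (l + 1)‖ₑ) := by
  have e : (p j : ℂ) * helmholtz p d c l =
      -Complex.I * (((waveLength p ^ 2 : ℝ) : ℂ)⁻¹ * ((p j : ℂ) * p l)) * d +
      (Complex.I * (((waveLength p ^ 2 : ℝ) : ℂ)⁻¹ * ((p j : ℂ) * p (l + 1))) * c (l + 2) +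
      -Complex.I * (((waveLength p ^ 2 : ℝ) : ℂ)⁻¹ * ((p j : ℂ) * p (l + 2))) * c (l + 1)) := by
    simp only [helmholtz, PiLp.smul_apply, PiLp.add_apply, cross_apply, wave_apply, smul_eq_mul]
    ring
  rw [e]
  refine (enorm_add_le _ _).trans (add_le_add ?_ ((enorm_add_le _ _).trans (add_le_add ?_ ?_))) <;>
  · refine enorm_mul_le_of_norm_le_one ?_ _
    rw [norm_mul]
    simpa using norm_wave_mul_wave_le p _ _

theorem enorm_inv_ofNat_mul (n : ℕ) [n.AtLeastTwo] (z : ℂ) :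
    ‖(OfNat.ofNat n : ℂ)⁻¹ * z‖ₑ = (OfNat.ofNat n : ℝ≥0∞)⁻¹ * ‖z‖ₑ := by
  rw [enorm_mul, enorm_inv (NeZero.ne _)]
  congr 2
  rw [← ofReal_norm, Complex.norm_ofNat, ENNReal.ofReal_ofNat]

variable (f : Mode → C3)

/-- The majorant of the quadratic interaction in the divergence equation. -/
def quadDivMajorant (x : Mode × Mode) : ℝ≥0∞ :=
  ∑ a, ((entrySize f (a + 1) (a + 1) x.1 * entrySize f (a + 2) (a + 2) x.2 +
    entrySize f (a + 1) (a + 2) x.1 * entrySize f (a + 2) (a + 1) x.2) +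
    (entrySize f (a + 2) (a + 1) x.1 * entrySize f (a + 1) (a + 2) x.2 +
    entrySize f (a + 2) (a + 2) x.1 * entrySize f (a + 1) (a + 1) x.2))

/-- The majorant of a component of the quadratic interaction in the curl equation. -/
def quadCurlMajorant (b : Fin 3) (x : Mode × Mode) : ℝ≥0∞ :=
  ∑ e, (entrySize f (b + 1) e x.1 * entrySize f (b + 2) e x.2 +
    entrySize f (b + 2) e x.1 * entrySize f (b + 1) e x.2)

/-- The majorant of the cubic interaction. -/
def cubDivMajorant (x : Mode × Mode × Mode) : ℝ≥0∞ :=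
  ∑ a, ∑ b,
    ((entrySize f a b x.1 * (entrySize f (a + 1) (b + 1) x.2.1 * entrySize f (a + 2) (b + 2) x.2.2) +
    entrySize f a b x.1 * (entrySize f (a + 1) (b + 2) x.2.1 * entrySize f (a + 2) (b + 1) x.2.2)) +
    (entrySize f a b x.1 * (entrySize f (a + 2) (b + 1) x.2.1 * entrySize f (a + 1) (b + 2) x.2.2) +
    entrySize f a b x.1 * (entrySize f (a + 2) (b + 2) x.2.1 * entrySize f (a + 1) (b + 1) x.2.2)))

theorem enorm_quadDiv_le (x : Mode × Mode) :
    ‖quadDiv f x‖ₑ ≤ 2⁻¹ * quadDivMajorant f x := by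
  rw [quadDiv, enorm_inv_ofNat_mul, dot, quadDivMajorant]
  refine mul_le_mul_right ((enorm_sum_le _ _).trans (Finset.sum_le_sum fun a _ => ?_)) _
  simp only [entrySize, ← enorm_mul, cross_apply, wave_apply]
  rw [show ((x.1.2 (a + 1) : ℂ) * x.2.2 (a + 2) - x.1.2 (a + 2) * x.2.2 (a + 1)) *
      (f x.1 (a + 1) * f x.2 (a + 2) - f x.1 (a + 2) * f x.2 (a + 1)) =
    ((x.1.2 (a + 1) * f x.1 (a + 1) * (x.2.2 (a + 2) * f x.2 (a + 2)) -
      x.1.2 (a + 1) * f x.1 (a + 2) * (x.2.2 (a + 2) * f x.2 (a + 1))) -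
    (x.1.2 (a + 2) * f x.1 (a + 1) * (x.2.2 (a + 1) * f x.2 (a + 2)) -
      x.1.2 (a + 2) * f x.1 (a + 2) * (x.2.2 (a + 1) * f x.2 (a + 1)))) by ring]
  exact enorm_sub_le.trans (add_le_add enorm_sub_le enorm_sub_le)

theorem enorm_quadCurl_le (b : Fin 3) (x : Mode × Mode) :
    ‖quadCurl f x b‖ₑ ≤ 2⁻¹ * quadCurlMajorant f b x := by
  rw [quadCurl, PiLp.smul_apply, smul_eq_mul, mul_assoc, mul_assoc, enorm_inv_ofNat_mul]
  refine mul_le_mul_right ((enorm_mul_le_of_norm_le_one (norm_orderRatio_le _ _) _).trans ?_) _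
  rw [quadCurlMajorant, dot, Finset.sum_mul]
  refine (enorm_sum_le _ _).trans (Finset.sum_le_sum fun e _ => ?_)
  simp only [entrySize, ← enorm_mul, cross_apply, wave_apply]
  rw [show f x.1 e * f x.2 e * ((x.1.2 (b + 1) : ℂ) * x.2.2 (b + 2) -
      x.1.2 (b + 2) * x.2.2 (b + 1)) =
    x.1.2 (b + 1) * f x.1 e * (x.2.2 (b + 2) * f x.2 e) -
      x.1.2 (b + 2) * f x.1 e * (x.2.2 (b + 1) * f x.2 e) by ring]
  exact enorm_sub_le

theorem enorm_cubDiv_le (x : Mode × Mode × Mode) :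
    ‖cubDiv f x‖ₑ ≤ 6⁻¹ * cubDivMajorant f x := by
  refine (enorm_mul_le_of_norm_le_one Complex.norm_I.le _).trans ?_
  rw [enorm_inv_ofNat_mul, det3, det3, dot, dot, cubDivMajorant, Finset.sum_mul_sum]
  refine mul_le_mul_right ((enorm_sum_le _ _).trans (Finset.sum_le_sum fun a _ =>
    (enorm_sum_le _ _).trans (Finset.sum_le_sum fun b _ => ?_))) _
  simp only [entrySize, ← enorm_mul, cross_apply, wave_apply]
  rw [show (x.1.2 a : ℂ) * (x.2.1.2 (a + 1) * x.2.2.2 (a + 2) - x.2.1.2 (a + 2) * x.2.2.2 (a + 1)) *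
      (f x.1 b * (f x.2.1 (b + 1) * f x.2.2 (b + 2) - f x.2.1 (b + 2) * f x.2.2 (b + 1))) =
    ((x.1.2 a * f x.1 b * (x.2.1.2 (a + 1) * f x.2.1 (b + 1) *
        (x.2.2.2 (a + 2) * f x.2.2 (b + 2))) -
      x.1.2 a * f x.1 b * (x.2.1.2 (a + 1) * f x.2.1 (b + 2) *
        (x.2.2.2 (a + 2) * f x.2.2 (b + 1)))) -
    (x.1.2 a * f x.1 b * (x.2.1.2 (a + 2) * f x.2.1 (b + 1) *
        (x.2.2.2 (a + 1) * f x.2.2 (b + 2))) -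
      x.1.2 a * f x.1 b * (x.2.1.2 (a + 2) * f x.2.1 (b + 2) *
        (x.2.2.2 (a + 1) * f x.2.2 (b + 1))))) by ring]
  exact enorm_sub_le.trans (add_le_add enorm_sub_le enorm_sub_le)

theorem enorm_tsum_apply_le {ι : Type*} (F : ι → C3) (b : Fin 3) :
    ‖(∑' x, F x) b‖ₑ ≤ ∑' x, ‖F x b‖ₑ := by
  by_cases h : Summable F
  · have := h.hasSum.mapL (EuclideanSpace.proj b : C3 →L[ℂ] ℂ)
    exact (congrArg _ this.tsum_eq.symm).le.trans enorm_tsum_le_tsum_enorm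
  · simp [tsum_eq_zero_of_not_summable h]

theorem enorm_divSource_le (k : Mode) : ‖divSource f k‖ₑ ≤
    ∑' x : PairFiber k, 2⁻¹ * quadDivMajorant f x +
      ∑' x : TripleFiber k, 6⁻¹ * cubDivMajorant f x :=
  (enorm_add_le _ _).trans (add_le_add
    (enorm_tsum_le_tsum_enorm.trans (ENNReal.tsum_le_tsum fun x => enorm_quadDiv_le f x))
    (enorm_tsum_le_tsum_enorm.trans (ENNReal.tsum_le_tsum fun x => enorm_cubDiv_le f x)))

theorem enorm_curlSource_le (k : Mode) (b : Fin 3) : ‖curlSource f k b‖ₑ ≤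
    ∑' x : PairFiber k, 2⁻¹ * quadCurlMajorant f b x :=
  (enorm_tsum_apply_le _ b).trans (ENNReal.tsum_le_tsum fun x => enorm_quadCurl_le f b x)

/-- The norm `maxⱼₗ ∑ₚ e^{σ|p|} |pⱼ vₚ,ₗ|` of the gradient of a sequence of Fourier coefficients. -/
def gradNorm (σ : ℝ) (v : (Fin 3 → ℤ) → C3) : ℝ≥0∞ :=
  ⨆ (j : Fin 3) (l : Fin 3),
    ∑' p, ENNReal.ofReal (Real.exp (σ * waveLength p)) * ‖(p j : ℂ) * v p l‖ₑ

/-- The generating function of the gradient norms. -/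
def gradSeries (σ t : ℝ) : ℝ≥0∞ :=
  ∑' s : ℕ, gradNorm σ (fun p => f (s, p)) * ENNReal.ofReal t ^ s

theorem tsum_weight_entrySize_le (σ t : ℝ) (j l : Fin 3) (s : ℕ) :
    ∑' p, weight σ t (s, p) * entrySize f j l (s, p) ≤
      gradNorm σ (fun p => f (s, p)) * ENNReal.ofReal t ^ s := by
  have h : ∑' p, ENNReal.ofReal (Real.exp (σ * waveLength p)) * ‖(p j : ℂ) * f (s, p) l‖ₑ ≤
      gradNorm σ (fun p => f (s, p)) :=
    le_iSup₂ (f := fun j l : Fin 3 => ∑' p, ENNReal.ofReal (Real.exp (σ * waveLength p)) *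
      ‖(p j : ℂ) * f (s, p) l‖ₑ) j l
  refine le_trans (le_of_eq ?_) (mul_le_mul_left h _)
  rw [← ENNReal.tsum_mul_right]
  exact tsum_congr fun p => by simp only [weight, entrySize]; ring

/-- Weighted sum of a function of pairs of modes and of their total order. -/
def pairSum (σ t : ℝ) (F : ℕ → Mode × Mode → ℝ≥0∞) : ℝ≥0∞ :=
  ∑' k, weight σ t k * ∑' x : PairFiber k, F k.1 x

theorem pairSum_add (σ t : ℝ) (F G : ℕ → Mode × Mode → ℝ≥0∞) :
    pairSum σ t (fun s x => F s x + G s x) = pairSum σ t F + pairSum σ t G := by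
  simp only [pairSum, ENNReal.tsum_add, mul_add]

theorem pairSum_const_mul (σ t : ℝ) (c : ℝ≥0∞) (F : ℕ → Mode × Mode → ℝ≥0∞) :
    pairSum σ t (fun s x => c * F s x) = c * pairSum σ t F := by
  simp only [pairSum, ENNReal.tsum_mul_left, mul_left_comm _ c]

theorem pairSum_sum (σ t : ℝ) (F : Fin 3 → ℕ → Mode × Mode → ℝ≥0∞) :
    pairSum σ t (fun s x => ∑ a, F a s x) = ∑ a, pairSum σ t (F a) := by
  simp only [Fin.sum_univ_three, pairSum_add]

/-- Weighted sum of a function of triples of modes. -/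
def tripleSum (σ t : ℝ) (F : Mode × Mode × Mode → ℝ≥0∞) : ℝ≥0∞ :=
  ∑' k, weight σ t k * ∑' x : TripleFiber k, F x

theorem tripleSum_add (σ t : ℝ) (F G : Mode × Mode × Mode → ℝ≥0∞) :
    tripleSum σ t (fun x => F x + G x) = tripleSum σ t F + tripleSum σ t G := by
  simp only [tripleSum, ENNReal.tsum_add, mul_add]

theorem tripleSum_const_mul (σ t : ℝ) (c : ℝ≥0∞) (F : Mode × Mode × Mode → ℝ≥0∞) :
    tripleSum σ t (fun x => c * F x) = c * tripleSum σ t F := by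
  simp only [tripleSum, ENNReal.tsum_mul_left, mul_left_comm _ c]

theorem tripleSum_sum (σ t : ℝ) (F : Fin 3 → Mode × Mode × Mode → ℝ≥0∞) :
    tripleSum σ t (fun x => ∑ a, F a x) = ∑ a, tripleSum σ t (F a) := by
  simp only [Fin.sum_univ_three, tripleSum_add]

/-- The entries may vary with the total order because `gradNorm` takes its maximum separately at
each order, so the maximising entry on the left of the recursion depends on `s`. -/
theorem pairSum_entrySize_le {σ : ℝ} (hσ : 0 ≤ σ) (t : ℝ) (a b c d : ℕ → Fin 3) :
    pairSum σ t (fun s x => entrySize f (a s) (b s) x.1 * entrySize f (c s) (d s) x.2) ≤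
      gradSeries f σ t * gradSeries f σ t := by
  have h1 : pairSum σ t (fun s x => entrySize f (a s) (b s) x.1 * entrySize f (c s) (d s) x.2) ≤
      ∑' x : Mode × Mode,
        (weight σ t x.1 * entrySize f (a (x.1.1 + x.2.1)) (b (x.1.1 + x.2.1)) x.1) *
        (weight σ t x.2 * entrySize f (c (x.1.1 + x.2.1)) (d (x.1.1 + x.2.1)) x.2) := by
    rw [← tsum_pairFiber]
    refine ENNReal.tsum_le_tsum fun k => ?_
    rw [← ENNReal.tsum_mul_left]
    refine ENNReal.tsum_le_tsum fun x => ?_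
    have h2 := weight_add_le hσ t x.1.1 x.1.2
    rw [x.2] at h2
    rw [show x.1.1.1 + x.1.2.1 = k.1 from congrArg Prod.fst x.2]
    calc _ ≤ (weight σ t x.1.1 * weight σ t x.1.2) * _ := mul_le_mul_left h2 _
      _ = _ := by ring
  refine h1.trans ?_
  rw [gradSeries, ← tsum_mul_prod, ENNReal.tsum_prod', ENNReal.tsum_prod', ENNReal.tsum_prod']
  refine ENNReal.tsum_le_tsum fun n => ?_
  simp only [ENNReal.tsum_prod']
  -- Both orders are fixed before summing over wave vectors. The entry indices are then constant,
  -- and each factor is bounded by its `gradNorm`.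
  rw [ENNReal.tsum_comm]
  refine ENNReal.tsum_le_tsum fun m => ?_
  simp only [ENNReal.tsum_mul_left, ENNReal.tsum_mul_right]
  exact mul_le_mul' (tsum_weight_entrySize_le f σ t _ _ n) (tsum_weight_entrySize_le f σ t _ _ m)

theorem tsum_weight_entrySize_le_gradSeries (σ t : ℝ) (j l : Fin 3) :
    ∑' k, weight σ t k * entrySize f j l k ≤ gradSeries f σ t := by
  rw [ENNReal.tsum_prod']
  exact ENNReal.tsum_le_tsum fun s => tsum_weight_entrySize_le f σ t j l s

theorem tripleSum_entrySize_le {σ : ℝ} (hσ : 0 ≤ σ) (t : ℝ) (a b c d e g : Fin 3) :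
    tripleSum σ t (fun x => entrySize f a b x.1 * (entrySize f c d x.2.1 * entrySize f e g x.2.2)) ≤
      gradSeries f σ t * (gradSeries f σ t * gradSeries f σ t) :=
  (tsum_weight_triple_le hσ t _ _ _).trans (mul_le_mul'
    (tsum_weight_entrySize_le_gradSeries f σ t _ _) (mul_le_mul'
      (tsum_weight_entrySize_le_gradSeries f σ t _ _)
      (tsum_weight_entrySize_le_gradSeries f σ t _ _)))

/-- Three components with four products each. The curl bound counts three terms with two products,
the cubic bound nine terms with four. -/
theorem pairSum_quadDivMajorant_le {σ : ℝ} (hσ : 0 ≤ σ) (t : ℝ) :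
    pairSum σ t (fun _ => quadDivMajorant f) ≤ 12 * (gradSeries f σ t * gradSeries f σ t) := by
  unfold quadDivMajorant
  rw [pairSum_sum]
  calc _ ≤ ∑ _a : Fin 3, ((gradSeries f σ t * gradSeries f σ t + gradSeries f σ t * gradSeries f σ t)
        + (gradSeries f σ t * gradSeries f σ t + gradSeries f σ t * gradSeries f σ t)) := by
        refine Finset.sum_le_sum fun a _ => ?_
        rw [pairSum_add, pairSum_add, pairSum_add]
        gcongr <;>
        · refine pairSum_entrySize_le f hσ t (fun _ => _) (fun _ => _) (fun _ => _) (fun _ => _)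
    _ = _ := by rw [Fin.sum_univ_three]; ring

theorem pairSum_quadCurlMajorant_le {σ : ℝ} (hσ : 0 ≤ σ) (t : ℝ) (b : ℕ → Fin 3) :
    pairSum σ t (fun s => quadCurlMajorant f (b s)) ≤
      6 * (gradSeries f σ t * gradSeries f σ t) := by
  unfold quadCurlMajorant
  rw [pairSum_sum σ t fun e s x => _]
  calc _ ≤ ∑ _a : Fin 3,
        (gradSeries f σ t * gradSeries f σ t + gradSeries f σ t * gradSeries f σ t) := by
        refine Finset.sum_le_sum fun a _ => ?_
        rw [pairSum_add]
        gcongr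
        · exact pairSum_entrySize_le f hσ t (fun s => b s + 1) (fun _ => a) (fun s => b s + 2)
            (fun _ => a)
        · exact pairSum_entrySize_le f hσ t (fun s => b s + 2) (fun _ => a) (fun s => b s + 1)
            (fun _ => a)
    _ = _ := by rw [Fin.sum_univ_three]; ring

theorem tripleSum_cubDivMajorant_le {σ : ℝ} (hσ : 0 ≤ σ) (t : ℝ) :
    tripleSum σ t (cubDivMajorant f) ≤
      36 * (gradSeries f σ t * (gradSeries f σ t * gradSeries f σ t)) := by
  set Z := gradSeries f σ t * (gradSeries f σ t * gradSeries f σ t) with hZ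
  unfold cubDivMajorant
  rw [tripleSum_sum]
  calc _ ≤ ∑ _a : Fin 3, ∑ _b : Fin 3, ((Z + Z) + (Z + Z)) := by
        refine Finset.sum_le_sum fun a _ => ?_
        rw [tripleSum_sum]
        refine Finset.sum_le_sum fun b _ => ?_
        rw [tripleSum_add, tripleSum_add, tripleSum_add]
        gcongr <;> exact tripleSum_entrySize_le f hσ t _ _ _ _ _ _
    _ = _ := by simp only [Fin.sum_univ_three]; ring

/-- The cubic inequality for the gradient generating function of the displacement. -/
theorem gradSeries_xi_le (v : (Fin 3 → ℤ) → C3) {σ : ℝ} (hσ : 0 ≤ σ) (t : ℝ) :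
    gradSeries (xi v) σ t ≤ 6 * gradSeries (xi v) σ t ^ 3 + 12 * gradSeries (xi v) σ t ^ 2 +
      ENNReal.ofReal t * gradNorm σ v := by
  -- At each order an entry attaining the maximum is selected; `m` records the choice.
  have hsup : ∀ s : ℕ, ∃ jl : Fin 3 × Fin 3, gradNorm σ (fun p => xi v (s, p)) =
      ∑' p, ENNReal.ofReal (Real.exp (σ * waveLength p)) * ‖(p jl.1 : ℂ) * xi v (s, p) jl.2‖ₑ := by
    intro s
    obtain ⟨j, hj⟩ := exists_eq_ciSup_of_finite (f := fun j : Fin 3 => ⨆ l : Fin 3,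
      ∑' p, ENNReal.ofReal (Real.exp (σ * waveLength p)) * ‖(p j : ℂ) * xi v (s, p) l‖ₑ)
    obtain ⟨l, hl⟩ := exists_eq_ciSup_of_finite (f := fun l : Fin 3 =>
      ∑' p, ENNReal.ofReal (Real.exp (σ * waveLength p)) * ‖(p j : ℂ) * xi v (s, p) l‖ₑ)
    exact ⟨(j, l), by rw [gradNorm, ← hj, ← hl]⟩
  choose m hm using hsup
  have hZ : gradSeries (xi v) σ t =
      ∑' k : Mode, weight σ t k * entrySize (xi v) (m k.1).1 (m k.1).2 k := by
    rw [gradSeries, ENNReal.tsum_prod']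
    refine tsum_congr fun s => ?_
    rw [hm s, ← ENNReal.tsum_mul_right]
    exact tsum_congr fun p => by simp only [weight, entrySize]; ring
  set Z := gradSeries (xi v) σ t with hZdef
  have hk : ∀ k : Mode, entrySize (xi v) (m k.1).1 (m k.1).2 k ≤
      ‖(k.2 (m k.1).1 : ℂ) * (if k.1 = 1 then v k.2 else 0 : C3) (m k.1).2‖ₑ +
      ((∑' x : PairFiber k, 2⁻¹ * quadDivMajorant (xi v) x +
        ∑' x : TripleFiber k, 6⁻¹ * cubDivMajorant (xi v) x) +
      (∑' x : PairFiber k, 2⁻¹ * quadCurlMajorant (xi v) ((m k.1).2 + 2) x +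
        ∑' x : PairFiber k, 2⁻¹ * quadCurlMajorant (xi v) ((m k.1).2 + 1) x)) := by
    intro k
    rw [entrySize, xi_eq, PiLp.add_apply, mul_add]
    refine (enorm_add_le _ _).trans (add_le_add le_rfl
      ((enorm_wave_mul_helmholtz_le _ _ _ _ _).trans ?_))
    exact add_le_add (enorm_divSource_le _ k)
      (add_le_add (enorm_curlSource_le _ k _) (enorm_curlSource_le _ k _))
  have hinit : ∑' k : Mode, weight σ t k *
      ‖(k.2 (m k.1).1 : ℂ) * (if k.1 = 1 then v k.2 else 0 : C3) (m k.1).2‖ₑ ≤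
      ENNReal.ofReal t * gradNorm σ v := by
    rw [ENNReal.tsum_prod', tsum_eq_single 1 (fun s hs => by simp [hs])]
    refine le_trans (le_of_eq ?_) (mul_le_mul_right (le_iSup₂ (f := fun j l : Fin 3 =>
      ∑' p, ENNReal.ofReal (Real.exp (σ * waveLength p)) * ‖(p j : ℂ) * v p l‖ₑ)
      (m 1).1 (m 1).2) _)
    rw [← ENNReal.tsum_mul_left]
    exact tsum_congr fun p => by simp only [weight, if_true, pow_one]; ring
  have hQ : ∑' k : Mode, weight σ t k * ∑' x : PairFiber k, 2⁻¹ * quadDivMajorant (xi v) x ≤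
      2⁻¹ * (12 * (Z * Z)) := by
    refine (pairSum_const_mul σ t 2⁻¹ fun _ => quadDivMajorant (xi v)).le.trans ?_
    exact mul_le_mul_right (pairSum_quadDivMajorant_le _ hσ t) _
  have hC : ∀ b : ℕ → Fin 3, ∑' k : Mode, weight σ t k *
      ∑' x : PairFiber k, 2⁻¹ * quadCurlMajorant (xi v) (b k.1) x ≤ 2⁻¹ * (6 * (Z * Z)) := by
    intro b
    refine (pairSum_const_mul σ t 2⁻¹ fun s => quadCurlMajorant (xi v) (b s)).le.trans ?_
    exact mul_le_mul_right (pairSum_quadCurlMajorant_le _ hσ t b) _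
  have hT : ∑' k : Mode, weight σ t k * ∑' x : TripleFiber k, 6⁻¹ * cubDivMajorant (xi v) x ≤
      6⁻¹ * (36 * (Z * (Z * Z))) := by
    refine (tripleSum_const_mul σ t 6⁻¹ (cubDivMajorant (xi v))).le.trans ?_
    exact mul_le_mul_right (tripleSum_cubDivMajorant_le _ hσ t) _
  -- The constants: `12/2` from the divergence and `6/2` from each of two curl components give 12
  -- for the quadratic term; `36/6` gives 6 for the cubic one.
  have e2 : (2⁻¹ : ℝ≥0∞) * 12 = 6 := by
    rw [show (12 : ℝ≥0∞) = 2 * 6 by norm_num, ← mul_assoc, ENNReal.inv_mul_cancel] <;> norm_num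
  have e3 : (2⁻¹ : ℝ≥0∞) * 6 = 3 := by
    rw [show (6 : ℝ≥0∞) = 2 * 3 by norm_num, ← mul_assoc, ENNReal.inv_mul_cancel] <;> norm_num
  have e6 : (6⁻¹ : ℝ≥0∞) * 36 = 6 := by
    rw [show (36 : ℝ≥0∞) = 6 * 6 by norm_num, ← mul_assoc, ENNReal.inv_mul_cancel] <;> norm_num
  rw [← mul_assoc, e2] at hQ
  rw [← mul_assoc, e6] at hT
  simp only [← mul_assoc, e3] at hC
  calc Z ≤ _ := hZ.le.trans (ENNReal.tsum_le_tsum fun k => mul_le_mul_right (hk k) _)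
    _ ≤ ENNReal.ofReal t * gradNorm σ v +
        ((6 * (Z * Z) + 6 * (Z * (Z * Z))) + (3 * Z * Z + 3 * Z * Z)) := by
        simp only [mul_add, ENNReal.tsum_add]
        exact add_le_add hinit (add_le_add (add_le_add hQ hT)
          (add_le_add (hC fun s => (m s).2 + 2) (hC fun s => (m s).2 + 1)))
    _ = _ := by ring

end

section

/-! ### Reality of the displacement -/

/-- Componentwise complex conjugation. -/
def conjC3 : C3 ≃ₗᵢ[ℝ] C3 := LinearIsometryEquiv.piLpCongrRight 2 fun _ => Complex.conjLIE

theorem conjC3_apply (u : C3) (j : Fin 3) : conjC3 u j = (starRingEnd ℂ) (u j) := rfl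

/-- The mode with opposite wave vector. -/
def negMode : Mode ≃ Mode where
  toFun k := (k.1, -k.2)
  invFun k := (k.1, -k.2)
  left_inv k := by simp
  right_inv k := by simp

/-- The condition `f₋ₚ = conj fₚ` on Fourier coefficients of a real field. -/
def IsHermitianMode (f : Mode → C3) : Prop := ∀ k, f (negMode k) = conjC3 (f k)

variable {f : Mode → C3}

theorem negMode_add (i j : Mode) : negMode (i + j) = negMode i + negMode j := by
  simp [negMode, add_comm]

/-- Negation of wave vectors, on pairs with given sum. -/
def negPair (k : Mode) : PairFiber k ≃ PairFiber (negMode k) :=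
  (negMode.prodCongr negMode).subtypeEquiv fun x => by
    simp [← negMode_add]

/-- Negation of wave vectors, on triples with given sum. -/
def negTriple (k : Mode) : TripleFiber k ≃ TripleFiber (negMode k) :=
  (negMode.prodCongr (negMode.prodCongr negMode)).subtypeEquiv fun x => by
    simp [← negMode_add]

theorem quadDiv_neg (hf : IsHermitianMode f) (k : Mode) (x : PairFiber k) :
    quadDiv f (negPair k x) = (starRingEnd ℂ) (quadDiv f x) := by
  have h1 : f (negPair k x).1.1 = conjC3 (f x.1.1) := hf _
  have h2 : f (negPair k x).1.2 = conjC3 (f x.1.2) := hf _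
  have h3 : (negPair k x).1.1.2 = -x.1.1.2 := rfl
  have h4 : (negPair k x).1.2.2 = -x.1.2.2 := rfl
  simp only [quadDiv, dot, cross_apply, h1, h2, h3, h4, conjC3_apply, map_mul,
    map_sum, map_sub, wave_apply, map_inv₀, map_ofNat]
  simp [Fin.sum_univ_three]

theorem quadCurl_neg (hf : IsHermitianMode f) (k : Mode) (x : PairFiber k) :
    quadCurl f (negPair k x) = conjC3 (quadCurl f x) := by
  have h1 : f (negPair k x).1.1 = conjC3 (f x.1.1) := hf _
  have h2 : f (negPair k x).1.2 = conjC3 (f x.1.2) := hf _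
  have h3 : (negPair k x).1.1.2 = -x.1.1.2 := rfl
  have h4 : (negPair k x).1.2.2 = -x.1.2.2 := rfl
  have h5 : (negPair k x).1.1.1 = x.1.1.1 := rfl
  have h6 : (negPair k x).1.2.1 = x.1.2.1 := rfl
  ext j
  simp only [quadCurl, PiLp.smul_apply, smul_eq_mul, dot, cross_apply, h1, h2, h3, h4, h5, h6,
    conjC3_apply, map_mul, map_sum, map_sub, wave_apply, map_inv₀, map_ofNat]
  simp

theorem cubDiv_neg (hf : IsHermitianMode f) (k : Mode) (x : TripleFiber k) :
    cubDiv f (negTriple k x) = (starRingEnd ℂ) (cubDiv f x) := by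
  have h1 : f (negTriple k x).1.1 = conjC3 (f x.1.1) := hf _
  have h2 : f (negTriple k x).1.2.1 = conjC3 (f x.1.2.1) := hf _
  have h3 : f (negTriple k x).1.2.2 = conjC3 (f x.1.2.2) := hf _
  have h4 : (negTriple k x).1.1.2 = -x.1.1.2 := rfl
  have h5 : (negTriple k x).1.2.1.2 = -x.1.2.1.2 := rfl
  have h6 : (negTriple k x).1.2.2.2 = -x.1.2.2.2 := rfl
  simp only [cubDiv, det3, dot, cross_apply, h1, h2, h3, h4, h5, h6, conjC3_apply,
    map_mul, map_sum, map_sub, wave_apply, map_inv₀, map_ofNat]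
  simp [Fin.sum_univ_three]
  ring

theorem divSource_neg (hf : IsHermitianMode f) (k : Mode) :
    divSource f (negMode k) = (starRingEnd ℂ) (divSource f k) := by
  rw [divSource, divSource, ← (negPair k).tsum_eq, ← (negTriple k).tsum_eq, map_add]
  simp only [quadDiv_neg hf, cubDiv_neg hf]
  exact congrArg₂ (· + ·) (Complex.conjCLE.map_tsum).symm (Complex.conjCLE.map_tsum).symm

theorem curlSource_neg (hf : IsHermitianMode f) (k : Mode) :
    curlSource f (negMode k) = conjC3 (curlSource f k) := by
  rw [curlSource, curlSource, ← (negPair k).tsum_eq]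
  simp only [quadCurl_neg hf]
  exact (conjC3.toContinuousLinearEquiv.map_tsum).symm

theorem waveLength_neg (p : Fin 3 → ℤ) : waveLength (-p) = waveLength p := by
  simp [waveLength]

theorem helmholtz_neg (p : Fin 3 → ℤ) (d : ℂ) (c : C3) :
    helmholtz (-p) ((starRingEnd ℂ) d) (conjC3 c) = conjC3 (helmholtz p d c) := by
  ext j
  simp only [helmholtz, PiLp.smul_apply, PiLp.add_apply, cross_apply, conjC3_apply,
    wave_apply, Pi.neg_apply, Int.cast_neg, smul_eq_mul, waveLength_neg, map_mul, map_add, map_sub, map_neg, map_inv₀,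
    Complex.conj_I, Complex.conj_ofReal, map_intCast]
  ring

/-- The recursion commutes with conjugation combined with `p ↦ -p`, so the symmetry of the data
propagates by strong induction on the order. -/
theorem isHermitianMode_xi {v : (Fin 3 → ℤ) → C3} (hv : ∀ p, v (-p) = conjC3 (v p)) :
    IsHermitianMode (xi v) := by
  have h : ∀ s p, xi v (negMode (s, p)) = conjC3 (xi v (s, p)) := by
    intro s
    induction s using Nat.strong_induction_on with
    | _ s ih =>
      intro p
      have hf : IsHermitianMode (trunc (xi v) s) := by
        intro k
        have h1 : (negMode k).1 = k.1 := rfl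
        simp only [trunc, h1]
        split_ifs with hk
        · exact ih k.1 hk k.2
        · simp
      have h1 : (negMode (s, p)).1 = s := rfl
      have h2 : (negMode (s, p)).2 = -p := rfl
      rw [xi_eq_trunc, xi_eq_trunc v (s, p), map_add, h1, h2, divSource_neg hf, curlSource_neg hf,
        helmholtz_neg]
      congr 1
      split_ifs
      · exact hv p
      · simp
  exact fun k => h k.1 k.2

/-! ### Divergence and curl of the displacement -/

theorem sum_wave_sq (p : Fin 3 → ℤ) : ∑ j, (p j : ℂ) * p j = ((waveLength p ^ 2 : ℝ) : ℂ) := by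
  rw [waveLength, Real.sq_sqrt (by positivity)]
  push_cast
  simp [sq]

theorem waveLength_eq_zero {p : Fin 3 → ℤ} : waveLength p = 0 ↔ p = 0 := by
  constructor
  · intro h
    funext j
    have h1 := abs_le_waveLength p j
    rw [h] at h1
    simpa using abs_nonpos_iff.1 h1
  · rintro rfl
    simp [waveLength]

/-- Minors of a gradient have mean zero: for wave vectors with sum zero the cross product,
respectively the determinant, vanishes. This makes the divergence equation solvable at `p = 0`. -/
theorem divSource_wave_zero (f : Mode → C3) {k : Mode} (hk : k.2 = 0) : divSource f k = 0 := by
  have h2 : ∀ x : PairFiber k, quadDiv f x = 0 := fun x => by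
    have hx : x.1.2.2 = -x.1.1.2 := by
      have h : x.1.1.2 + x.1.2.2 = k.2 := congrArg Prod.snd x.2
      exact (neg_eq_of_add_eq_zero_right (h.trans hk)).symm
    simp only [quadDiv, dot, cross_apply, hx, wave_apply]
    simp [Fin.sum_univ_three]
    ring
  have h3 : ∀ x : TripleFiber k, cubDiv f x = 0 := fun x => by
    have hx : x.1.1.2 = -(x.1.2.1.2 + x.1.2.2.2) := by
      have h : x.1.1.2 + (x.1.2.1.2 + x.1.2.2.2) = k.2 := congrArg Prod.snd x.2
      exact (neg_eq_of_add_eq_zero_left (h.trans hk)).symm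
    have h4 : det3 (wave x.1.1.2) (wave x.1.2.1.2) (wave x.1.2.2.2) = 0 := by
      simp only [det3, dot, cross_apply, hx, wave_apply]
      simp [Fin.sum_univ_three]
      ring
    rw [cubDiv, h4]
    ring
  simp [divSource, h2, h3]

/-- With `k = p + q`, this is `(p + q)·(p × q) = 0`: the source of the curl equation is
divergence-free, as its solvability requires. -/
theorem dot_wave_quadCurl (f : Mode → C3) {k : Mode} (x : PairFiber k) :
    dot (wave k.2) (quadCurl f x) = 0 := by
  have h : k.2 = x.1.1.2 + x.1.2.2 := (congrArg Prod.snd x.2).symm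
  simp only [quadCurl, dot, PiLp.smul_apply, cross_apply, wave_apply, smul_eq_mul, h]
  simp [Fin.sum_univ_three]
  ring

/-- The functional `dot (wave p)`. -/
def dotWave (p : Fin 3 → ℤ) : C3 →L[ℂ] ℂ := ∑ j, (p j : ℂ) • (EuclideanSpace.proj j : C3 →L[ℂ] ℂ)

theorem dotWave_apply (p : Fin 3 → ℤ) (u : C3) : dotWave p u = dot (wave p) u := by
  simp [dotWave, dot, wave_apply]

theorem dot_wave_curlSource (f : Mode → C3) (k : Mode) :
    dot (wave k.2) (curlSource f k) = 0 := by
  rw [curlSource]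
  by_cases h : Summable fun x : PairFiber k => quadCurl f x
  · have h1 := h.hasSum.mapL (dotWave k.2)
    simp only [dotWave_apply, dot_wave_quadCurl] at h1
    exact h1.unique hasSum_zero
  · rw [tsum_eq_zero_of_not_summable h, dot_zero_right]

theorem curlSource_wave_zero (f : Mode → C3) {k : Mode} (hk : k.2 = 0) : curlSource f k = 0 := by
  have h2 : ∀ x : PairFiber k, quadCurl f x = 0 := fun x => by
    have hx : x.1.2.2 = -x.1.1.2 := by
      have h : x.1.1.2 + x.1.2.2 = k.2 := congrArg Prod.snd x.2
      exact (neg_eq_of_add_eq_zero_right (h.trans hk)).symm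
    ext j
    simp only [quadCurl, PiLp.smul_apply, cross_apply, hx, wave_apply]
    simp
    ring_nf
    simp
  simp [curlSource, h2]

theorem dot_wave_helmholtz {p : Fin 3 → ℤ} (hp : p ≠ 0) (d : ℂ) (c : C3) :
    Complex.I * dot (wave p) (helmholtz p d c) = d := by
  have h0 : ((waveLength p ^ 2 : ℝ) : ℂ) ≠ 0 := by
    simpa using waveLength_eq_zero.not.2 hp
  have e : Complex.I * dot (wave p) (helmholtz p d c) =
      -(Complex.I * Complex.I) * ((waveLength p ^ 2 : ℝ) : ℂ)⁻¹ * (∑ j, (p j : ℂ) * p j) * d := by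
    simp only [dot, helmholtz, PiLp.smul_apply, PiLp.add_apply, cross_apply, wave_apply,
      smul_eq_mul, Fin.sum_univ_three]
    simp
    ring_nf
    simp only [Complex.I_sq]
    ring
  rw [e, sum_wave_sq, Complex.I_mul_I, mul_assoc (-(-1)), inv_mul_cancel₀ h0]
  ring

theorem cross_wave_helmholtz {p : Fin 3 → ℤ} (hp : p ≠ 0) (d : ℂ) {c : C3}
    (hc : dot (wave p) c = 0) : Complex.I • cross (wave p) (helmholtz p d c) = c := by
  have h0 : ((waveLength p ^ 2 : ℝ) : ℂ) ≠ 0 := by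
    simpa using waveLength_eq_zero.not.2 hp
  have e : ∀ a, Complex.I * cross (wave p) (helmholtz p d c) a =
      (Complex.I * Complex.I) * ((waveLength p ^ 2 : ℝ) : ℂ)⁻¹ *
        (p a * dot (wave p) c - (∑ j, (p j : ℂ) * p j) * c a) := by
    intro a
    simp only [dot, helmholtz, PiLp.smul_apply, PiLp.add_apply, cross_apply, wave_apply,
      smul_eq_mul, Fin.sum_univ_three]
    fin_cases a <;>
    · simp
      ring_nf
      simp only [Complex.I_sq]
      ring
  ext a
  rw [PiLp.smul_apply, smul_eq_mul, e, sum_wave_sq, hc, Complex.I_mul_I]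
  field_simp
  ring

variable {v : (Fin 3 → ℤ) → C3}

theorem dot_wave_xi (hv : ∀ p, dot (wave p) (v p) = 0) (k : Mode) :
    Complex.I * dot (wave k.2) (xi v k) = divSource (xi v) k := by
  by_cases hk : k.2 = 0
  · rw [divSource_wave_zero _ hk, hk]
    simp [dot, wave_apply]
  · rw [xi_eq, ← dotWave_apply, map_add, dotWave_apply, dotWave_apply, mul_add,
      dot_wave_helmholtz hk]
    split_ifs
    · rw [hv, mul_zero, zero_add]
    · rw [dot_zero_right, mul_zero, zero_add]

/-- Order one is exempt because there the curl is the initial vorticity. -/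
theorem cross_wave_xi {k : Mode} (hk1 : k.1 ≠ 1) :
    Complex.I • cross (wave k.2) (xi v k) = curlSource (xi v) k := by
  by_cases hk : k.2 = 0
  · rw [curlSource_wave_zero _ hk, hk]
    ext j
    simp [cross_apply, wave_apply]
  · rw [xi_eq, if_neg hk1, zero_add, cross_wave_helmholtz hk _ (dot_wave_curlSource _ _)]

end

section

/-! ### The Lagrangian equations for the summed series -/

theorem hasSum_mul_of_summable_norm {α β : Type*} {F : α → ℂ} {G : β → ℂ}
    (hF : Summable fun i => ‖F i‖) (hG : Summable fun i => ‖G i‖) :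
    HasSum (fun x : α × β => F x.1 * G x.2) ((∑' i, F i) * ∑' i, G i) := by
  rw [tsum_mul_tsum_of_summable_norm hF hG]
  exact (summable_mul_of_summable_norm hF hG).hasSum

section Relations

variable {v : (Fin 3 → ℤ) → C3} {e : Mode → ℂ}

/-- The terms of the series for `∂ⱼ ξₗ`. -/
def gradTerm (e : Mode → ℂ) (f : Mode → C3) (j l : Fin 3) (i : Mode) : ℂ :=
  e i * (Complex.I * i.2 j * f i l)

/-- The terms of the series for `t² ∂ₜ² ∂ⱼ ξₗ`. -/
def accTerm (e : Mode → ℂ) (f : Mode → C3) (j l : Fin 3) (i : Mode) : ℂ :=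
  (i.1 * (i.1 - 1) : ℂ) * gradTerm e f j l i

theorem norm_apply_le (u : C3) (l : Fin 3) : ‖u l‖ ≤ ‖u‖ := PiLp.norm_apply_le u l

theorem norm_gradTerm_le (f : Mode → C3) (j l : Fin 3) (i : Mode) :
    ‖gradTerm e f j l i‖ ≤ ‖e i‖ * (waveLength i.2 * ‖f i‖) := by
  rw [gradTerm, norm_mul, norm_mul, norm_mul, Complex.norm_I, one_mul, Complex.norm_intCast]
  gcongr
  · exact waveLength_nonneg _
  · exact abs_le_waveLength _ _
  · exact norm_apply_le _ _

theorem norm_accTerm_le (f : Mode → C3) (j l : Fin 3) (i : Mode) :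
    ‖accTerm e f j l i‖ ≤ (i.1 : ℝ) ^ 2 * (‖e i‖ * (waveLength i.2 * ‖f i‖)) := by
  rw [accTerm, norm_mul]
  gcongr
  · have h : ((i.1 : ℂ) * (i.1 - 1)) = (((i.1 : ℝ) * (i.1 - 1) : ℝ) : ℂ) := by push_cast; rfl
    rw [h, Complex.norm_real, Real.norm_eq_abs, abs_le]
    rcases Nat.eq_zero_or_pos i.1 with h0 | h0
    · simp [h0]
    · have : (1 : ℝ) ≤ i.1 := by exact_mod_cast h0
      constructor <;> nlinarith
  · exact norm_gradTerm_le _ _ _ _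

variable (hadd : ∀ i j, e (i + j) = e i * e j)
  (hS : Summable fun i => ‖e i‖ * (waveLength i.2 * ‖xi v i‖))

include hS

theorem summable_norm_gradTerm (j l : Fin 3) : Summable fun i => ‖gradTerm e (xi v) j l i‖ :=
  hS.of_nonneg_of_le (fun _ => norm_nonneg _) fun _ => norm_gradTerm_le _ _ _ _

theorem hasSum_gradTerm_mul (j l j' l' : Fin 3) :
    HasSum (fun x : Mode × Mode => gradTerm e (xi v) j l x.1 * gradTerm e (xi v) j' l' x.2)
      ((∑' i, gradTerm e (xi v) j l i) * ∑' i, gradTerm e (xi v) j' l' i) := by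
  have h1 := summable_norm_gradTerm hS j l
  have h2 := summable_norm_gradTerm hS j' l'
  rw [tsum_mul_tsum_of_summable_norm h1 h2]
  exact (summable_mul_of_summable_norm h1 h2).hasSum

theorem hasSum_gradTerm_mul_mul (j l j' l' j'' l'' : Fin 3) :
    HasSum (fun x : Mode × Mode × Mode => gradTerm e (xi v) j l x.1 *
        (gradTerm e (xi v) j' l' x.2.1 * gradTerm e (xi v) j'' l'' x.2.2))
      ((∑' i, gradTerm e (xi v) j l i) * ((∑' i, gradTerm e (xi v) j' l' i) *
        ∑' i, gradTerm e (xi v) j'' l'' i)) := by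
  have h1 := summable_norm_gradTerm hS j l
  have h2 := summable_norm_gradTerm hS j' l'
  have h3 := summable_norm_gradTerm hS j'' l''
  have h4 : Summable fun y : Mode × Mode =>
      ‖gradTerm e (xi v) j' l' y.1 * gradTerm e (xi v) j'' l'' y.2‖ := h2.mul_norm h3
  rw [tsum_mul_tsum_of_summable_norm h2 h3, tsum_mul_tsum_of_summable_norm h1 h4]
  exact (summable_mul_of_summable_norm h1 h4).hasSum

/-- The sum over `a` counts each principal `2 × 2` minor of `∇ξ` twice. The sign comes from `i² =
-1`, as each derivative is multiplication by `i pⱼ`. -/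
theorem hasSum_quadDiv :
    HasSum (fun x : Mode × Mode => e x.1 * e x.2 * quadDiv (xi v) x)
      (-2⁻¹ * ∑ a : Fin 3,
        (((∑' i, gradTerm e (xi v) (a + 1) (a + 1) i) * (∑' i, gradTerm e (xi v) (a + 2) (a + 2) i) -
          (∑' i, gradTerm e (xi v) (a + 1) (a + 2) i) * (∑' i, gradTerm e (xi v) (a + 2) (a + 1) i)) -
        ((∑' i, gradTerm e (xi v) (a + 2) (a + 1) i) * (∑' i, gradTerm e (xi v) (a + 1) (a + 2) i) -
          (∑' i, gradTerm e (xi v) (a + 2) (a + 2) i) *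
            (∑' i, gradTerm e (xi v) (a + 1) (a + 1) i)))) := by
  have h := (hasSum_sum (s := Finset.univ) fun (a : Fin 3) _ =>
    ((hasSum_gradTerm_mul hS (a + 1) (a + 1) (a + 2) (a + 2)).sub
      (hasSum_gradTerm_mul hS (a + 1) (a + 2) (a + 2) (a + 1))).sub
    ((hasSum_gradTerm_mul hS (a + 2) (a + 1) (a + 1) (a + 2)).sub
      (hasSum_gradTerm_mul hS (a + 2) (a + 2) (a + 1) (a + 1)))).mul_left (-2⁻¹)
  refine h.congr_fun fun x => ?_
  simp only [quadDiv, dot, cross_apply, wave_apply, gradTerm, Finset.mul_sum]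
  refine Finset.sum_congr rfl fun a _ => ?_
  ring_nf
  simp only [Complex.I_sq]
  ring

/-- Both determinants are expanded over permutations. After summation the double sum over
permutations is `3!` times the determinant of `∇ξ`, which cancels the factor `1/6`; the sign comes
from `i³ = -i`. -/
theorem hasSum_cubDiv :
    HasSum (fun x : Mode × Mode × Mode => e x.1 * (e x.2.1 * e x.2.2) * cubDiv (xi v) x)
      (-(Matrix.of fun j l => ∑' i, gradTerm e (xi v) j l i).det) := by
  have h := (hasSum_sum (s := (Finset.univ : Finset (Equiv.Perm (Fin 3)))) fun σ _ =>
    (hasSum_sum (s := (Finset.univ : Finset (Equiv.Perm (Fin 3)))) fun τ _ =>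
      (hasSum_gradTerm_mul_mul hS (σ 0) (τ 0) (σ 1) (τ 1) (σ 2) (τ 2)).mul_left
        (((Equiv.Perm.sign σ : ℤ) : ℂ) * ((Equiv.Perm.sign τ : ℤ) : ℂ)))).mul_left (-6⁻¹)
  have hd : ∀ a b c : C3, det3 a b c = (Matrix.of ![a, b, c]).det := fun a b c => by
    simp [det3, dot, cross_apply, Matrix.det_fin_three, Fin.sum_univ_three]
    ring
  have hv : -6⁻¹ * ∑ σ : Equiv.Perm (Fin 3), ∑ τ : Equiv.Perm (Fin 3),
      ((Equiv.Perm.sign σ : ℤ) : ℂ) * ((Equiv.Perm.sign τ : ℤ) : ℂ) *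
      ((∑' i, gradTerm e (xi v) (σ 0) (τ 0) i) * ((∑' i, gradTerm e (xi v) (σ 1) (τ 1) i) *
        ∑' i, gradTerm e (xi v) (σ 2) (τ 2) i)) =
      -(Matrix.of fun j l => ∑' i, gradTerm e (xi v) j l i).det := by
    set M := Matrix.of fun j l => ∑' i, gradTerm e (xi v) j l i
    -- Permuting the rows by `σ` multiplies the determinant by its sign, so every `σ` contributes
    -- the same amount.
    have h1 : ∀ σ : Equiv.Perm (Fin 3), ∑ τ : Equiv.Perm (Fin 3),
        ((Equiv.Perm.sign σ : ℤ) : ℂ) * ((Equiv.Perm.sign τ : ℤ) : ℂ) *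
        ((∑' i, gradTerm e (xi v) (σ 0) (τ 0) i) * ((∑' i, gradTerm e (xi v) (σ 1) (τ 1) i) *
          ∑' i, gradTerm e (xi v) (σ 2) (τ 2) i)) = M.det := fun σ => by
      have h2 := Matrix.det_permute σ M
      rw [← Matrix.det_transpose, Matrix.det_apply'] at h2
      have h3 : ((Equiv.Perm.sign σ : ℤ) : ℂ) * ((Equiv.Perm.sign σ : ℤ) : ℂ) = 1 := by
        rw [← Int.cast_mul, Int.units_coe_mul_self, Int.cast_one]
      rw [← one_mul M.det, ← h3, mul_assoc, ← h2, Finset.mul_sum]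
      refine Finset.sum_congr rfl fun τ _ => ?_
      simp only [Fin.prod_univ_three, Matrix.transpose_apply, Matrix.submatrix_apply, id, M,
        Matrix.of_apply]
      ring
    rw [Finset.sum_congr rfl fun σ _ => h1 σ]
    simp [Fintype.card_perm, Nat.factorial]
  rw [← hv]
  refine h.congr_fun fun x => ?_
  rw [cubDiv, hd, hd, ← Matrix.det_transpose, Matrix.det_apply', ← Matrix.det_transpose,
    Matrix.det_apply', Finset.sum_mul_sum, Finset.mul_sum, Finset.mul_sum, Finset.mul_sum,
    Finset.mul_sum]
  refine Finset.sum_congr rfl fun σ _ => ?_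
  rw [Finset.mul_sum, Finset.mul_sum, Finset.mul_sum, Finset.mul_sum]
  refine Finset.sum_congr rfl fun τ _ => ?_
  simp only [Fin.prod_univ_three, gradTerm, Matrix.transpose_apply, Matrix.of_apply,
    Matrix.cons_val_zero, Matrix.cons_val_one, Matrix.cons_val_two, Matrix.head_cons,
    Matrix.tail_cons, wave_apply]
  ring_nf
  simp only [Complex.I_pow_three]
  ring

include hadd

/-- The trace relation. -/
theorem trace_gradTerm (hv : ∀ p, dot (wave p) (v p) = 0) :
    (1 + Matrix.of fun j l => ∑' i, gradTerm e (xi v) j l i).det = 1 := by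
  -- The products are grouped by total mode. Since `e` is multiplicative, a fibre carries the common
  -- factor `e k`, and what remains is the divergence equation of the mode `k`.
  have h2 := (hasSum_quadDiv hS).tsum_fiberwise fun x => x.1 + x.2
  have h3 := (hasSum_cubDiv hS).tsum_fiberwise fun x => x.1 + (x.2.1 + x.2.2)
  have h1 := hasSum_sum (s := Finset.univ) fun (j : Fin 3) _ =>
    (summable_norm_gradTerm hS j j).of_norm.hasSum
  have h4 : ∀ k, ∑ j : Fin 3, gradTerm e (xi v) j j k =
      ∑' x : (fun x : Mode × Mode => x.1 + x.2) ⁻¹' {k}, e x.1.1 * e x.1.2 * quadDiv (xi v) x +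
      ∑' x : (fun x : Mode × Mode × Mode => x.1 + (x.2.1 + x.2.2)) ⁻¹' {k},
        e x.1.1 * (e x.1.2.1 * e x.1.2.2) * cubDiv (xi v) x := fun k => by
    have e1 : ∀ x : (fun x : Mode × Mode => x.1 + x.2) ⁻¹' {k}, e x.1.1 * e x.1.2 = e k :=
      fun x => by rw [← hadd]; exact congrArg e x.2
    have e2 : ∀ x : (fun x : Mode × Mode × Mode => x.1 + (x.2.1 + x.2.2)) ⁻¹' {k},
        e x.1.1 * (e x.1.2.1 * e x.1.2.2) = e k :=
      fun x => by rw [← hadd, ← hadd]; exact congrArg e x.2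
    simp only [e1, e2]
    rw [tsum_mul_left, tsum_mul_left, ← mul_add]
    have h5 := dot_wave_xi hv k
    rw [divSource] at h5
    refine Eq.trans ?_ (congrArg (e k * ·) h5)
    simp only [gradTerm, dot, wave_apply, Finset.mul_sum, mul_assoc]
  have h5 := h1.unique ((h2.add h3).congr_fun h4)
  -- The summed equation reads: trace = -(sum of principal minors) - determinant, which is the
  -- expansion of `det (1 + M) = 1`.
  rw [Matrix.det_fin_three] at h5 ⊢
  simp only [Fin.sum_univ_three, Matrix.of_apply, Matrix.add_apply, Matrix.one_apply] at h5 ⊢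
  simp at h5 ⊢
  linear_combination h5

/-- The time derivative of Cauchy's invariants: `∑ₗ ∇ẍₗ × ∇xₗ = 0`, multiplied by `t²`. The curl
equation of order `s = m + n` is multiplied by `s(s - 1)`, and the factor `(m - n)/(m + n)` fits
because `m(m - 1) - n(n - 1) = (m - n)(m + n - 1)`. -/
theorem closed_accTerm (he : ∀ i, e i ≠ 0)
    (hS2 : Summable fun i : Mode => (i.1 : ℝ) ^ 2 * (‖e i‖ * (waveLength i.2 * ‖xi v i‖)))
    (a : Fin 3) :
    ∑' i, accTerm e (xi v) (a + 1) (a + 2) i + ∑ l, (∑' i, accTerm e (xi v) (a + 1) l i) *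
      (∑' i, gradTerm e (xi v) (a + 2) l i) =
    ∑' i, accTerm e (xi v) (a + 2) (a + 1) i + ∑ l, (∑' i, accTerm e (xi v) (a + 2) l i) *
      (∑' i, gradTerm e (xi v) (a + 1) l i) := by
  have hN : ∀ j l, Summable fun i => ‖accTerm e (xi v) j l i‖ := fun j l =>
    hS2.of_nonneg_of_le (fun _ => norm_nonneg _) fun i => norm_accTerm_le _ _ _ _
  have hG := summable_norm_gradTerm hS
  have h1 := (hasSum_sum (s := Finset.univ) fun (l : Fin 3) _ =>
    ((hasSum_mul_of_summable_norm (hN (a + 1) l) (hG (a + 2) l)).sub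
      (hasSum_mul_of_summable_norm (hN (a + 2) l) (hG (a + 1) l))).sub
    ((hasSum_mul_of_summable_norm (hG (a + 1) l) (hN (a + 2) l)).sub
      (hasSum_mul_of_summable_norm (hG (a + 2) l) (hN (a + 1) l)))).mul_left (-2⁻¹)
  have h2 := h1.tsum_fiberwise fun x => x.1 + x.2
  have h3 := (hN (a + 1) (a + 2)).of_norm.hasSum.sub (hN (a + 2) (a + 1)).of_norm.hasSum
  have h4 : ∀ k, accTerm e (xi v) (a + 1) (a + 2) k - accTerm e (xi v) (a + 2) (a + 1) k =
      ∑' x : (fun x : Mode × Mode => x.1 + x.2) ⁻¹' {k}, -2⁻¹ * ∑ l,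
        ((accTerm e (xi v) (a + 1) l x.1.1 * gradTerm e (xi v) (a + 2) l x.1.2 -
          accTerm e (xi v) (a + 2) l x.1.1 * gradTerm e (xi v) (a + 1) l x.1.2) -
        (gradTerm e (xi v) (a + 1) l x.1.1 * accTerm e (xi v) (a + 2) l x.1.2 -
          gradTerm e (xi v) (a + 2) l x.1.1 * accTerm e (xi v) (a + 1) l x.1.2)) := fun k => by
    have e1 : ∀ x : (fun x : Mode × Mode => x.1 + x.2) ⁻¹' {k}, e x.1.1 * e x.1.2 = e k :=
      fun x => by rw [← hadd]; exact congrArg e x.2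
    have e2 : ∀ x : (fun x : Mode × Mode => x.1 + x.2) ⁻¹' {k}, -2⁻¹ * ∑ l,
        ((accTerm e (xi v) (a + 1) l x.1.1 * gradTerm e (xi v) (a + 2) l x.1.2 -
          accTerm e (xi v) (a + 2) l x.1.1 * gradTerm e (xi v) (a + 1) l x.1.2) -
        (gradTerm e (xi v) (a + 1) l x.1.1 * accTerm e (xi v) (a + 2) l x.1.2 -
          gradTerm e (xi v) (a + 2) l x.1.1 * accTerm e (xi v) (a + 1) l x.1.2)) =
        (e k * (k.1 * (k.1 - 1))) * quadCurl (xi v) x.1 a := fun x => by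
      have hx : ((k.1 : ℕ) : ℂ) = x.1.1.1 + x.1.2.1 := by
        rw [← Nat.cast_add]; exact congrArg Nat.cast (congrArg Prod.fst x.2).symm
      -- When both orders are zero the quotient is `0/0 = 0`, and the identity still holds.
      have h6 : ((x.1.1.1 : ℂ) + x.1.2.1) *
          (((x.1.1.1 : ℂ) - x.1.2.1) / (x.1.1.1 + x.1.2.1)) = x.1.1.1 - x.1.2.1 := by
        by_cases h0 : (x.1.1.1 : ℂ) + x.1.2.1 = 0
        · have : x.1.1.1 + x.1.2.1 = 0 := by exact_mod_cast h0
          have h7 : x.1.1.1 = 0 := by omega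
          have h8 : x.1.2.1 = 0 := by omega
          simp [h7, h8]
        · field_simp
      rw [← e1 x, hx]
      simp only [quadCurl, PiLp.smul_apply, smul_eq_mul]
      set D := dot (xi v x.1.1) (xi v x.1.2) with hD
      set c := cross (wave x.1.1.2) (wave x.1.2.2) a with hc
      have h7 : -2⁻¹ * ∑ l,
          ((accTerm e (xi v) (a + 1) l x.1.1 * gradTerm e (xi v) (a + 2) l x.1.2 -
            accTerm e (xi v) (a + 2) l x.1.1 * gradTerm e (xi v) (a + 1) l x.1.2) -
          (gradTerm e (xi v) (a + 1) l x.1.1 * accTerm e (xi v) (a + 2) l x.1.2 -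
            gradTerm e (xi v) (a + 2) l x.1.1 * accTerm e (xi v) (a + 1) l x.1.2)) =
          e x.1.1 * e x.1.2 * 2⁻¹ * ((x.1.1.1 : ℂ) - x.1.2.1) * (x.1.1.1 + x.1.2.1 - 1) *
            D * c := by
        simp only [hD, hc, cross_apply, wave_apply, dot, Fin.sum_univ_three, accTerm, gradTerm]
        ring_nf
        simp only [Complex.I_sq]
        ring
      rw [h7]
      linear_combination (-(e x.1.1 * e x.1.2 * 2⁻¹ * (x.1.1.1 + x.1.2.1 - 1) * D * c)) * h6
    rw [tsum_congr e2, tsum_mul_left]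
    -- The curl equation is not available at order one, but there the factor `s(s - 1)` vanishes.
    by_cases hk : k.1 = 1
    · simp [accTerm, hk]
    -- Summability lets the evaluation of a component pass through the sum. On a fibre the weight is
    -- the constant `e k`, which can be divided out because it is nonzero.
    have h7 : Summable fun x : PairFiber k => quadCurl (xi v) x := by
      have h8 := (hS.mul_of_nonneg hS (fun i => by have := waveLength_nonneg i.2; positivity)
        fun i => by have := waveLength_nonneg i.2; positivity).subtype
          ((fun x : Mode × Mode => x.1 + x.2) ⁻¹' {k})
      refine (h8.mul_left (‖e k‖⁻¹ * (√2)⁻¹)).of_norm_bounded fun x => ?_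
      refine ((Real.le_sqrt_of_sq_le (le_add_of_nonneg_left (sq_nonneg _))).trans
        (norm_pair_le (xi v) x.1)).trans (le_of_eq ?_)
      have h9 : ‖e k‖ ≠ 0 := norm_ne_zero_iff.2 (he k)
      have h10 : ‖e x.1.1‖ * ‖e x.1.2‖ = ‖e k‖ := by rw [← norm_mul]; exact congrArg _ (e1 x)
      simp only [Function.comp_apply]
      rw [← h10] at h9 ⊢
      have h11 := (mul_ne_zero_iff.1 h9).1
      have h12 := (mul_ne_zero_iff.1 h9).2
      field_simp
    have h8 := (EuclideanSpace.proj a : C3 →L[ℂ] ℂ).map_tsum h7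
    have h9 := congrArg (EuclideanSpace.proj a : C3 →L[ℂ] ℂ) (cross_wave_xi (v := v) hk)
    rw [curlSource, h8] at h9
    simp only [EuclideanSpace.coe_proj, PiLp.smul_apply, smul_eq_mul, cross_apply,
      wave_apply] at h9
    refine Eq.trans ?_ (congrArg ((e k * (k.1 * (k.1 - 1))) * ·) h9)
    simp only [accTerm, gradTerm]
    ring
  have h5 := h3.unique (h2.congr_fun h4)
  simp only [Fin.sum_univ_three] at h5 ⊢
  linear_combination h5

end Relations

end

section

/-! ### Fourier–Taylor series in complex space-time -/

section Series

variable {F : Type*} [NormedAddCommGroup F] [NormedSpace ℂ F]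

/-- The sum `∑ τˢ e^{i p·z} c_{(s,p)}`. -/
def series (c : Mode → F) (y : C3 × ℂ) : F := ∑' i, (y.2 ^ i.1 * character i.2 y.1) • c i

/-- Absolute convergence with spatial weight `e^{σ|p|}` and temporal weight `rˢ`. -/
def Converges (c : Mode → F) (σ r : ℝ) : Prop :=
  Summable fun i => Real.exp (σ * waveLength i.2) * r ^ i.1 * ‖c i‖

theorem continuous_imPart : Continuous imPart := by
  unfold imPart
  fun_prop

/-- The modulus is `e^{-p·Im z}`, and Cauchy–Schwarz bounds the exponent. -/
theorem norm_character_le (p : Fin 3 → ℤ) (z : C3) :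
    ‖character p z‖ ≤ Real.exp (‖imPart z‖ * waveLength p) := by
  rw [character, Complex.norm_exp, Real.exp_le_exp]
  have h1 : (Complex.I * ∑ j, (p j : ℂ) * z j).re = -∑ j, (p j : ℝ) * imPart z j := by
    simp [imPart]
  have h2 : -∑ j, (p j : ℝ) * imPart z j =
      inner ℝ (imPart z) (-(WithLp.toLp 2 fun j => (p j : ℝ) : E3)) := by
    simp [PiLp.inner_apply]
  rw [h1, h2]
  refine (real_inner_le_norm _ _).trans (le_of_eq ?_)
  rw [norm_neg, EuclideanSpace.norm_eq (WithLp.toLp 2 fun j => (p j : ℝ) : E3), waveLength]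
  simp

theorem norm_monomial_le {c : Mode → F} {σ r : ℝ} (i : Mode) {y : C3 × ℂ}
    (h1 : ‖imPart y.1‖ ≤ σ) (h2 : ‖y.2‖ ≤ r) :
    ‖(y.2 ^ i.1 * character i.2 y.1) • c i‖ ≤
      Real.exp (σ * waveLength i.2) * r ^ i.1 * ‖c i‖ := by
  rw [norm_smul, norm_mul, norm_pow, mul_comm (_ ^ _)]
  have h3 := (norm_character_le i.2 y.1).trans (Real.exp_le_exp.2
    (mul_le_mul_of_nonneg_right h1 (waveLength_nonneg _)))
  gcongr

/-- Multilinear map with diagonal values `(p·h)ᵐ wⁿ⁻ᵐ`. -/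
def monomialMap (n m : ℕ) (p : Fin 3 → ℤ) (ρ r : ℝ) (c : F) :
    ContinuousMultilinearMap ℂ (fun _ : Fin n => C3 × ℂ) F :=
  ((ContinuousMultilinearMap.mkPiAlgebraFin ℂ n ℂ).compContinuousLinearMap fun j =>
    if (j : ℕ) < m then (ρ : ℂ) • (dotWave p).comp (ContinuousLinearMap.fst ℂ C3 ℂ)
    else (r : ℂ) • ContinuousLinearMap.snd ℂ C3 ℂ).smulRight c

theorem prod_ite_lt {M : Type*} [CommMonoid M] (m s : ℕ) (A B : M) :
    ∏ j : Fin (m + s), (if (j : ℕ) < m then A else B) = A ^ m * B ^ s := by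
  rw [Fin.prod_univ_add]
  simp

theorem monomialMap_diag (m s : ℕ) (p : Fin 3 → ℤ) (ρ r : ℝ) (c : F) (y : C3 × ℂ) :
    monomialMap (m + s) m p ρ r c (fun _ => y) =
      ((ρ * dot (wave p) y.1) ^ m * (r * y.2) ^ s) • c := by
  rw [monomialMap, ContinuousMultilinearMap.smulRight_apply,
    ContinuousMultilinearMap.compContinuousLinearMap_apply,
    ContinuousMultilinearMap.mkPiAlgebraFin_apply, List.prod_ofFn, ← prod_ite_lt]
  congr 2
  funext j
  split_ifs
  · simp [dotWave_apply]
  · simp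

theorem norm_dotWave_le (p : Fin 3 → ℤ) (u : C3) : ‖dotWave p u‖ ≤ waveLength p * ‖u‖ := by
  rw [dotWave_apply, ← norm_wave]
  exact norm_dot_le _ _

theorem norm_monomialMap_le (m s : ℕ) (p : Fin 3 → ℤ) {ρ r : ℝ} (hρ : 0 ≤ ρ) (hr : 0 ≤ r) (c : F) :
    ‖monomialMap (m + s) m p ρ r c‖ ≤ (ρ * waveLength p) ^ m * r ^ s * ‖c‖ := by
  have hw := waveLength_nonneg p
  refine ContinuousMultilinearMap.opNorm_le_bound (by positivity) fun y => ?_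
  rw [monomialMap, ContinuousMultilinearMap.smulRight_apply,
    ContinuousMultilinearMap.compContinuousLinearMap_apply,
    ContinuousMultilinearMap.mkPiAlgebraFin_apply, List.prod_ofFn, norm_smul, norm_prod,
    ← prod_ite_lt, mul_right_comm, ← Finset.prod_mul_distrib]
  gcongr with j
  split_ifs
  · rw [_root_.smul_apply, norm_smul, Complex.norm_real, Real.norm_of_nonneg hρ,
      mul_assoc]
    gcongr
    exact (norm_dotWave_le _ _).trans (mul_le_mul_of_nonneg_left (norm_fst_le _) hw)
  · rw [_root_.smul_apply, norm_smul, Complex.norm_real, Real.norm_of_nonneg hr]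
    gcongr
    exact norm_snd_le _

/-- The contribution of the mode `i` to the Taylor coefficient of order `n` at `(z, 0)`. -/
def taylorTerm (c : Mode → F) (z : C3) (ρ r : ℝ) (n : ℕ) (i : Mode) :
    ContinuousMultilinearMap ℂ (fun _ : Fin n => C3 × ℂ) F :=
  if i.1 ≤ n then monomialMap n (n - i.1) i.2 ρ r
    ((character i.2 z * (Complex.I ^ (n - i.1) / (n - i.1)!)) • c i) else 0

theorem tsum_shift {α : Type*} [AddCommMonoid α] [TopologicalSpace α] {f : ℕ → α} {s : ℕ}
    {a : α} (h0 : ∀ n < s, f n = 0) (h : HasSum (fun m => f (m + s)) a) : HasSum f a := by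
  refine ((add_left_injective s).hasSum_iff fun n hn => h0 n ?_).1 h
  by_contra! h1
  exact hn ⟨n - s, by simp; omega⟩

theorem norm_taylorTerm_le (c : Mode → F) (z : C3) {ρ r : ℝ} (hρ : 0 ≤ ρ) (hr : 0 ≤ r)
    (m : ℕ) (i : Mode) :
    ‖taylorTerm c z ρ r (m + i.1) i‖ ≤ (ρ * waveLength i.2) ^ m / m ! *
      (Real.exp (‖imPart z‖ * waveLength i.2) * r ^ i.1 * ‖c i‖) := by
  have hw := waveLength_nonneg i.2
  rw [taylorTerm, if_pos (Nat.le_add_left _ _), Nat.add_sub_cancel]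
  refine (norm_monomialMap_le m i.1 i.2 hρ hr _).trans ?_
  rw [norm_smul, norm_mul, norm_div, norm_pow, Complex.norm_I, one_pow, Complex.norm_natCast]
  calc (ρ * waveLength i.2) ^ m * r ^ i.1 * (‖character i.2 z‖ * (1 / (m ! : ℝ)) * ‖c i‖)
      ≤ (ρ * waveLength i.2) ^ m * r ^ i.1 *
        (Real.exp (‖imPart z‖ * waveLength i.2) * (1 / (m ! : ℝ)) * ‖c i‖) := by
        gcongr
        exact norm_character_le _ _
    _ = _ := by ring

/-- The majorant of the norms of the Taylor terms. -/
theorem exists_majorant (c : Mode → F) (z : C3) {ρ r : ℝ} (hρ : 0 ≤ ρ) (hr : 0 ≤ r)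
    (hc : Converges c (‖imPart z‖ + ρ) r) :
    Summable fun x : Mode × ℕ => ‖taylorTerm c z ρ r x.2 x.1‖ := by
  rw [summable_prod_of_nonneg fun _ => norm_nonneg _]
  have h1 : ∀ i : Mode, HasSum (fun m : ℕ => (ρ * waveLength i.2) ^ m / m ! *
      (Real.exp (‖imPart z‖ * waveLength i.2) * r ^ i.1 * ‖c i‖))
      (Real.exp ((‖imPart z‖ + ρ) * waveLength i.2) * r ^ i.1 * ‖c i‖) := fun i => by
    have h2 := NormedSpace.expSeries_div_hasSum_exp (𝔸 := ℝ) (ρ * waveLength i.2)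
    rw [← Real.exp_eq_exp_ℝ] at h2
    have h3 := h2.mul_right (Real.exp (‖imPart z‖ * waveLength i.2) * r ^ i.1 * ‖c i‖)
    have h4 : Real.exp (ρ * waveLength i.2) *
        (Real.exp (‖imPart z‖ * waveLength i.2) * r ^ i.1 * ‖c i‖) =
        Real.exp ((‖imPart z‖ + ρ) * waveLength i.2) * r ^ i.1 * ‖c i‖ := by
      rw [add_mul, Real.exp_add]
      ring
    exact h4 ▸ h3
  have h0 : ∀ i : Mode, ∀ n < i.1, ‖taylorTerm c z ρ r n i‖ = 0 := fun i n hn => by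
    rw [taylorTerm, if_neg (by omega), norm_zero]
  have h3 : ∀ i : Mode, Summable fun m => ‖taylorTerm c z ρ r (m + i.1) i‖ := fun i =>
    (h1 i).summable.of_nonneg_of_le (fun _ => norm_nonneg _) fun m => norm_taylorTerm_le c z hρ hr m i
  have h4 : ∀ i : Mode, HasSum (fun n => ‖taylorTerm c z ρ r n i‖)
      (∑' m, ‖taylorTerm c z ρ r (m + i.1) i‖) := fun i => tsum_shift (h0 i) (h3 i).hasSum
  refine ⟨fun i => (h4 i).summable, ?_⟩
  refine hc.of_nonneg_of_le (fun i => tsum_nonneg fun _ => norm_nonneg _) fun i => ?_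
  rw [(h4 i).tsum_eq, ← (h1 i).tsum_eq]
  exact (h3 i).tsum_le_tsum (fun m => norm_taylorTerm_le c z hρ hr m i) (h1 i).summable

variable [CompleteSpace F]

/-- Each exponential is expanded around `z`, and the sums over modes and over degrees are
interchanged. The double series is dominated because `∑ₘ (ρ|p|)ᵐ/m! = e^{ρ|p|}`, which the spatial
weight `|Im z| + ρ` absorbs. The scaling of the variables by `ρ` and `r` normalises the radius to
one. -/
theorem hasFPowerSeriesOnBall_series {c : Mode → F} {z : C3} {ρ r : ℝ} (hρ : 0 ≤ ρ) (hr : 0 ≤ r)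
    (hc : Converges c (‖imPart z‖ + ρ) r) :
    HasFPowerSeriesOnBall (fun y : C3 × ℂ => series c (z + (ρ : ℂ) • y.1, (r : ℂ) * y.2))
      (fun n => ∑' i, taylorTerm c z ρ r n i) 0 1 := by
  have hM := exists_majorant c z hρ hr hc
  have hM' := (Equiv.prodComm ℕ Mode).summable_iff.2 hM
  have hn : ∀ n, Summable fun i => ‖taylorTerm c z ρ r n i‖ := fun n => hM'.prod_factor n
  refine ⟨?_, one_pos, fun {y} hy => ?_⟩
  · have h2 : Summable fun n => ∑' i, ‖taylorTerm c z ρ r n i‖ := hM'.prod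
    have := FormalMultilinearSeries.le_radius_of_summable_norm
      (fun n => ∑' i, taylorTerm c z ρ r n i) (r := 1) (by
        refine h2.of_nonneg_of_le (fun _ => by positivity) fun n => ?_
        simp only [NNReal.coe_one, one_pow, mul_one]
        exact norm_tsum_le_tsum_norm (hn n))
    simpa using this
  · have hy1 : ‖y‖ ≤ 1 := by
      have : ‖y‖ₑ < 1 := by simpa [Metric.mem_eball, edist_zero_right] using hy
      rw [← ofReal_norm, ENNReal.ofReal_lt_one] at this
      exact this.le
    have hb : ∀ n i, ‖taylorTerm c z ρ r n i (fun _ => y)‖ ≤ ‖taylorTerm c z ρ r n i‖ := fun n i => by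
      refine (ContinuousMultilinearMap.le_opNorm _ _).trans ?_
      rw [Finset.prod_const]
      exact mul_le_of_le_one_right (norm_nonneg _) (pow_le_one₀ (norm_nonneg _) hy1)
    have hs : Summable fun x : Mode × ℕ => taylorTerm c z ρ r x.2 x.1 (fun _ => y) :=
      hM.of_norm_bounded fun x => hb _ _
    have h3 : ∀ i, HasSum (fun n => taylorTerm c z ρ r n i (fun _ => y))
        (((r * y.2) ^ i.1 * character i.2 (z + (ρ : ℂ) • y.1)) • c i) := fun i => by
      refine tsum_shift (s := i.1) (fun n hn => by
        rw [taylorTerm, if_neg (by omega)]; rfl) ?_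
      have h4 := NormedSpace.expSeries_div_hasSum_exp (𝔸 := ℂ)
        (Complex.I * (ρ * dot (wave i.2) y.1))
      rw [← Complex.exp_eq_exp_ℂ] at h4
      have h5 : character i.2 (z + (ρ : ℂ) • y.1) =
          character i.2 z * Complex.exp (Complex.I * (ρ * dot (wave i.2) y.1)) := by
        simp only [character, ← Complex.exp_add, ← mul_add, dot, wave_apply, PiLp.add_apply,
          PiLp.smul_apply, smul_eq_mul, Finset.mul_sum, ← Finset.sum_add_distrib]
        congr 2
        funext j
        ring
      rw [h5]
      have h6 := (h4.mul_left ((r * y.2) ^ i.1 * character i.2 z)).smul_const (c i)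
      rw [← mul_assoc]
      refine h6.congr_fun fun m => ?_
      rw [taylorTerm, if_pos (Nat.le_add_left _ _), Nat.add_sub_cancel, monomialMap_diag, smul_smul,
        mul_pow Complex.I]
      congr 1
      ring
    have h4 := (hs.hasSum.prod_fiberwise h3)
    have h5 : series c (z + (ρ : ℂ) • y.1, (r : ℂ) * y.2) =
        ∑' x : Mode × ℕ, taylorTerm c z ρ r x.2 x.1 (fun _ => y) := h4.tsum_eq
    have h6 : ∀ n, HasSum (fun i => taylorTerm c z ρ r n i (fun _ => y))
        ((∑' i, taylorTerm c z ρ r n i) (fun _ => y)) := fun n =>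
      ContinuousMultilinearMap.hasSum_eval ((hn n).of_norm.hasSum) _
    have h7 := ((Equiv.prodComm ℕ Mode).hasSum_iff.2 hs.hasSum).prod_fiberwise h6
    rw [zero_add]
    simp only [h5]
    exact h7

/-- The expansion is centred at `(z, 0)` with `ρ = σ - |Im z|`. In the scaled variables the given
point becomes `(0, τ/r)`, which lies in the unit ball of the maximum norm. -/
theorem analyticAt_series {c : Mode → F} {σ r : ℝ} (hc : Converges c σ r) {y : C3 × ℂ}
    (h1 : ‖imPart y.1‖ < σ) (h2 : ‖y.2‖ < r) : AnalyticAt ℂ (series c) y := by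
  obtain ⟨z, τ⟩ := y
  have hr : 0 < r := (norm_nonneg _).trans_lt h2
  have hr' : (r : ℂ) ≠ 0 := by exact_mod_cast hr.ne'
  have hρ : 0 < σ - ‖imPart z‖ := sub_pos.2 h1
  have hρ' : ((σ - ‖imPart z‖ : ℝ) : ℂ) ≠ 0 := by exact_mod_cast hρ.ne'
  have h := hasFPowerSeriesOnBall_series (c := c) (z := z) hρ.le hr.le (by simpa using hc)
  have h3 : AnalyticAt ℂ (fun y : C3 × ℂ => series c
      (z + ((σ - ‖imPart z‖ : ℝ) : ℂ) • y.1, (r : ℂ) * y.2)) (0, τ / r) := by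
    refine h.analyticOnNhd _ ?_
    rw [Metric.mem_eball, edist_zero_right, ← ofReal_norm, ENNReal.ofReal_lt_one,
      Prod.norm_def, norm_zero, norm_div, Complex.norm_real, Real.norm_of_nonneg hr.le]
    exact max_lt one_pos ((div_lt_one hr).2 h2)
  have h4 : AnalyticAt ℂ (fun y : C3 × ℂ =>
      ((((σ - ‖imPart z‖ : ℝ) : ℂ)⁻¹) • (y.1 - z), y.2 / r)) (z, τ) :=
    AnalyticAt.prod
      ((analyticAt_const (v := (((σ - ‖imPart z‖ : ℝ) : ℂ)⁻¹))).smul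
        (analyticAt_fst.sub (analyticAt_const (v := z))))
      (analyticAt_snd.div (analyticAt_const (v := (r : ℂ))) hr')
  have h5 := h3.comp_of_eq h4 (by simp)
  refine h5.congr (Filter.Eventually.of_forall fun y => ?_)
  simp only [Function.comp_apply, smul_smul, mul_inv_cancel₀ hρ', one_smul, add_sub_cancel,
    mul_div_cancel₀ _ hr']

end Series

end

section

/-! ### Differentiation of Fourier–Taylor series -/

section Deriv

variable {F : Type*} [NormedAddCommGroup F] [NormedSpace ℂ F]

/-- The coefficients of the spatial derivative `∂ⱼ`. -/
def dSpace (j : Fin 3) (c : Mode → F) (i : Mode) : F := (Complex.I * i.2 j) • c i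

/-- The coefficients of the time derivative. -/
def dTime (c : Mode → F) (i : Mode) : F := ((i.1 : ℂ) + 1) • c (i.1 + 1, i.2)

theorem norm_dSpace_le (j : Fin 3) (c : Mode → F) (i : Mode) :
    ‖dSpace j c i‖ ≤ waveLength i.2 * ‖c i‖ := by
  rw [dSpace, norm_smul, norm_mul, Complex.norm_I, one_mul, Complex.norm_intCast]
  gcongr
  exact abs_le_waveLength _ _

theorem norm_dTime (c : Mode → F) (i : Mode) :
    ‖dTime c i‖ = ((i.1 : ℝ) + 1) * ‖c (i.1 + 1, i.2)‖ := by
  rw [dTime, norm_smul]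
  norm_cast

omit [NormedSpace ℂ F] in
theorem Converges.mono {c : Mode → F} {σ σ' r r' : ℝ} (h : Converges c σ r) (hσ : σ' ≤ σ)
    (h0 : 0 ≤ r') (hr : r' ≤ r) : Converges c σ' r' := by
  refine h.of_nonneg_of_le (fun i => by positivity) fun i => ?_
  have := waveLength_nonneg i.2
  gcongr

/-- A little of the strip is given up: the factor `|p|` is absorbed by `e^{(σ - σ')|p|}`. -/
theorem Converges.dSpace {c : Mode → F} {σ σ' r : ℝ} (h : Converges c σ r) (hr : 0 ≤ r)
    (hσ : σ' < σ) (j : Fin 3) : Converges (dSpace j c) σ' r := by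
  have hd := sub_pos.2 hσ
  refine (h.mul_left (σ - σ')⁻¹).of_nonneg_of_le (fun i => by positivity) fun i => ?_
  have hw := waveLength_nonneg i.2
  have h1 : waveLength i.2 * Real.exp (σ' * waveLength i.2) ≤
      (σ - σ')⁻¹ * Real.exp (σ * waveLength i.2) := by
    have h2 : (σ - σ') * waveLength i.2 ≤ Real.exp ((σ - σ') * waveLength i.2) :=
      (le_add_of_nonneg_right zero_le_one).trans (Real.add_one_le_exp _)
    have h3 : Real.exp (σ * waveLength i.2) =
        Real.exp ((σ - σ') * waveLength i.2) * Real.exp (σ' * waveLength i.2) := by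
      rw [← Real.exp_add]; ring_nf
    rw [h3, ← mul_assoc]
    gcongr
    rw [← div_eq_inv_mul, le_div_iff₀ hd, mul_comm]
    exact h2
  calc Real.exp (σ' * waveLength i.2) * r ^ i.1 * ‖PeriodicEuler.dSpace j c i‖
      ≤ Real.exp (σ' * waveLength i.2) * r ^ i.1 * (waveLength i.2 * ‖c i‖) := by
        gcongr
        exact norm_dSpace_le _ _ _
    _ = (waveLength i.2 * Real.exp (σ' * waveLength i.2)) * (r ^ i.1 * ‖c i‖) := by ring
    _ ≤ ((σ - σ')⁻¹ * Real.exp (σ * waveLength i.2)) * (r ^ i.1 * ‖c i‖) := by gcongr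
    _ = _ := by ring

theorem succ_mode_injective : Function.Injective fun i : Mode => ((i.1 + 1, i.2) : Mode) := by
  rintro ⟨s, p⟩ ⟨s', p'⟩ h
  simpa using h

/-- A little of the time radius is given up: Bernoulli's inequality bounds `s + 1` by a multiple of
`(r/r')^{s+1}`. -/
theorem Converges.dTime {c : Mode → F} {σ r r' : ℝ} (h : Converges c σ r) (hr' : 0 < r')
    (hr : r' < r) : Converges (dTime c) σ r' := by
  have hd : 0 < r / r' - 1 := sub_pos.2 ((one_lt_div hr').2 hr)
  have h1 := (h.comp_injective succ_mode_injective).mul_left ((r / r' - 1)⁻¹ * r'⁻¹)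
  refine h1.of_nonneg_of_le (fun i => by positivity) fun i => ?_
  have h2 : ((i.1 : ℝ) + 1) * r' ^ i.1 ≤ (r / r' - 1)⁻¹ * r'⁻¹ * r ^ (i.1 + 1) := by
    have h3 := one_add_mul_le_pow (a := r / r' - 1) (by linarith) (i.1 + 1)
    rw [add_sub_cancel, div_pow, le_div_iff₀ (by positivity)] at h3
    push_cast at h3
    rw [← mul_inv, ← div_eq_inv_mul, le_div_iff₀ (by positivity)]
    calc ((i.1 : ℝ) + 1) * r' ^ i.1 * ((r / r' - 1) * r') =
        (((i.1 : ℝ) + 1) * (r / r' - 1)) * r' ^ (i.1 + 1) := by ring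
      _ ≤ (1 + ((i.1 : ℝ) + 1) * (r / r' - 1)) * r' ^ (i.1 + 1) := by
          gcongr; linarith
      _ ≤ _ := h3
  rw [norm_dTime]
  simp only [Function.comp_apply]
  calc Real.exp (σ * waveLength i.2) * r' ^ i.1 * (((i.1 : ℝ) + 1) * ‖c (i.1 + 1, i.2)‖)
      = (((i.1 : ℝ) + 1) * r' ^ i.1) * (Real.exp (σ * waveLength i.2) * ‖c (i.1 + 1, i.2)‖) := by
        ring
    _ ≤ ((r / r' - 1)⁻¹ * r'⁻¹ * r ^ (i.1 + 1)) *
        (Real.exp (σ * waveLength i.2) * ‖c (i.1 + 1, i.2)‖) := by gcongr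
    _ = _ := by ring

omit [NormedSpace ℂ F] in
theorem hasSum_mode_succ {f : Mode → F} (h0 : ∀ p, f (0, p) = 0) {a : F}
    (h : HasSum f a) : HasSum (fun i : Mode => f (i.1 + 1, i.2)) a := by
  refine (succ_mode_injective.hasSum_iff fun i hi => ?_).2 h
  obtain ⟨s, p⟩ := i
  rcases s with _ | s
  · exact h0 p
  · exact absurd ⟨(s, p), rfl⟩ hi

theorem character_apply_add (p : Fin 3 → ℤ) (z w : C3) :
    character p (z + w) = character p z * Complex.exp (Complex.I * dot (wave p) w) := by
  simp only [character, dot, wave_apply, ← Complex.exp_add, ← mul_add, PiLp.add_apply,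
    ← Finset.sum_add_distrib]

variable [CompleteSpace F]

/-- Holomorphic terms with a uniform summable majorant may be differentiated one by one; the term of
order zero drops out, and `dTime` is the resulting shift of the order. -/
theorem hasDerivAt_series_time {c : Mode → F} {σ r : ℝ} (hc : Converges c σ r) {y : C3 × ℂ}
    (h1 : ‖imPart y.1‖ < σ) (h2 : ‖y.2‖ < r) :
    HasDerivAt (fun τ => series c (y.1, τ)) (series (dTime c) y) y.2 := by
  have hd : DifferentiableAt ℂ (fun τ => series c (y.1, τ)) y.2 :=
    (analyticAt_series hc (y := (y.1, y.2)) h1 h2).differentiableAt.comp y.2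
      ((differentiableAt_const y.1).prodMk differentiableAt_id)
  have hs := Complex.hasSum_deriv_of_summable_norm (U := Metric.ball 0 r)
    (F := fun (i : Mode) τ => (τ ^ i.1 * character i.2 y.1) • c i) hc
    (fun i => by fun_prop) Metric.isOpen_ball
    (fun i τ hτ => norm_monomial_le i (y := (y.1, τ)) h1.le (by simpa using (mem_ball_zero_iff.1 hτ).le))
    (z := y.2) (by simpa using h2)
  have hs' : HasSum (fun i : Mode => (i.1 * y.2 ^ (i.1 - 1) * character i.2 y.1) • c i)
      (deriv (fun τ => series c (y.1, τ)) y.2) := by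
    refine hs.congr_fun fun i => ?_
    exact (((hasDerivAt_pow i.1 y.2).mul_const _).smul_const (c i)).deriv.symm
  have h3 := hasSum_mode_succ (fun p => by simp) hs'
  have h4 : series (dTime c) y = deriv (fun τ => series c (y.1, τ)) y.2 := by
    rw [← h3.tsum_eq, series]
    refine tsum_congr fun i => ?_
    rw [dTime, smul_smul]
    simp
    congr 1
    ring
  rw [h4]
  exact hd.hasDerivAt

theorem hasDerivAt_series_line {c : Mode → F} {σ r : ℝ} (hc : Converges c σ r) {y : C3 × ℂ}
    (h1 : ‖imPart y.1‖ < σ) (h2 : ‖y.2‖ < r) {u : C3} {g : ℂ → C3} (hg : ∀ w, g w = y.1 + w • u) :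
    HasDerivAt (fun w : ℂ => series c (g w, y.2))
      (∑' i, (y.2 ^ i.1 * (character i.2 y.1 * (Complex.I * dot (wave i.2) u))) • c i) 0 := by
  have hg0 : g 0 = y.1 := by simp [hg]
  have hgd : Differentiable ℂ g := by
    rw [funext hg]
    fun_prop
  have hd : DifferentiableAt ℂ (fun w : ℂ => series c (g w, y.2)) 0 := by
    refine DifferentiableAt.comp (g := series c) (0 : ℂ) (analyticAt_series hc
      (y := (g 0, y.2)) ?_ h2).differentiableAt ((hgd 0).prodMk (differentiableAt_const _))
    rwa [hg0]
  have hchar : ∀ (i : Mode) (w : ℂ), HasDerivAt (fun w => character i.2 (g w))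
      (character i.2 y.1 * (Complex.exp (Complex.I * (w * dot (wave i.2) u)) *
        (Complex.I * dot (wave i.2) u))) w := fun i w => by
    have h6 : ∀ w : ℂ, dot (wave i.2) (w • u) = w * dot (wave i.2) u := by
      intro w
      rw [← dotWave_apply, map_smul, dotWave_apply, smul_eq_mul]
    simp only [hg, character_apply_add, h6]
    have h7 := (((hasDerivAt_id w).mul_const (dot (wave i.2) u)).const_mul
      Complex.I).cexp.const_mul (character i.2 y.1)
    simpa using h7
  have hs := Complex.hasSum_deriv_of_summable_norm (U := {w : ℂ | ‖imPart (g w)‖ < σ})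
    (F := fun (i : Mode) (w : ℂ) => (y.2 ^ i.1 * character i.2 (g w)) • c i) hc
    (fun i w _ => (((hchar i w).const_mul _).smul_const _).differentiableAt.differentiableWithinAt)
    (isOpen_lt (continuous_imPart.comp hgd.continuous).norm continuous_const)
    (fun i w hw => norm_monomial_le i (y := (g w, y.2)) (le_of_lt hw) h2.le)
    (z := 0) (show ‖imPart (g 0)‖ < σ by rwa [hg0])
  have h4 : ∑' i, (y.2 ^ i.1 * (character i.2 y.1 * (Complex.I * dot (wave i.2) u))) • c i =
      deriv (fun w : ℂ => series c (g w, y.2)) 0 := by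
    refine Eq.trans (tsum_congr fun i => ?_) hs.tsum_eq
    rw [(((hchar i 0).const_mul (y.2 ^ i.1)).smul_const (c i)).deriv]
    simp
  rw [h4]
  exact hd.hasDerivAt

theorem hasDerivAt_series_space {c : Mode → F} {σ r : ℝ} (hc : Converges c σ r) {y : C3 × ℂ}
    (h1 : ‖imPart y.1‖ < σ) (h2 : ‖y.2‖ < r) (j : Fin 3) :
    HasDerivAt (fun w : ℂ => series c (y.1 + w • EuclideanSpace.single j 1, y.2))
      (series (dSpace j c) y) 0 := by
  have h := hasDerivAt_series_line hc h1 h2 (u := EuclideanSpace.single j 1) fun w => rfl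
  have h3 : series (dSpace j c) y = ∑' i, (y.2 ^ i.1 * (character i.2 y.1 *
      (Complex.I * dot (wave i.2) (EuclideanSpace.single j 1)))) • c i := by
    refine tsum_congr fun i => ?_
    rw [dSpace, smul_smul, mul_assoc]
    simp [dot, wave_apply]
  rwa [h3]

end Deriv

end

section

/-! ### Real fields given by Fourier–Taylor series -/

/-- The componentwise real part. -/
def reC3 : C3 →L[ℝ] E3 := LinearMap.toContinuousLinearMap
  { toFun := fun z => WithLp.toLp 2 fun j => (z j).re
    map_add' := fun x y => by ext j; simp
    map_smul' := fun x y => by ext j; simp }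

/-- The inclusion of real space in complex space. -/
def toC3L : E3 →L[ℝ] C3 := LinearMap.toContinuousLinearMap
  { toFun := toC3
    map_add' := fun x y => by ext j; simp [toC3]
    map_smul' := fun x y => by ext j; simp [toC3] }

theorem toC3L_apply (a : E3) : toC3L a = toC3 a := rfl

theorem toC3_apply (a : E3) (j : Fin 3) : toC3 a j = a j := rfl

theorem imPart_toC3 (a : E3) : imPart (toC3 a) = 0 := by ext j; simp [imPart, toC3]

theorem toC3_reC3 {z : C3} (h : conjC3 z = z) : toC3 (reC3 z) = z := by
  ext j
  have h1 := congrArg (fun u : C3 => u j) h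
  simp only [conjC3_apply] at h1
  exact Complex.conj_eq_iff_re.1 h1

/-- The symmetric time interval `|t| < R`. -/
def timeDisc (R : ℝ≥0∞) : Set ℝ := {t | ‖t‖ₑ < R}

theorem isOpen_timeDisc (R : ℝ≥0∞) : IsOpen (timeDisc R) :=
  isOpen_lt continuous_enorm continuous_const

/-- Convergence for all times less than `R`, with some spatial weight. -/
def Admissible (c : Mode → C3) (R : ℝ≥0∞) : Prop :=
  ∀ r : ℝ, 0 < r → ENNReal.ofReal r < R → ∃ σ, 0 < σ ∧ Converges c σ r

theorem exists_real_btwn {r : ℝ} (hr : 0 ≤ r) {R : ℝ≥0∞} (h : ENNReal.ofReal r < R) :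
    ∃ r', r < r' ∧ ENNReal.ofReal r' < R := by
  obtain ⟨q, h1, h2⟩ := ENNReal.lt_iff_exists_nnreal_btwn.1 h
  refine ⟨q, ?_, by simpa using h2⟩
  rw [ENNReal.ofReal_lt_coe_iff hr] at h1
  exact h1

variable {c : Mode → C3} {R : ℝ≥0∞}

theorem Admissible.dSpace (hc : Admissible c R) (j : Fin 3) : Admissible (dSpace j c) R := by
  intro r hr hR
  obtain ⟨σ, hσ, h⟩ := hc r hr hR
  exact ⟨σ / 2, half_pos hσ, h.dSpace hr.le (half_lt_self hσ) j⟩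

theorem Admissible.dTime (hc : Admissible c R) : Admissible (dTime c) R := by
  intro r hr hR
  obtain ⟨r', h1, h2⟩ := exists_real_btwn hr.le hR
  obtain ⟨σ, hσ, h⟩ := hc r' (hr.trans h1) h2
  exact ⟨σ, hσ, h.dTime hr h1⟩

theorem Admissible.converges (hc : Admissible c R) {τ : ℂ} (h : ‖τ‖ₑ < R) :
    ∃ σ r, 0 < σ ∧ ‖τ‖ < r ∧ Converges c σ r := by
  rw [← ofReal_norm] at h
  obtain ⟨r, h1, h2⟩ := exists_real_btwn (norm_nonneg _) h
  obtain ⟨σ, hσ, h3⟩ := hc r ((norm_nonneg _).trans_lt h1) h2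
  exact ⟨σ, r, hσ, h1, h3⟩

theorem Admissible.analyticAt (hc : Admissible c R) (a : E3) {τ : ℂ} (h : ‖τ‖ₑ < R) :
    AnalyticAt ℂ (series c) (toC3 a, τ) := by
  obtain ⟨σ, r, hσ, h1, h2⟩ := hc.converges h
  exact analyticAt_series h2 (by simpa [imPart_toC3] using hσ) h1

/-- The real field with Fourier–Taylor coefficients `c`. -/
def realField (c : Mode → C3) (y : ℝ × E3) : E3 := reC3 (series c (toC3 y.2, (y.1 : ℂ)))

theorem enorm_ofReal_lt {t : ℝ} (ht : t ∈ timeDisc R) : ‖(t : ℂ)‖ₑ < R := by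
  rwa [← ofReal_norm, Complex.norm_real, ofReal_norm]

theorem Admissible.contDiffAt (hc : Admissible c R) {y : ℝ × E3} (hy : y.1 ∈ timeDisc R) {n : ℕ∞} :
    ContDiffAt ℝ n (realField c) y := by
  have h1 : ContDiffAt ℝ n (series c) (toC3L y.2, Complex.ofRealCLM y.1) :=
    (hc.analyticAt y.2 (enorm_ofReal_lt hy)).contDiffAt.restrict_scalars ℝ
  exact reC3.contDiff.contDiffAt.comp y (h1.comp y
    ((toC3L.contDiff.comp contDiff_snd).prodMk (Complex.ofRealCLM.contDiff.comp contDiff_fst)).contDiffAt)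

theorem hasDerivAt_comp_ofReal {F : Type*} [NormedAddCommGroup F] [NormedSpace ℂ F] {e : ℂ → F}
    {e' : F} {t : ℝ} (h : HasDerivAt e e' (t : ℂ)) : HasDerivAt (fun s : ℝ => e s) e' t := by
  simpa [Function.comp_def] using
    (h.hasFDerivAt.restrictScalars ℝ).comp_hasDerivAt t Complex.ofRealCLM.hasDerivAt

theorem Admissible.hasDerivAt_time (hc : Admissible c R) {t : ℝ} (ht : t ∈ timeDisc R) (a : E3) :
    HasDerivAt (fun t => realField c (t, a)) (realField (PeriodicEuler.dTime c) (t, a)) t := by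
  obtain ⟨σ, r, hσ, h1, h2⟩ := hc.converges (enorm_ofReal_lt ht)
  have h3 := hasDerivAt_series_time h2 (y := (toC3 a, (t : ℂ))) (by simpa [imPart_toC3] using hσ) h1
  exact reC3.hasFDerivAt.comp_hasDerivAt t
    (hasDerivAt_comp_ofReal (e := fun τ => series c (toC3 a, τ)) h3)

theorem Admissible.partialD_realField (hc : Admissible c R) {t : ℝ} (ht : t ∈ timeDisc R) (a : E3)
    (j : Fin 3) :
    partialD j (fun a => realField c (t, a)) a = realField (PeriodicEuler.dSpace j c) (t, a) := by
  obtain ⟨σ, r, hσ, h1, h2⟩ := hc.converges (enorm_ofReal_lt ht)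
  have h3 := hasDerivAt_series_space h2 (y := (toC3 a, (t : ℂ)))
    (by simpa [imPart_toC3] using hσ) h1 j
  have h4 : HasDerivAt (fun s : ℝ => realField c (t, a + s • EuclideanSpace.single j 1))
      (realField (PeriodicEuler.dSpace j c) (t, a)) 0 := by
    have h5 := reC3.hasFDerivAt.comp_hasDerivAt (0 : ℝ)
      (hasDerivAt_comp_ofReal (t := 0)
        (e := fun w : ℂ => series c (toC3 a + w • EuclideanSpace.single j 1, (t : ℂ)))
        (by simpa using h3))
    refine h5.congr_deriv rfl |>.congr_of_eventuallyEq (Filter.Eventually.of_forall fun s => ?_)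
    simp only [realField, Function.comp_apply]
    congr 4
    ext l
    by_cases hl : l = j <;> simp [toC3_apply, hl]
  have h6 : DifferentiableAt ℝ (fun a => realField c (t, a)) a :=
    ((hc.contDiffAt (y := (t, a)) ht (n := 1)).differentiableAt (by simp)).comp a
      ((differentiableAt_const t).prodMk differentiableAt_id)
  have h7 : HasDerivAt (fun s : ℝ => a + s • (EuclideanSpace.single j 1 : E3))
      (EuclideanSpace.single j 1) 0 := by
    simpa using ((hasDerivAt_id (0 : ℝ)).smul_const (EuclideanSpace.single j 1 : E3)).const_add a
  have h8 := HasFDerivAt.comp_hasDerivAt (0 : ℝ) (f := fun s : ℝ => a + s • (EuclideanSpace.single j 1 : E3))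
    (l := fun a => realField c (t, a)) (by simpa using h6.hasFDerivAt) h7
  exact h8.unique h4

theorem isPeriodic_realField (c : Mode → C3) (t : ℝ) : IsPeriodic fun a => realField c (t, a) := by
  intro j a
  simp only [realField, series, isPeriodic_character _ j a]

theorem character_neg_toC3 (p : Fin 3 → ℤ) (a : E3) :
    character (-p) (toC3 a) = (starRingEnd ℂ) (character p (toC3 a)) := by
  simp only [character, ← Complex.exp_conj]
  simp [toC3_apply]

theorem conjC3_smul (z : ℂ) (u : C3) : conjC3 (z • u) = (starRingEnd ℂ) z • conjC3 u := by
  ext j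
  simp [conjC3_apply]

/-- At real points the modes `p` and `-p` contribute conjugate terms, so taking the real part in
`realField` loses nothing. -/
theorem IsHermitianMode.toC3_realField (hc : IsHermitianMode c) (t : ℝ) (a : E3) :
    toC3 (realField c (t, a)) = series c (toC3 a, (t : ℂ)) := by
  refine toC3_reC3 ?_
  rw [series]
  refine (conjC3.toContinuousLinearEquiv.map_tsum).trans ?_
  rw [← negMode.tsum_eq]
  refine tsum_congr fun i => ?_
  have h1 : (negMode i).1 = i.1 := rfl
  have h2 : (negMode i).2 = -i.2 := rfl
  refine (conjC3_smul _ _).trans ?_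
  rw [hc i, h1, h2, character_neg_toC3, map_mul, map_pow, Complex.conj_ofReal, Complex.conj_conj]
  rw [show conjC3 (conjC3 (c i)) = c i by ext j; simp [conjC3_apply]]

theorem IsHermitianMode.dSpace (hc : IsHermitianMode c) (j : Fin 3) :
    IsHermitianMode (dSpace j c) := by
  intro i
  have h2 : (negMode i).2 = -i.2 := rfl
  rw [PeriodicEuler.dSpace, PeriodicEuler.dSpace, conjC3_smul, hc i, h2]
  simp

theorem IsHermitianMode.dTime (hc : IsHermitianMode c) : IsHermitianMode (dTime c) := by
  intro i
  have h2 : (negMode i).1 = i.1 := rfl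
  rw [PeriodicEuler.dTime, PeriodicEuler.dTime, conjC3_smul, h2]
  have := hc (i.1 + 1, i.2)
  rw [show (i.1 + 1, (negMode i).2) = negMode (i.1 + 1, i.2) from rfl, this]
  simp

/-- The Fourier coefficients of a real field. -/
theorem IsHermitianMode.fourierCoefVec_realField (hc : IsHermitianMode c) {σ r t : ℝ} (hσ : 0 ≤ σ)
    (h : Converges c σ r) (ht : |t| ≤ r) (p : Fin 3 → ℤ) :
    HasSum (fun s : ℕ => ((t : ℂ) ^ s) • c (s, p)) (fourierCoefVec (fun a => realField c (t, a)) p) := by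
  have hs : Summable fun i : Mode => ‖((t : ℂ) ^ i.1) • c i‖ := by
    refine h.of_nonneg_of_le (fun _ => norm_nonneg _) fun i => ?_
    rw [norm_smul, norm_pow, Complex.norm_real, Real.norm_eq_abs, ← one_mul (|t| ^ _)]
    have := waveLength_nonneg i.2
    gcongr
    exact Real.one_le_exp (by positivity)
  have hs' := (Equiv.prodComm (Fin 3 → ℤ) ℕ).summable_iff.2 hs
  have h1 : ∀ q, Summable fun s : ℕ => ‖((t : ℂ) ^ s) • c (s, q)‖ := fun q => hs'.prod_factor q
  have h2 : Summable fun q => ‖∑' s : ℕ, ((t : ℂ) ^ s) • c (s, q)‖ :=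
    hs'.prod.of_nonneg_of_le (fun _ => norm_nonneg _) fun q => norm_tsum_le_tsum_norm (h1 q)
  have h3 : fourierCoefVec (fun a => realField c (t, a)) p = ∑' s : ℕ, ((t : ℂ) ^ s) • c (s, p) := by
    ext j
    simp only [fourierCoefVec]
    rw [fourierCoef_eq]
    have h4 : (fun a : E3 => ((realField c (t, a) j : ℝ) : ℂ)) = fun a =>
        ∑' q, (∑' s : ℕ, ((t : ℂ) ^ s) • c (s, q)) j * character q (toC3 a) := by
      funext a
      have h5 : ((realField c (t, a) j : ℝ) : ℂ) = series c (toC3 a, (t : ℂ)) j := by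
        rw [← hc.toC3_realField]; rfl
      have h6 : Summable fun i : Mode => ((t : ℂ) ^ i.1 * character i.2 (toC3 a)) • c i :=
        hs.of_norm_bounded fun i => by
          rw [norm_smul, norm_smul, norm_mul, norm_character_toC3, mul_one]
      have h7 := ((Equiv.prodComm (Fin 3 → ℤ) ℕ).summable_iff.2 h6).hasSum
      have h8 : ∀ q, HasSum (fun s : ℕ => ((t : ℂ) ^ s * character q (toC3 a)) • c (s, q))
          (character q (toC3 a) • ∑' s : ℕ, ((t : ℂ) ^ s) • c (s, q)) := fun q => by
        refine ((h1 q).of_norm.hasSum.const_smul _).congr_fun fun s => ?_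
        rw [smul_smul, mul_comm]
      have h9 := h7.prod_fiberwise h8
      have h10 := h9.mapL (EuclideanSpace.proj j : C3 →L[ℂ] ℂ)
      rw [h5, series, ← (Equiv.prodComm (Fin 3 → ℤ) ℕ).tsum_eq]
      refine h10.tsum_eq.symm.trans (tsum_congr fun q => ?_)
      simp [mul_comm]
    rw [h4, fourierCoefC_tsum]
    exact h2.of_nonneg_of_le (fun _ => norm_nonneg _) fun q => norm_apply_le _ _
  rw [h3]
  exact (h1 p).of_norm.hasSum

end

section

/-! ### Properties of the displacement field -/

theorem Converges.orderMul {c : Mode → C3} {σ r r' : ℝ} (h : Converges c σ r) (hr' : 0 < r')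
    (hr : r' < r) : Converges (fun i => (i.1 : ℂ) • c i) σ r' := by
  have hd : 0 < r / r' - 1 := sub_pos.2 ((one_lt_div hr').2 hr)
  refine (h.mul_left (r / r' - 1)⁻¹).of_nonneg_of_le (fun i => by positivity) fun i => ?_
  have h2 : (i.1 : ℝ) * r' ^ i.1 ≤ (r / r' - 1)⁻¹ * r ^ i.1 := by
    have h3 := one_add_mul_le_pow (a := r / r' - 1) (by linarith) i.1
    rw [add_sub_cancel, div_pow, le_div_iff₀ (by positivity)] at h3
    rw [← div_eq_inv_mul, le_div_iff₀ hd]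
    calc (i.1 : ℝ) * r' ^ i.1 * (r / r' - 1) = (i.1 * (r / r' - 1)) * r' ^ i.1 := by ring
      _ ≤ (1 + i.1 * (r / r' - 1)) * r' ^ i.1 := by gcongr; linarith
      _ ≤ _ := h3
  rw [norm_smul, Complex.norm_natCast]
  calc Real.exp (σ * waveLength i.2) * r' ^ i.1 * ((i.1 : ℝ) * ‖c i‖)
      = ((i.1 : ℝ) * r' ^ i.1) * (Real.exp (σ * waveLength i.2) * ‖c i‖) := by ring
    _ ≤ ((r / r' - 1)⁻¹ * r ^ i.1) * (Real.exp (σ * waveLength i.2) * ‖c i‖) := by gcongr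
    _ = _ := by ring

theorem Converges.summable_grad {c : Mode → C3} {σ r : ℝ} (h : Converges c σ r) (hσ : 0 < σ)
    (hr : 0 ≤ r) : Summable fun i : Mode => r ^ i.1 * (waveLength i.2 * ‖c i‖) := by
  refine (h.mul_left σ⁻¹).of_nonneg_of_le
    (fun i => by have := waveLength_nonneg i.2; positivity) fun i => ?_
  have h2 : waveLength i.2 ≤ σ⁻¹ * Real.exp (σ * waveLength i.2) := by
    rw [← div_eq_inv_mul, le_div_iff₀ hσ, mul_comm]
    exact (le_add_of_nonneg_right zero_le_one).trans (Real.add_one_le_exp _)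
  calc r ^ i.1 * (waveLength i.2 * ‖c i‖)
      ≤ r ^ i.1 * ((σ⁻¹ * Real.exp (σ * waveLength i.2)) * ‖c i‖) := by gcongr
    _ = _ := by ring

/-- The monomial `tˢ e^{i p·a}` at a real point. -/
def monomial (y : ℝ × E3) (i : Mode) : ℂ := (y.1 : ℂ) ^ i.1 * character i.2 (toC3 y.2)

theorem norm_monomial (y : ℝ × E3) (i : Mode) : ‖monomial y i‖ = |y.1| ^ i.1 := by
  rw [monomial, norm_mul, norm_character_toC3, mul_one, norm_pow, Complex.norm_real,
    Real.norm_eq_abs]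

theorem monomial_add (y : ℝ × E3) (i j : Mode) :
    monomial y (i + j) = monomial y i * monomial y j := by
  rw [monomial, monomial, monomial, Prod.fst_add, Prod.snd_add, pow_add, character_add]
  ring

section

variable {c : Mode → C3} {R : ℝ≥0∞}

theorem Admissible.converges_real (hc : Admissible c R) {t : ℝ} (ht : t ∈ timeDisc R) :
    ∃ σ r, 0 < σ ∧ |t| < r ∧ Converges c σ r := by
  have h := hc.converges (enorm_ofReal_lt ht)
  simpa using h

theorem Admissible.summable_monomial (hc : Admissible c R) {y : ℝ × E3} (ht : y.1 ∈ timeDisc R) :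
    Summable fun i => ‖monomial y i‖ * (waveLength i.2 * ‖c i‖) := by
  obtain ⟨σ, r, hσ, h1, h2⟩ := hc.converges_real ht
  have h3 := (h2.mono le_rfl (abs_nonneg _) h1.le).summable_grad hσ (abs_nonneg _)
  simpa only [norm_monomial] using h3

theorem Admissible.summable_monomial_sq (hc : Admissible c R) {y : ℝ × E3}
    (ht : y.1 ∈ timeDisc R) :
    Summable fun i : Mode => (i.1 : ℝ) ^ 2 * (‖monomial y i‖ * (waveLength i.2 * ‖c i‖)) := by
  obtain ⟨σ, r, hσ, h1, h2⟩ := hc.converges_real ht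
  obtain ⟨r', h3, h4⟩ := exists_between h1
  obtain ⟨r'', h5, h6⟩ := exists_between h3
  have h7 := (abs_nonneg _).trans_lt h5
  have h8 := (((h2.orderMul (h7.trans h6) h4).orderMul h7 h6).mono le_rfl (abs_nonneg _)
    h5.le).summable_grad hσ (abs_nonneg _)
  refine h8.congr fun i => ?_
  rw [norm_monomial, norm_smul, norm_smul, Complex.norm_natCast]
  ring

theorem Admissible.hasSum_component (hc : Admissible c R) {y : ℝ × E3} (ht : y.1 ∈ timeDisc R)
    (hH : IsHermitianMode c) (l : Fin 3) :
    HasSum (fun i => monomial y i * c i l) ((realField c y l : ℝ) : ℂ) := by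
  obtain ⟨σ, r, hσ, h1, h2⟩ := hc.converges_real ht
  have h3 : Summable fun i : Mode => ((y.1 : ℂ) ^ i.1 * character i.2 (toC3 y.2)) • c i :=
    h2.of_norm_bounded fun i => norm_monomial_le i (y := (toC3 y.2, (y.1 : ℂ)))
      (by simpa [imPart_toC3] using hσ.le) (by simpa using h1.le)
  have h4 := h3.hasSum.mapL (EuclideanSpace.proj l : C3 →L[ℂ] ℂ)
  have h5 : ((realField c y l : ℝ) : ℂ) = series c (toC3 y.2, (y.1 : ℂ)) l := by
    rw [← hH.toC3_realField]; rfl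
  rw [h5]
  exact h4

end

section

variable {v : (Fin 3 → ℤ) → C3} {R : ℝ≥0∞} (hA : Admissible (xi v) R)
  (hH : IsHermitianMode (xi v))

include hA hH

theorem hasSum_gradTerm {y : ℝ × E3} (ht : y.1 ∈ timeDisc R) (j l : Fin 3) :
    HasSum (gradTerm (monomial y) (xi v) j l)
      ((realField (dSpace j (xi v)) y l : ℝ) : ℂ) := by
  refine ((hA.dSpace j).hasSum_component ht (hH.dSpace j) l).congr_fun fun i => ?_
  rw [gradTerm, dSpace, PiLp.smul_apply, smul_eq_mul]

/-- The factor `s(s - 1)` kills the orders zero and one; what is left is `t²` times the series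
shifted twice. -/
theorem hasSum_accTerm {y : ℝ × E3} (ht : y.1 ∈ timeDisc R) (j l : Fin 3) :
    HasSum (accTerm (monomial y) (xi v) j l)
      ((y.1 ^ 2 * realField (dSpace j (dTime (dTime (xi v)))) y l : ℝ) : ℂ) := by
  have h1 := ((hA.dTime.dTime.dSpace j).hasSum_component ht (hH.dTime.dTime.dSpace j) l).mul_left
    ((y.1 : ℂ) ^ 2)
  push_cast
  refine (succ_mode_injective.hasSum_iff fun i hi => ?_).1
    ((succ_mode_injective.hasSum_iff fun i hi => ?_).1 (h1.congr_fun fun i => ?_))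
  · obtain ⟨s, p⟩ := i
    rcases s with _ | s
    · simp [accTerm]
    · exact absurd ⟨(s, p), rfl⟩ hi
  · obtain ⟨s, p⟩ := i
    rcases s with _ | s
    · simp [accTerm]
    · exact absurd ⟨(s, p), rfl⟩ hi
  · simp only [Function.comp_apply, accTerm, gradTerm, monomial, dSpace, dTime, PiLp.smul_apply,
      smul_eq_mul]
    push_cast
    ring

/-- The flow map preserves volume. -/
theorem det_jacobian (hD : ∀ p, dot (wave p) (v p) = 0) {y : ℝ × E3} (ht : y.1 ∈ timeDisc R) :
    (1 + Matrix.of fun j l => realField (dSpace j (xi v)) y l).det = 1 := by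
  have h := trace_gradTerm (monomial_add y) (hA.summable_monomial ht) hD
  simp only [(hasSum_gradTerm hA hH ht _ _).tsum_eq] at h
  rw [Matrix.det_fin_three] at h ⊢
  simp only [Matrix.of_apply, Matrix.add_apply] at h ⊢
  simp at h ⊢
  exact_mod_cast h

omit hA hH in
theorem continuousAt_realField {c : Mode → C3} (hc : Admissible c R) {t : ℝ} (ht : t ∈ timeDisc R)
    (a : E3) (l : Fin 3) : ContinuousAt (fun t => realField c (t, a) l) t := by
  have h := (hc.hasDerivAt_time ht a).continuousAt
  exact ((EuclideanSpace.proj l : E3 →L[ℝ] ℝ).continuous.continuousAt).comp h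

/-- The Lagrangian pressure force is curl-free. -/
theorem closed_acceleration {y : ℝ × E3} (ht : y.1 ∈ timeDisc R) (a : Fin 3) :
    realField (dSpace (a + 1) (dTime (dTime (xi v)))) y (a + 2) +
      ∑ l, realField (dSpace (a + 1) (dTime (dTime (xi v)))) y l *
        realField (dSpace (a + 2) (xi v)) y l =
    realField (dSpace (a + 2) (dTime (dTime (xi v)))) y (a + 1) +
      ∑ l, realField (dSpace (a + 2) (dTime (dTime (xi v)))) y l *
        realField (dSpace (a + 1) (xi v)) y l := by
  -- The series identity carries the factor `t²` and needs nonvanishing monomials, so it is used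
  -- away from `t = 0`.
  have key : ∀ t : ℝ, t ≠ 0 → t ∈ timeDisc R → ∀ z : E3,
      realField (dSpace (a + 1) (dTime (dTime (xi v)))) (t, z) (a + 2) +
      ∑ l, realField (dSpace (a + 1) (dTime (dTime (xi v)))) (t, z) l *
        realField (dSpace (a + 2) (xi v)) (t, z) l =
      realField (dSpace (a + 2) (dTime (dTime (xi v)))) (t, z) (a + 1) +
      ∑ l, realField (dSpace (a + 2) (dTime (dTime (xi v)))) (t, z) l *
        realField (dSpace (a + 1) (xi v)) (t, z) l := by
    intro t h0 ht z
    have hne : ∀ i, monomial (t, z) i ≠ 0 := fun i => by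
      rw [← norm_ne_zero_iff, norm_monomial]
      positivity
    have h := closed_accTerm (monomial_add _) (hA.summable_monomial (y := (t, z)) ht) hne
      (hA.summable_monomial_sq (y := (t, z)) ht) a
    simp only [(hasSum_gradTerm hA hH (y := (t, z)) ht _ _).tsum_eq,
      (hasSum_accTerm hA hH (y := (t, z)) ht _ _).tsum_eq] at h
    have h1 : t ^ 2 ≠ 0 := by positivity
    refine mul_left_cancel₀ h1 ?_
    simp only [mul_add, Finset.mul_sum, ← mul_assoc]
    exact_mod_cast h
  obtain ⟨t, z⟩ := y
  rcases ne_or_eq t 0 with h0 | rfl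
  · exact key t h0 ht z
  -- At `t = 0` both sides are limits from nonzero times.
  · have hB := fun j l => continuousAt_realField (hA.dTime.dTime.dSpace j) ht z l
    have hG := fun j l => continuousAt_realField (hA.dSpace j) ht z l
    have hl := (hB (a + 1) (a + 2)).add (tendsto_finsetSum Finset.univ
      fun l _ => (hB (a + 1) l).mul (hG (a + 2) l))
    have hr := (hB (a + 2) (a + 1)).add (tendsto_finsetSum Finset.univ
      fun l _ => (hB (a + 2) l).mul (hG (a + 1) l))
    refine tendsto_nhds_unique_of_frequently_eq hl hr ?_
    have h1 : ∀ᶠ t in nhdsWithin (0 : ℝ) {0}ᶜ, t ∈ timeDisc R :=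
      nhdsWithin_le_nhds ((isOpen_timeDisc R).mem_nhds ht)
    have h2 : ∀ᶠ t in nhdsWithin (0 : ℝ) {0}ᶜ, t ≠ 0 := self_mem_nhdsWithin
    exact ((h1.and h2).mono fun t h => key t h.2 h.1 z).frequently.filter_mono nhdsWithin_le_nhds

omit hA hH in
-- Both sources vanish at `p = 0`, so the mean displacement is linear in time: conservation of
-- momentum is built into the recursion.
theorem xi_mean_zero {s : ℕ} (hs : s ≠ 1) : xi v (s, 0) = 0 := by
  rw [xi_eq, if_neg hs, divSource_wave_zero _ rfl, curlSource_wave_zero _ rfl,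
    helmholtz_zero_source, add_zero]

/-- Two time derivatives shift the order by two, and the modes of zero wave vector vanish from order
two on. This mean is what later forces the pressure to be periodic. -/
theorem integral_acceleration {t : ℝ} (ht : t ∈ timeDisc R) (l : Fin 3) :
    ∫ a in cell, realField (dTime (dTime (xi v))) (t, a) l = 0 := by
  obtain ⟨σ, r, hσ, h1, h2⟩ := hA.dTime.dTime.converges_real ht
  have h3 := hH.dTime.dTime.fourierCoefVec_realField hσ.le h2 h1.le 0
  have h4 : ∀ s : ℕ, ((t : ℂ) ^ s) • dTime (dTime (xi v)) (s, 0) = 0 := fun s => by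
    rw [dTime, dTime, xi_mean_zero (by omega), smul_zero, smul_zero, smul_zero]
  have h5 := h3.unique (hasSum_zero.congr_fun h4)
  have h6 := congrArg (fun u : C3 => u l) h5
  simp only [fourierCoefVec, fourierCoef] at h6
  have h7 := (mul_eq_zero.1 h6).resolve_left
    (inv_ne_zero (pow_ne_zero 3 (by simp [Real.pi_ne_zero])))
  simp only [Pi.zero_apply, Int.cast_zero, zero_mul, Finset.sum_const_zero, mul_zero,
    Complex.exp_zero, mul_one, integral_complex_ofReal] at h7
  exact Complex.ofReal_eq_zero.1 h7

omit hA hH in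
theorem realField_xi_zero (a : E3) : realField (xi v) (0, a) = 0 := by
  rw [realField, series]
  have : ∀ i : Mode, (((0 : ℝ) : ℂ) ^ i.1 * character i.2 (toC3 a)) • xi v i = 0 := fun i => by
    rcases Nat.eq_zero_or_pos i.1 with h | h
    · rw [xi_eq_zero v h, smul_zero]
    · simp [zero_pow h.ne']
  rw [tsum_congr this, tsum_zero, map_zero]

omit hA hH in
theorem norm_character_sub_le (p : Fin 3 → ℤ) (a b : E3) :
    ‖character p (toC3 a) - character p (toC3 b)‖ ≤ waveLength p * ‖a - b‖ := by
  have h1 : toC3 a = toC3 b + toC3 (a - b) := by ext j; simp [toC3_apply]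
  rw [h1, character_apply_add, ← mul_sub_one, norm_mul, norm_character_toC3, one_mul]
  have h2 : dot (wave p) (toC3 (a - b)) = ((∑ j, (p j : ℝ) * (a - b) j : ℝ) : ℂ) := by
    simp [dot, wave_apply, toC3_apply]
  have h3 : ‖toC3 (a - b)‖ = ‖a - b‖ := by
    rw [EuclideanSpace.norm_eq, EuclideanSpace.norm_eq]
    simp only [toC3_apply, Complex.norm_real]
  rw [h2]
  refine (Real.norm_exp_I_mul_ofReal_sub_one_le (x := _)).trans ?_
  rw [← Complex.norm_real, ← h2, ← norm_wave, ← h3]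
  exact norm_dot_le _ _

omit hH in
/-- The displacement is a contraction. -/
theorem norm_displacement_sub_le {t : ℝ} (ht : t ∈ timeDisc R)
    (hL : modeGenFun (xi v) 0 |t| ≤ ENNReal.ofReal (2 - √2)) (a b : E3) :
    ‖realField (xi v) (t, a) - realField (xi v) (t, b)‖ ≤ (2 - √2) * ‖a - b‖ := by
  have hs := hA.summable_monomial (y := (t, a)) ht
  have h0 : (0 : ℝ) ≤ 2 - √2 := by
    have : √2 ≤ 2 := by rw [Real.sqrt_le_left (by norm_num)]; norm_num
    linarith
  -- The Lipschitz constant of the mode `(s, p)` is at most `|t|ˢ |p| |ξ̂⁽ˢ⁾ₚ|`, and these add up to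
  -- the generating function at `σ = 0`.
  have h1 : ∑' i, ‖monomial (t, a) i‖ * (waveLength i.2 * ‖xi v i‖) ≤ 2 - √2 := by
    have hnn : ∀ i : Mode, 0 ≤ ‖monomial (t, a) i‖ * (waveLength i.2 * ‖xi v i‖) := fun i => by
      have := waveLength_nonneg i.2
      positivity
    rw [← ENNReal.ofReal_le_ofReal_iff h0, ENNReal.ofReal_tsum_of_nonneg hnn hs]
    refine le_trans (le_of_eq (tsum_congr fun i => ?_)) hL
    rw [modeSize_eq, weight, zero_mul, Real.exp_zero, ENNReal.ofReal_one, one_mul, norm_monomial,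
      ← ENNReal.ofReal_pow (abs_nonneg _), ← ENNReal.ofReal_mul (by positivity)]
  obtain ⟨σ, r, hσ, h2, h3⟩ := hA.converges_real ht
  have h4 : ∀ z : E3, Summable fun i : Mode => ((t : ℂ) ^ i.1 * character i.2 (toC3 z)) • xi v i :=
    fun z => h3.of_norm_bounded fun i => norm_monomial_le i (y := (toC3 z, (t : ℂ)))
      (by simpa [imPart_toC3] using hσ.le) (by simpa using h2.le)
  have h5 : ‖series (xi v) (toC3 a, (t : ℂ)) - series (xi v) (toC3 b, (t : ℂ))‖ ≤
      (2 - √2) * ‖a - b‖ := by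
    rw [series, series, ← (h4 a).tsum_sub (h4 b)]
    refine (tsum_of_norm_bounded (hs.mul_right ‖a - b‖).hasSum fun i => ?_).trans ?_
    · rw [← sub_smul, ← mul_sub, norm_smul, norm_mul, norm_monomial, norm_pow, Complex.norm_real,
        Real.norm_eq_abs]
      calc |t| ^ i.1 * ‖character i.2 (toC3 a) - character i.2 (toC3 b)‖ * ‖xi v i‖
          ≤ |t| ^ i.1 * (waveLength i.2 * ‖a - b‖) * ‖xi v i‖ := by
            gcongr
            exact norm_character_sub_le _ _ _
        _ = _ := by ring
    · rw [tsum_mul_right]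
      gcongr
  refine le_trans ?_ h5
  have h6 : ∀ z : C3, ‖reC3 z‖ ≤ ‖z‖ := fun z => by
    rw [EuclideanSpace.norm_eq, EuclideanSpace.norm_eq]
    gcongr with j
    exact Complex.abs_re_le_norm _
  rw [realField, realField, ← map_sub]
  exact h6 _

end

end

section

/-! ### From Lagrangian to Eulerian coordinates -/

/-- A periodic displacement `d`, with velocity `u` and acceleration `b`, whose map `a + d` preserves
volume and whose acceleration has a potential in Eulerian coordinates. -/
structure IsEulerFlow (R : ℝ≥0∞) (κ : ℝ) (d u b : ℝ × E3 → E3) : Prop where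
  contDiffAt_disp : ∀ y : ℝ × E3, y.1 ∈ timeDisc R → ContDiffAt ℝ 3 d y
  contDiffAt_vel : ∀ y : ℝ × E3, y.1 ∈ timeDisc R → ContDiffAt ℝ 3 u y
  contDiffAt_acc : ∀ y : ℝ × E3, y.1 ∈ timeDisc R → ContDiffAt ℝ 3 b y
  deriv_disp : ∀ t ∈ timeDisc R, ∀ a, HasDerivAt (fun t => d (t, a)) (u (t, a)) t
  deriv_vel : ∀ t ∈ timeDisc R, ∀ a, HasDerivAt (fun t => u (t, a)) (b (t, a)) t
  deriv_grad : ∀ t ∈ timeDisc R, ∀ a j,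
    HasDerivAt (fun t => partialD j (fun a => d (t, a)) a) (partialD j (fun a => u (t, a)) a) t
  initial : ∀ a, d (0, a) = 0
  periodic_disp : ∀ t, IsPeriodic fun a => d (t, a)
  periodic_vel : ∀ t, IsPeriodic fun a => u (t, a)
  periodic_acc : ∀ t, IsPeriodic fun a => b (t, a)
  det_jacobian : ∀ t ∈ timeDisc R, ∀ a,
    (1 + Matrix.of fun j l => partialD j (fun a => d (t, a)) a l).det = 1
  closed : ∀ t ∈ timeDisc R, ∀ (a : E3) (k : Fin 3),
    partialD (k + 1) (fun a => b (t, a)) a (k + 2) +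
      ∑ l, partialD (k + 1) (fun a => b (t, a)) a l * partialD (k + 2) (fun a => d (t, a)) a l =
    partialD (k + 2) (fun a => b (t, a)) a (k + 1) +
      ∑ l, partialD (k + 2) (fun a => b (t, a)) a l * partialD (k + 1) (fun a => d (t, a)) a l
  mean_acc : ∀ t ∈ timeDisc R, ∀ l, ∫ a in cell, b (t, a) l = 0
  ratio_lt_one : κ < 1
  contraction : ∀ t ∈ timeDisc R, ∀ a a', ‖d (t, a) - d (t, a')‖ ≤ κ * ‖a - a'‖

theorem isEulerFlow_realField {v : (Fin 3 → ℤ) → C3} {R : ℝ≥0∞} (hA : Admissible (xi v) R)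
    (hH : IsHermitianMode (xi v)) (hD : ∀ p, dot (wave p) (v p) = 0)
    (hL : ∀ t ∈ timeDisc R, modeGenFun (xi v) 0 |t| ≤ ENNReal.ofReal (2 - √2)) :
    IsEulerFlow R (2 - √2) (realField (xi v)) (realField (dTime (xi v)))
      (realField (dTime (dTime (xi v)))) where
  contDiffAt_disp _ hy := hA.contDiffAt hy
  contDiffAt_vel _ hy := hA.dTime.contDiffAt hy
  contDiffAt_acc _ hy := hA.dTime.dTime.contDiffAt hy
  deriv_disp _ ht a := hA.hasDerivAt_time ht a
  deriv_vel _ ht a := hA.dTime.hasDerivAt_time ht a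
  deriv_grad t ht a j := by
    have h1 := (hA.dSpace j).hasDerivAt_time ht a
    have h2 : dTime (dSpace j (xi v)) = dSpace j (dTime (xi v)) := by
      funext i
      rw [dTime, dSpace, dSpace, dTime, smul_comm]
    rw [h2, ← hA.dTime.partialD_realField ht] at h1
    refine h1.congr_of_eventuallyEq ?_
    filter_upwards [(isOpen_timeDisc R).mem_nhds ht] with s hs
    exact hA.partialD_realField hs a j
  initial := realField_xi_zero
  periodic_disp t := isPeriodic_realField _ t
  periodic_vel t := isPeriodic_realField _ t
  periodic_acc t := isPeriodic_realField _ t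
  det_jacobian t ht a := by
    simp only [hA.partialD_realField ht]
    exact PeriodicEuler.det_jacobian hA hH hD (y := (t, a)) ht
  closed t ht a k := by
    simp only [hA.partialD_realField ht, hA.dTime.dTime.partialD_realField ht]
    exact closed_acceleration hA hH (y := (t, a)) ht k
  mean_acc t ht l := integral_acceleration hA hH ht l
  ratio_lt_one := by
    have : 1 < √2 := by rw [Real.lt_sqrt (by norm_num)]; norm_num
    linarith
  contraction t ht a a' := norm_displacement_sub_le hA ht (hL t ht) a a'

variable {R : ℝ≥0∞} {κ : ℝ} {d u b : ℝ × E3 → E3}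

/-- The label `a` of the particle at the position `y`, at time `t`. -/
def label (d : ℝ × E3 → E3) (y : ℝ × E3) : E3 := Function.invFun (fun a => a + d (y.1, a)) y.2

namespace IsEulerFlow

variable (h : IsEulerFlow R κ d u b)

include h

theorem mul_norm_sub_le {t : ℝ} (ht : t ∈ timeDisc R) (a a' : E3) :
    (1 - κ) * ‖a - a'‖ ≤ ‖(a + d (t, a)) - (a' + d (t, a'))‖ := by
  have h1 := h.contraction t ht a a'
  have h2 := norm_sub_norm_le (a - a') (-(d (t, a) - d (t, a')))
  rw [norm_neg] at h2
  have h3 : a - a' - -(d (t, a) - d (t, a')) = (a + d (t, a)) - (a' + d (t, a')) := by abel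
  rw [h3] at h2
  linarith

theorem injective {t : ℝ} (ht : t ∈ timeDisc R) : Function.Injective fun a => a + d (t, a) := by
  intro a a' haa
  have h1 := h.mul_norm_sub_le ht a a'
  simp only at haa
  rw [haa, sub_self, norm_zero] at h1
  have h2 := sub_pos.2 h.ratio_lt_one
  have h3 : ‖a - a'‖ ≤ 0 := by
    by_contra! h4
    exact absurd h1 (not_le.2 (mul_pos h2 h4))
  exact sub_eq_zero.1 (norm_le_zero_iff.1 h3)

/-- A preimage of `y` is a fixed point of the contraction `a ↦ y - d(t, a)`. -/
theorem surjective {t : ℝ} (ht : t ∈ timeDisc R) : Function.Surjective fun a => a + d (t, a) := by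
  intro y
  have hc : ContractingWith κ.toNNReal fun a => y - d (t, a) := by
    refine ⟨by simpa using h.ratio_lt_one, LipschitzWith.of_dist_le_mul fun a a' => ?_⟩
    rw [dist_eq_norm, dist_eq_norm, sub_sub_sub_cancel_left, norm_sub_rev]
    refine (h.contraction t ht a a').trans ?_
    gcongr
    exact Real.le_coe_toNNReal κ
  refine ⟨hc.fixedPoint, ?_⟩
  have h1 : y - d (t, hc.fixedPoint) = hc.fixedPoint := hc.fixedPoint_isFixedPt
  simp only
  nth_rewrite 1 [← h1]
  exact sub_add_cancel _ _

theorem position_label {t : ℝ} (ht : t ∈ timeDisc R) (y : E3) :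
    label d (t, y) + d (t, label d (t, y)) = y :=
  Function.invFun_eq (h.surjective ht y)

theorem label_position {t : ℝ} (ht : t ∈ timeDisc R) (a : E3) : label d (t, a + d (t, a)) = a :=
  h.injective ht (h.position_label ht _)

theorem label_eq {t : ℝ} (ht : t ∈ timeDisc R) {a y : E3} (hy : a + d (t, a) = y) :
    label d (t, y) = a := by
  rw [← hy, h.label_position ht]

theorem periodic_label {t : ℝ} (ht : t ∈ timeDisc R) (i : Fin 3) (y : E3) :
    label d (t, y + EuclideanSpace.single i (2 * π)) =
      label d (t, y) + EuclideanSpace.single i (2 * π) := by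
  refine h.label_eq ht ?_
  have h1 := h.periodic_disp t i (label d (t, y))
  simp only at h1
  rw [h1, add_right_comm, h.position_label ht]

omit h in
theorem differentiableAt_space {f : ℝ × E3 → E3} {t : ℝ} {a : E3} (hf : ContDiffAt ℝ 3 f (t, a)) :
    DifferentiableAt ℝ (fun a => f (t, a)) a :=
  (hf.differentiableAt (by simp)).comp a ((differentiableAt_const t).prodMk differentiableAt_id)

/-- The inverse function theorem for `(t, a) ↦ (t, a + d)`. The differential is injective by the
lower Lipschitz bound, and global injectivity identifies the local inverse with `label`. -/
theorem contDiffAt_label {y : ℝ × E3} (hy : y.1 ∈ timeDisc R) : ContDiffAt ℝ 3 (label d) y := by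
  obtain ⟨t, y⟩ := y
  set a := label d (t, y) with ha
  have hxa : a + d (t, a) = y := h.position_label hy y
  set Φ : ℝ × E3 → ℝ × E3 := fun z => (z.1, z.2 + d z) with hΦ
  have h1 : ContDiffAt ℝ 3 Φ (t, a) :=
    contDiffAt_fst.prodMk (contDiffAt_snd.add (h.contDiffAt_disp (t, a) hy))
  set L := fderiv ℝ Φ (t, a) with hL
  have hΦd : HasFDerivAt Φ L (t, a) := (h1.differentiableAt (by simp)).hasFDerivAt
  have hdd : HasFDerivAt d (fderiv ℝ d (t, a)) (t, a) :=
    ((h.contDiffAt_disp (t, a) hy).differentiableAt (by simp)).hasFDerivAt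
  have hLv : ∀ w, L w = (w.1, w.2 + fderiv ℝ d (t, a) w) := fun w => by
    have := hΦd.unique (hasFDerivAt_fst.prodMk (hasFDerivAt_snd.add hdd))
    rw [this]
    rfl
  have hinj : Function.Injective L := by
    rw [injective_iff_map_eq_zero]
    rintro ⟨τ, w⟩ hw
    rw [hLv] at hw
    obtain ⟨h2, h3⟩ := Prod.mk.inj hw
    simp only at h2 h3
    subst h2
    -- Along a kernel direction `w` the map has derivative zero, while its difference quotients have
    -- norm at least `(1 - κ)‖w‖`; hence `w = 0`.
    have h4 : HasDerivAt (fun s : ℝ => (a + s • w) + d (t, a + s • w)) 0 0 := by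
      have h5 : HasDerivAt (fun s : ℝ => ((t, a + s • w) : ℝ × E3)) (0, w) 0 := by
        have h6 := ((hasDerivAt_id (0 : ℝ)).smul_const w).const_add a
        simpa using (hasDerivAt_const (0 : ℝ) t).prodMk h6
      have h7 := HasFDerivAt.comp_hasDerivAt (0 : ℝ) (f := fun s : ℝ => ((t, a + s • w) : ℝ × E3))
        (l := Φ) (by simpa using hΦd) h5
      have h8 := (ContinuousLinearMap.snd ℝ ℝ E3).hasFDerivAt.comp_hasDerivAt (0 : ℝ) h7
      refine h8.congr_deriv ?_
      rw [hLv]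
      exact h3
    have h6 := sub_pos.2 h.ratio_lt_one
    have h7 : Filter.Tendsto (fun s : ℝ => ‖s‖⁻¹ * ‖(a + s • w) + d (t, a + s • w) - (a + d (t, a))‖)
        (nhdsWithin 0 {0}ᶜ) (nhds 0) := by
      have h8 := h4.tendsto_slope_zero.norm
      simpa [norm_smul] using h8
    have h8 : ∀ᶠ s in nhdsWithin (0 : ℝ) {0}ᶜ, (1 - κ) * ‖w‖ ≤
        ‖s‖⁻¹ * ‖(a + s • w) + d (t, a + s • w) - (a + d (t, a))‖ := by
      filter_upwards [self_mem_nhdsWithin] with s hs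
      have h9 := h.mul_norm_sub_le hy (a + s • w) a
      rw [add_sub_cancel_left, norm_smul] at h9
      have h10 : 0 < ‖s‖ := norm_pos_iff.2 hs
      rw [← div_eq_inv_mul, le_div_iff₀ h10]
      linarith
    have h9 := ge_of_tendsto h7 h8
    have h10 : ‖w‖ ≤ 0 := by
      by_contra! h11
      exact absurd h9 (not_le.2 (mul_pos h6 h11))
    rw [norm_le_zero_iff.1 h10]
    rfl
  let e : (ℝ × E3) ≃L[ℝ] ℝ × E3 :=
    (LinearEquiv.ofInjectiveEndo (L : ℝ × E3 →ₗ[ℝ] ℝ × E3) hinj).toContinuousLinearEquiv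
  have he : (e : (ℝ × E3) →L[ℝ] ℝ × E3) = L := by
    ext w <;> rfl
  have h2 : HasFDerivAt Φ (e : (ℝ × E3) →L[ℝ] ℝ × E3) (t, a) := he ▸ hΦd
  have hinv := h1.to_localInverse h2 (by simp)
  have hΦa : Φ (t, a) = (t, y) := by simp only [hΦ, hxa]
  rw [hΦa] at hinv
  have hev : ∀ᶠ z in nhds (t, y), Φ (h1.localInverse h2 (by simp) z) = z := by
    rw [← hΦa]
    exact (h1.hasStrictFDerivAt' h2 (by simp)).eventually_right_inverse
  have hI : ∀ᶠ z in nhds (t, y), z.1 ∈ timeDisc R :=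
    continuousAt_fst.eventually ((isOpen_timeDisc R).mem_nhds hy)
  refine (contDiffAt_snd.comp _ hinv).congr_of_eventuallyEq ?_
  filter_upwards [hev, hI] with z hz hzI
  have h3 := Prod.ext_iff.1 hz
  simp only [hΦ] at h3
  refine h.label_eq hzI ?_
  rw [← h3.2]
  simp only [Function.comp_apply]
  rw [← h3.1]

end IsEulerFlow

end

section

/-! ### The Eulerian velocity -/

variable {R : ℝ≥0∞} {κ : ℝ} {d u b : ℝ × E3 → E3}

/-- A Lagrangian field in Eulerian coordinates. -/
def eulerian (d f : ℝ × E3 → E3) (y : ℝ × E3) : E3 := f (y.1, label d y)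

theorem fderiv_eq_sum_partialD {F : Type*} [NormedAddCommGroup F] [NormedSpace ℝ F]
    (f : E3 → F) (a w : E3) : fderiv ℝ f a w = ∑ m, w m • partialD m f a := by
  have hw : w = ∑ m, w m • (EuclideanSpace.single m 1 : E3) := by
    ext l
    fin_cases l <;> simp [Fin.sum_univ_three]
  conv_lhs => rw [hw]
  simp only [map_sum, map_smul, partialD]

namespace IsEulerFlow

variable (h : IsEulerFlow R κ d u b)

include h

theorem contDiffAt_eulerian {f : ℝ × E3 → E3}
    (hf : ∀ y : ℝ × E3, y.1 ∈ timeDisc R → ContDiffAt ℝ 3 f y) {y : ℝ × E3}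
    (hy : y.1 ∈ timeDisc R) : ContDiffAt ℝ 3 (eulerian d f) y :=
  ContDiffAt.comp (g := f) y (hf (y.1, label d y) hy) (contDiffAt_fst.prodMk (h.contDiffAt_label hy))

theorem eulerian_position {t : ℝ} (ht : t ∈ timeDisc R) (f : ℝ × E3 → E3) (a : E3) :
    eulerian d f (t, a + d (t, a)) = f (t, a) := by
  rw [eulerian, h.label_position ht]

theorem periodic_eulerian {t : ℝ} (ht : t ∈ timeDisc R) {f : ℝ × E3 → E3}
    (hf : IsPeriodic fun a => f (t, a)) : IsPeriodic fun y => eulerian d f (t, y) := by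
  intro i y
  simp only [eulerian]
  rw [h.periodic_label ht]
  exact hf i _

/-- The identity `u(t, a) = V(t, x(t, a))` is differentiated along a trajectory by the chain rule,
with `V` the Eulerian velocity. -/
theorem material_derivative {t : ℝ} (ht : t ∈ timeDisc R) (y : E3) :
    HasDerivAt (fun τ => eulerian d u (τ, y)) (eulerian d b (t, y) -
      fderiv ℝ (fun y => eulerian d u (t, y)) y (eulerian d u (t, y))) t := by
  set a := label d (t, y) with ha
  have hxa : a + d (t, a) = y := h.position_label ht y
  have hW : HasFDerivAt (eulerian d u) (fderiv ℝ (eulerian d u) (t, y)) (t, y) :=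
    ((h.contDiffAt_eulerian h.contDiffAt_vel (y := (t, y)) ht).differentiableAt
      (by simp)).hasFDerivAt
  have h1 : HasDerivAt (fun τ => ((τ, a + d (τ, a)) : ℝ × E3)) (1, u (t, a)) t :=
    (hasDerivAt_id t).prodMk ((h.deriv_disp t ht a).const_add a)
  have h2 := HasFDerivAt.comp_hasDerivAt t (f := fun τ => ((τ, a + d (τ, a)) : ℝ × E3))
    (l := eulerian d u) (by rw [hxa]; exact hW) h1
  have h3 : HasDerivAt (fun τ => u (τ, a)) (fderiv ℝ (eulerian d u) (t, y) (1, u (t, a))) t := by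
    refine h2.congr_of_eventuallyEq ?_
    filter_upwards [(isOpen_timeDisc R).mem_nhds ht] with τ hτ
    exact (h.eulerian_position hτ u a).symm
  have h4 := h3.unique (h.deriv_vel t ht a)
  have h5 : HasDerivAt (fun τ => eulerian d u (τ, y)) (fderiv ℝ (eulerian d u) (t, y) (1, 0)) t :=
    HasFDerivAt.comp_hasDerivAt t (l := eulerian d u) (f := fun τ => ((τ, y) : ℝ × E3)) hW
      ((hasDerivAt_id t).prodMk (hasDerivAt_const t y))
  have h6 : HasFDerivAt (fun y => eulerian d u (t, y))
      ((fderiv ℝ (eulerian d u) (t, y)).comp (ContinuousLinearMap.inr ℝ ℝ E3)) y :=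
    hW.comp y (hasFDerivAt_prodMk_right t y)
  refine h5.congr_deriv ?_
  rw [h6.fderiv, ContinuousLinearMap.comp_apply, ContinuousLinearMap.inr_apply, eq_sub_iff_add_eq,
    ← map_add]
  rw [show eulerian d b (t, y) = b (t, a) from rfl, ← h4,
    show eulerian d u (t, y) = u (t, a) from rfl]
  simp

theorem partialD_vel {t : ℝ} (ht : t ∈ timeDisc R) (a : E3) (j : Fin 3) :
    partialD j (fun a => u (t, a)) a =
      partialD j (fun y => eulerian d u (t, y)) (a + d (t, a)) +
      ∑ m, partialD j (fun a => d (t, a)) a m •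
        partialD m (fun y => eulerian d u (t, y)) (a + d (t, a)) := by
  have h1 : DifferentiableAt ℝ (fun y => eulerian d u (t, y)) (a + d (t, a)) :=
    differentiableAt_space (h.contDiffAt_eulerian h.contDiffAt_vel (y := (t, _)) ht)
  have h2 : DifferentiableAt ℝ (fun a => d (t, a)) a :=
    differentiableAt_space (h.contDiffAt_disp (t, a) ht)
  have h3 : HasFDerivAt (fun a => a + d (t, a))
      (ContinuousLinearMap.id ℝ E3 + fderiv ℝ (fun a => d (t, a)) a) a :=
    (hasFDerivAt_id a).add h2.hasFDerivAt
  have h4 := HasFDerivAt.comp a (f := fun a => a + d (t, a)) h1.hasFDerivAt h3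
  have h5 : (fun y => eulerian d u (t, y)) ∘ (fun a => a + d (t, a)) = fun a => u (t, a) := by
    funext a
    exact h.eulerian_position ht u a
  rw [h5] at h4
  rw [partialD, h4.fderiv, ContinuousLinearMap.comp_apply, _root_.add_apply, map_add,
    fderiv_eq_sum_partialD _ _ ((fderiv ℝ (fun a => d (t, a)) a) _)]
  rfl

/-- Jacobi's formula: since `∂ₜ∇x` is `∇x` times the gradient of the Eulerian velocity, the
derivative of `det ∇x = 1` is `det ∇x` times the divergence. -/
theorem divergence_eulerian {t : ℝ} (ht : t ∈ timeDisc R) (y : E3) :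
    divergence (fun y => eulerian d u (t, y)) y = 0 := by
  set a := label d (t, y) with ha
  have hxa : a + d (t, a) = y := h.position_label ht y
  have hN : ∀ j l, partialD j (fun a => u (t, a)) a l =
      partialD j (fun y => eulerian d u (t, y)) y l +
      ∑ m, partialD j (fun a => d (t, a)) a m * partialD m (fun y => eulerian d u (t, y)) y l := by
    intro j l
    rw [h.partialD_vel ht, hxa]
    simp
  have hM : ∀ j l, HasDerivAt (fun t => partialD j (fun a => d (t, a)) a l)
      (partialD j (fun a => u (t, a)) a l) t := fun j l =>
    (EuclideanSpace.proj l : E3 →L[ℝ] ℝ).hasFDerivAt.comp_hasDerivAt t (h.deriv_grad t ht a j)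
  have hdet := h.det_jacobian t ht a
  have hdet' : ∀ᶠ s in nhds t, (1 + Matrix.of fun j l => partialD j (fun a => d (s, a)) a l).det = 1 := by
    filter_upwards [(isOpen_timeDisc R).mem_nhds ht] with s hs using h.det_jacobian s hs a
  simp only [Matrix.det_fin_three, Matrix.of_apply, Matrix.add_apply] at hdet hdet'
  simp at hdet hdet'
  have h0 := (hasDerivAt_const t (1 : ℝ)).congr_of_eventuallyEq hdet'
  have q := fun j => (hM j j).const_add 1
  have h1 := (((((((q 0).mul (q 1)).mul (q 2)).sub (((q 0).mul (hM 1 2)).mul (hM 2 1))).sub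
    (((hM 0 1).mul (hM 1 0)).mul (q 2))).add (((hM 0 1).mul (hM 1 2)).mul (hM 2 0))).add
    (((hM 0 2).mul (hM 1 0)).mul (hM 2 1))).sub (((hM 0 2).mul (q 1)).mul (hM 2 0))
  have h2 := h1.unique h0
  simp only [Pi.mul_apply, hN, Fin.sum_univ_three] at h2
  rw [divergence, Fin.sum_univ_three]
  linear_combination h2 - (partialD 0 (fun y => eulerian d u (t, y)) y 0 +
    partialD 1 (fun y => eulerian d u (t, y)) y 1 +
    partialD 2 (fun y => eulerian d u (t, y)) y 2) * hdet

end IsEulerFlow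

end

section

/-! ### Null Lagrangians on the periodicity cell -/

/-- The components of the cross product `∇g × ∇k`. -/
def gradCross (g k : E3 → ℝ) (j : Fin 3) (a : E3) : ℝ :=
  partialD (j + 1) g a * partialD (j + 2) k a - partialD (j + 2) g a * partialD (j + 1) k a

theorem contDiff_partialD {F : Type*} [NormedAddCommGroup F] [NormedSpace ℝ F] {f : E3 → F}
    {m n : ℕ} (hf : ContDiff ℝ n f) (hmn : m + 1 ≤ n) (j : Fin 3) : ContDiff ℝ m (partialD j f) :=
  (hf.fderiv_right (m := m) (by exact_mod_cast hmn)).clm_apply contDiff_const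

theorem partialD_comm {f : E3 → ℝ} (hf : ContDiff ℝ 2 f) (i j : Fin 3) (a : E3) :
    partialD i (partialD j f) a = partialD j (partialD i f) a := by
  have h1 : ∀ i j, partialD i (partialD j f) a =
      fderiv ℝ (fderiv ℝ f) a (EuclideanSpace.single i 1) (EuclideanSpace.single j 1) := by
    intro i j
    have h2 : DifferentiableAt ℝ (fderiv ℝ f) a :=
      (hf.fderiv_right (m := 1) (by norm_num)).differentiable (by simp) a
    have h3 := h2.hasFDerivAt.clm_apply (hasFDerivAt_const (EuclideanSpace.single j (1 : ℝ) : E3) a)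
    rw [partialD, show partialD j f = fun a => fderiv ℝ f a (EuclideanSpace.single j 1) from rfl,
      h3.fderiv]
    simp
  rw [h1, h1]
  exact (hf.contDiffAt.isSymmSndFDerivAt (by simp)) _ _

theorem partialD_mul_real {f g : E3 → ℝ} {a : E3} (hf : DifferentiableAt ℝ f a)
    (hg : DifferentiableAt ℝ g a) (j : Fin 3) :
    partialD j (fun a => f a * g a) a = partialD j f a * g a + f a * partialD j g a := by
  rw [partialD, fderiv_fun_mul hf hg]
  simp [partialD]
  ring

theorem partialD_sub_real {f g : E3 → ℝ} {a : E3} (hf : DifferentiableAt ℝ f a)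
    (hg : DifferentiableAt ℝ g a) (j : Fin 3) :
    partialD j (fun a => f a - g a) a = partialD j f a - partialD j g a := by
  rw [partialD, fderiv_fun_sub hf hg]
  rfl

theorem contDiff_gradCross {g k : E3 → ℝ} (hg : ContDiff ℝ 2 g) (hk : ContDiff ℝ 2 k) (j : Fin 3) :
    ContDiff ℝ 1 (gradCross g k j) := by
  have h1 := fun j => contDiff_partialD (m := 1) (n := 2) hg (by norm_num) j
  have h2 := fun j => contDiff_partialD (m := 1) (n := 2) hk (by norm_num) j
  exact ((h1 _).mul (h2 _)).sub ((h1 _).mul (h2 _))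

/-- The terms cancel in pairs by the symmetry of second derivatives. -/
theorem divergence_gradCross {g k : E3 → ℝ} (hg : ContDiff ℝ 2 g) (hk : ContDiff ℝ 2 k) (a : E3) :
    ∑ j, partialD j (gradCross g k j) a = 0 := by
  have h1 := fun j => (contDiff_partialD (m := 1) (n := 2) hg (by norm_num) j).differentiable
    (by simp) a
  have h2 := fun j => (contDiff_partialD (m := 1) (n := 2) hk (by norm_num) j).differentiable
    (by simp) a
  have h3 : ∀ j, partialD j (gradCross g k j) a =
      (partialD j (partialD (j + 1) g) a * partialD (j + 2) k a +
        partialD (j + 1) g a * partialD j (partialD (j + 2) k) a) -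
      (partialD j (partialD (j + 2) g) a * partialD (j + 1) k a +
        partialD (j + 2) g a * partialD j (partialD (j + 1) k) a) := fun j => by
    rw [← partialD_mul_real (h1 _) (h2 _), ← partialD_mul_real (h1 _) (h2 _)]
    exact partialD_sub_real (f := fun a => partialD (j + 1) g a * partialD (j + 2) k a)
      (g := fun a => partialD (j + 2) g a * partialD (j + 1) k a)
      ((h1 _).mul (h2 _)) ((h1 _).mul (h2 _)) j
  simp only [h3, Fin.sum_univ_three]
  have e1 : (2 : Fin 3) + 1 = 0 := rfl
  have e2 : (1 : Fin 3) + 2 = 0 := rfl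
  have e3 : (2 : Fin 3) + 2 = 1 := rfl
  have e4 : (1 : Fin 3) + 1 = 2 := rfl
  simp only [zero_add, e1, e2, e3, e4]
  rw [partialD_comm hg 1 0, partialD_comm hg 2 0, partialD_comm hg 2 1, partialD_comm hk 1 0,
    partialD_comm hk 2 0, partialD_comm hk 2 1]
  ring

/-- The integrand is the divergence of `f ∇g × ∇k`. Only the gradients of `g` and `k` have to be
periodic, so coordinates `aₘ + dₘ` are allowed. -/
theorem integral_grad_gradCross {f g k : E3 → ℝ} (hf : ContDiff ℝ 1 f) (hg : ContDiff ℝ 2 g)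
    (hk : ContDiff ℝ 2 k) (pf : IsPeriodic f) (pg : ∀ j, IsPeriodic (partialD j g))
    (pk : ∀ j, IsPeriodic (partialD j k)) :
    ∫ a in cell, ∑ j, partialD j f a * gradCross g k j a = 0 := by
  have h0 := fun j => contDiff_gradCross hg hk j
  have h1 : ∀ a, ∑ j, partialD j f a * gradCross g k j a =
      ∑ j, partialD j (fun a => f a * gradCross g k j a) a := fun a => by
    simp only [partialD_mul_real (hf.differentiable (by simp) a)
      ((h0 _).differentiable (by simp) a), Finset.sum_add_distrib, ← Finset.mul_sum,
      divergence_gradCross hg hk, mul_zero, add_zero]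
  have h2 : ∀ j, IsPeriodic fun a => f a * gradCross g k j a := fun j i a => by
    simp only [gradCross, pf i a, pg _ i a, pk _ i a]
  simp only [h1]
  rw [integral_finsetSum]
  · exact Finset.sum_eq_zero fun j _ => integral_cell_partialD (hf.mul (h0 j)) (h2 j) j
  · exact fun j _ => integrableOn_cell (continuous_partialD (hf.mul (h0 j)) j)

theorem integral_gradCross {f k : E3 → ℝ} (hf : ContDiff ℝ 2 f) (hk : ContDiff ℝ 2 k)
    (pf : IsPeriodic f) (pk : ∀ j, IsPeriodic (partialD j k)) (j : Fin 3) :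
    ∫ a in cell, gradCross f k j a = 0 := by
  have h1 := fun j => contDiff_partialD (m := 1) (n := 2) hk (by norm_num) j
  have hf1 : ContDiff ℝ 1 f := hf.of_le (by norm_num)
  have h2 : ∀ a, gradCross f k j a = partialD (j + 1) (fun a => f a * partialD (j + 2) k a) a -
      partialD (j + 2) (fun a => f a * partialD (j + 1) k a) a := fun a => by
    rw [partialD_mul_real (hf1.differentiable (by simp) a) ((h1 _).differentiable (by simp) a),
      partialD_mul_real (hf1.differentiable (by simp) a) ((h1 _).differentiable (by simp) a),
      partialD_comm hk, gradCross]
    ring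
  have h3 : ∀ i, IsPeriodic fun a => f a * partialD i k a := fun i m a => by
    simp only [pf m a, pk i m a]
  simp only [h2]
  rw [integral_sub (integrableOn_cell (continuous_partialD (hf1.mul (h1 _)) _))
    (integrableOn_cell (continuous_partialD (hf1.mul (h1 _)) _)),
    integral_cell_partialD (hf1.mul (h1 _)) (h3 _), integral_cell_partialD (hf1.mul (h1 _)) (h3 _),
    sub_zero]

end

section

/-! ### The pressure -/

variable {R : ℝ≥0∞} {κ : ℝ} {d u b : ℝ × E3 → E3}

/-- The form `⟨b, dx⟩`, where `x = a + d`. -/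
def forceForm (d b : ℝ × E3 → E3) (t : ℝ) (a : E3) : E3 →L[ℝ] ℝ :=
  (innerSL ℝ (b (t, a))).comp (ContinuousLinearMap.id ℝ E3 + fderiv ℝ (fun a => d (t, a)) a)

/-- The coordinate function `xₘ = aₘ + dₘ`. -/
def position (d : ℝ × E3 → E3) (t : ℝ) (m : Fin 3) (a : E3) : ℝ := a m + d (t, a) m

theorem forceForm_apply (t : ℝ) (a w : E3) :
    forceForm d b t a w = ∑ l, b (t, a) l * (w l + fderiv ℝ (fun a => d (t, a)) a w l) := by
  simp only [forceForm, ContinuousLinearMap.comp_apply, innerSL_apply_apply, PiLp.inner_apply]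
  simp [mul_comm]

theorem partialD_apply {f : E3 → E3} {a : E3} (hf : DifferentiableAt ℝ f a) (j l : Fin 3) :
    partialD j (fun a => f a l) a = partialD j f a l := by
  have h := ((EuclideanSpace.proj l : E3 →L[ℝ] ℝ).hasFDerivAt (x := f a)).comp a hf.hasFDerivAt
  rw [partialD, show (fun a => f a l) = (EuclideanSpace.proj l : E3 →L[ℝ] ℝ) ∘ f from rfl, h.fderiv]
  rfl

namespace IsEulerFlow

variable (h : IsEulerFlow R κ d u b)

include h

theorem contDiff_disp {t : ℝ} (ht : t ∈ timeDisc R) : ContDiff ℝ 3 fun a => d (t, a) :=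
  contDiff_iff_contDiffAt.2 fun a => ContDiffAt.comp a (g := d) (h.contDiffAt_disp (t, a) ht)
    (contDiffAt_const.prodMk contDiffAt_id)

theorem contDiff_acc {t : ℝ} (ht : t ∈ timeDisc R) : ContDiff ℝ 3 fun a => b (t, a) :=
  contDiff_iff_contDiffAt.2 fun a => ContDiffAt.comp a (g := b) (h.contDiffAt_acc (t, a) ht)
    (contDiffAt_const.prodMk contDiffAt_id)

theorem contDiff_forceForm {t : ℝ} (ht : t ∈ timeDisc R) : ContDiff ℝ 2 (forceForm d b t) := by
  have h1 : ContDiff ℝ 2 fun a => innerSL ℝ (b (t, a)) :=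
    (innerSL ℝ).contDiff.comp ((h.contDiff_acc ht).of_le (by norm_num))
  have h2 : ContDiff ℝ 2 (fderiv ℝ fun a => d (t, a)) :=
    (h.contDiff_disp ht).fderiv_right (by norm_num)
  exact h1.clm_comp (contDiff_const.add h2)

/-- In the derivative of `⟨b, dx⟩` the part with second derivatives of `d` is symmetric. The
antisymmetric part of the rest is a combination of the three equations `closed`. -/
theorem fderiv_forceForm_symmetric {t : ℝ} (ht : t ∈ timeDisc R) (a v w : E3) :
    fderiv ℝ (forceForm d b t) a v w = fderiv ℝ (forceForm d b t) a w v := by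
  have hb : HasFDerivAt (fun a => b (t, a)) (fderiv ℝ (fun a => b (t, a)) a) a :=
    ((h.contDiff_acc ht).differentiable (by simp) a).hasFDerivAt
  have hd : HasFDerivAt (fderiv ℝ fun a => d (t, a)) (fderiv ℝ (fderiv ℝ fun a => d (t, a)) a) a :=
    (((h.contDiff_disp ht).fderiv_right (m := 2) (by norm_num)).differentiable
      (by norm_num) a).hasFDerivAt
  have hsym : IsSymmSndFDerivAt ℝ (fun a => d (t, a)) a :=
    (h.contDiff_disp ht).contDiffAt.isSymmSndFDerivAt (by simp; norm_num)
  have h1 := ((innerSL ℝ).hasFDerivAt.comp a hb).clm_comp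
    (hd.const_add (ContinuousLinearMap.id ℝ E3))
  have h2 : ∀ v w, fderiv ℝ (forceForm d b t) a v w =
      inner ℝ (b (t, a)) (fderiv ℝ (fderiv ℝ fun a => d (t, a)) a v w) +
      inner ℝ (fderiv ℝ (fun a => b (t, a)) a v) (w + fderiv ℝ (fun a => d (t, a)) a w) := by
    intro v w
    have h3 : HasFDerivAt (forceForm d b t) _ a := h1
    rw [h3.fderiv]
    simp only [inner_add_right]
    simp
    rfl
  have h3 : ∀ v w, inner ℝ (fderiv ℝ (fun a => b (t, a)) a v)
      (w + fderiv ℝ (fun a => d (t, a)) a w) = ∑ i, ∑ j, v i * w j *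
        (partialD i (fun a => b (t, a)) a j + ∑ l, partialD i (fun a => b (t, a)) a l *
          partialD j (fun a => d (t, a)) a l) := by
    intro v w
    rw [fderiv_eq_sum_partialD _ a v, fderiv_eq_sum_partialD _ a w]
    simp only [PiLp.inner_apply, PiLp.add_apply, Fin.sum_univ_three, PiLp.smul_apply, smul_eq_mul]
    simp
    ring
  have h01 := h.closed t ht a 2
  have h12 := h.closed t ht a 0
  have h20 := h.closed t ht a 1
  have e1 : (2 : Fin 3) + 1 = 0 := rfl
  have e2 : (1 : Fin 3) + 2 = 0 := rfl
  have e3 : (2 : Fin 3) + 2 = 1 := rfl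
  have e4 : (1 : Fin 3) + 1 = 2 := rfl
  simp only [zero_add, e1, e2, e3, e4] at h01 h12 h20
  rw [h2, h2, h3, h3, hsym.eq v w]
  simp only [Fin.sum_univ_three] at h01 h12 h20 ⊢
  linear_combination (v 0 * w 1 - v 1 * w 0) * h01 + (v 1 * w 2 - v 2 * w 1) * h12 +
    (v 2 * w 0 - v 0 * w 2) * h20

theorem exists_potential {t : ℝ} (ht : t ∈ timeDisc R) :
    ∃ q : E3 → ℝ, ∀ a, HasFDerivAt q (forceForm d b t a) a := by
  obtain ⟨q, hq⟩ := (convex_univ : Convex ℝ (univ : Set E3)).exists_forall_hasFDerivAt_of_fderiv_symmetric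
    isOpen_univ ((h.contDiff_forceForm ht).differentiable (by simp)).differentiableOn
    fun a _ v w => h.fderiv_forceForm_symmetric ht a v w
  exact ⟨q, fun a => hq a (mem_univ a)⟩

theorem contDiff_position {t : ℝ} (ht : t ∈ timeDisc R) (m : Fin 3) :
    ContDiff ℝ 2 (position d t m) :=
  ((EuclideanSpace.proj m : E3 →L[ℝ] ℝ).contDiff).add
    ((EuclideanSpace.proj m : E3 →L[ℝ] ℝ).contDiff.comp ((h.contDiff_disp ht).of_le (by norm_num)))

theorem partialD_position {t : ℝ} (ht : t ∈ timeDisc R) (m j : Fin 3) (a : E3) :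
    partialD j (position d t m) a = (if m = j then 1 else 0) + partialD j (fun a => d (t, a)) a m := by
  have h1 : HasFDerivAt (fun a : E3 => a + d (t, a))
      (ContinuousLinearMap.id ℝ E3 + fderiv ℝ (fun a => d (t, a)) a) a :=
    (hasFDerivAt_id a).add ((h.contDiff_disp ht).differentiable (by simp) a).hasFDerivAt
  have h2 := ((EuclideanSpace.proj m : E3 →L[ℝ] ℝ).hasFDerivAt).comp a h1
  rw [partialD, show position d t m = (EuclideanSpace.proj m : E3 →L[ℝ] ℝ) ∘
    (fun a : E3 => a + d (t, a)) from rfl, h2.fderiv]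
  simp [partialD]

theorem periodic_partialD_position {t : ℝ} (ht : t ∈ timeDisc R) (m j : Fin 3) :
    IsPeriodic (partialD j (position d t m)) := by
  intro i a
  have := (h.periodic_disp t).partialD j i a
  rw [h.partialD_position ht, h.partialD_position ht, this]

/-- Cofactors of `∇x` are null Lagrangians: the periodic displacement does not affect their mean,
which is that of the identity matrix. -/
theorem integral_gradCross_position {t : ℝ} (ht : t ∈ timeDisc R) (j l : Fin 3) :
    ∫ a in cell, gradCross (position d t (l + 1)) (position d t (l + 2)) j a =
      if j = l then (2 * π) ^ 3 else 0 := by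
  set k := position d t (l + 2) with hk
  have hk2 : ContDiff ℝ 2 k := h.contDiff_position ht _
  have hkp := fun j => h.periodic_partialD_position ht (l + 2) j
  have hd2 : ContDiff ℝ 2 fun a => d (t, a) (l + 1) :=
    (EuclideanSpace.proj (l + 1) : E3 →L[ℝ] ℝ).contDiff.comp
      ((h.contDiff_disp ht).of_le (by norm_num))
  have hdl : ContDiff ℝ 1 fun a => d (t, a) (l + 2) :=
    (EuclideanSpace.proj (l + 2) : E3 →L[ℝ] ℝ).contDiff.comp
      ((h.contDiff_disp ht).of_le (by norm_num))
  have hdp : ∀ m, IsPeriodic fun a => d (t, a) m := fun m => (h.periodic_disp t).comp fun w => w m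
  have hdiff := fun a => (h.contDiff_disp ht).differentiable (by simp) a
  have h1 : ∀ a, gradCross (position d t (l + 1)) k j a =
      gradCross (fun a => d (t, a) (l + 1)) k j a + (if j = l then 1 else 0) +
      ((if l + 1 = j + 1 then 1 else 0) * partialD (j + 2) (fun a => d (t, a) (l + 2)) a -
        (if l + 1 = j + 2 then 1 else 0) * partialD (j + 1) (fun a => d (t, a) (l + 2)) a) := by
    intro a
    simp only [gradCross, hk, h.partialD_position ht, partialD_apply (hdiff a)]
    fin_cases j <;> fin_cases l <;> simp <;> ring
  have i1 := integrableOn_cell (contDiff_gradCross hd2 hk2 j).continuous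
  have i2 : ∀ i, IntegrableOn (partialD i (fun a => d (t, a) (l + 2))) cell :=
    fun i => integrableOn_cell (continuous_partialD hdl i)
  have i3 : IntegrableOn (fun _ : E3 => (if j = l then 1 else 0 : ℝ)) cell :=
    integrableOn_cell continuous_const
  have i4 : IntegrableOn (fun a => gradCross (fun a => d (t, a) (l + 1)) k j a +
      (if j = l then 1 else 0)) cell := i1.add i3
  have i5 : ∀ (c : ℝ) i, IntegrableOn (fun a => c * partialD i (fun a => d (t, a) (l + 2)) a) cell :=
    fun c i => (i2 i).const_mul c
  have i6 : ∀ (c c' : ℝ) i i', IntegrableOn (fun a => c * partialD i (fun a => d (t, a) (l + 2)) a -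
      c' * partialD i' (fun a => d (t, a) (l + 2)) a) cell := fun c c' i i' => (i5 c i).sub (i5 c' i')
  simp only [h1]
  rw [integral_add i4 (i6 _ _ _ _), integral_add i1 i3, integral_sub (i5 _ _) (i5 _ _),
    integral_const_mul, integral_const_mul, integral_cell_partialD hdl (hdp _),
    integral_cell_partialD hdl (hdp _), integral_gradCross hd2 hk2 (hdp _) hkp, setIntegral_const,
    measureReal_def, volume_cell, ENNReal.toReal_ofReal (by positivity)]
  simp

/-- Cramer's rule: as `det ∇x = 1`, the inverse of `∇x` is given by its cofactors, which are the
components `gradCross` of the positions. -/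
theorem acceleration_eq {t : ℝ} (ht : t ∈ timeDisc R) (a : E3) (l : Fin 3) :
    b (t, a) l = ∑ j, forceForm d b t a (EuclideanSpace.single j 1) *
      gradCross (position d t (l + 1)) (position d t (l + 2)) j a := by
  have hdet := h.det_jacobian t ht a
  have hw : ∀ j, forceForm d b t a (EuclideanSpace.single j 1) =
      ∑ m, b (t, a) m * partialD j (position d t m) a := fun j => by
    rw [forceForm_apply]
    refine Finset.sum_congr rfl fun m _ => ?_
    rw [h.partialD_position ht]
    simp [partialD, eq_comm]
  have hM : (1 + Matrix.of fun j l => partialD j (fun a => d (t, a)) a l) =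
      Matrix.of fun j l => partialD j (position d t l) a := by
    ext j l
    simp [h.partialD_position ht, Matrix.one_apply, eq_comm]
  rw [hM, Matrix.det_fin_three] at hdet
  simp only [Matrix.of_apply] at hdet
  simp only [hw, gradCross, Fin.sum_univ_three]
  have e1 : (2 : Fin 3) + 1 = 0 := rfl
  have e2 : (1 : Fin 3) + 2 = 0 := rfl
  have e3 : (2 : Fin 3) + 2 = 1 := rfl
  have e4 : (1 : Fin 3) + 1 = 2 := rfl
  fin_cases l
  · simp only [Fin.zero_eta, zero_add, e1, e2, e3, e4]
    linear_combination (-b (t, a) 0) * hdet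
  · simp only [Fin.mk_one, zero_add, e1, e2, e3, e4]
    linear_combination (-b (t, a) 1) * hdet
  · simp only [Fin.reduceFinMk, zero_add, e1, e2, e3, e4]
    linear_combination (-b (t, a) 2) * hdet

theorem periodic_forceForm (t : ℝ) : IsPeriodic (forceForm d b t) := by
  intro i a
  have h1 := (h.periodic_disp t).fderiv i a
  have h2 := h.periodic_acc t i a
  simp only at h2
  rw [forceForm, forceForm, h1, h2]

/-- A potential of the periodic form has constant periods, so it is a periodic function plus a
linear one with slopes `c`. Averaging the acceleration, written by cofactors, removes the periodic
part and leaves `cₗ (2π)³`. The mean is zero, hence `c = 0`. -/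
theorem exists_periodic_potential {t : ℝ} (ht : t ∈ timeDisc R) :
    ∃ q : E3 → ℝ, IsPeriodic q ∧ ∀ a, HasFDerivAt q (forceForm d b t a) a := by
  obtain ⟨q, hq⟩ := h.exists_potential ht
  have hconst : ∀ (i : Fin 3) (a : E3), q (a + EuclideanSpace.single i (2 * π)) - q a =
      q (0 + EuclideanSpace.single i (2 * π)) - q 0 := by
    intro i a
    have h1 : ∀ a, HasFDerivAt (fun a => q (a + EuclideanSpace.single i (2 * π)) - q a)
        (0 : E3 →L[ℝ] ℝ) a := fun a => by
      have h2 := (HasFDerivAt.comp a (g := q) (hq (a + EuclideanSpace.single i (2 * π)))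
        ((hasFDerivAt_id a).add_const (EuclideanSpace.single i (2 * π)))).sub (hq a)
      rw [h.periodic_forceForm t, ContinuousLinearMap.comp_id, sub_self] at h2
      exact h2
    exact is_const_of_fderiv_eq_zero (fun a => (h1 a).differentiableAt) (fun a => (h1 a).fderiv) a 0
  -- Slopes of the linear function with the same periods as `q`.
  set c : Fin 3 → ℝ := fun i => (q (0 + EuclideanSpace.single i (2 * π)) - q 0) / (2 * π) with hc
  have hpi : (2 * π) ≠ 0 := by positivity
  set p : E3 → ℝ := fun a => q a - ∑ i, c i * a i with hp
  have hpp : IsPeriodic p := by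
    intro i a
    have h1 := hconst i a
    have h2 : ∑ j, c j * (a + EuclideanSpace.single i (2 * π)) j = (∑ j, c j * a j) + c i * (2 * π) := by
      simp [mul_add, Finset.sum_add_distrib]
    have h3 : c i * (2 * π) = q (0 + EuclideanSpace.single i (2 * π)) - q 0 :=
      div_mul_cancel₀ _ hpi
    simp only [hp]
    rw [h2, h3, ← h1]
    ring
  have hpd : ∀ a, HasFDerivAt p (forceForm d b t a -
      ∑ i, c i • (EuclideanSpace.proj i : E3 →L[ℝ] ℝ)) a := fun a =>
    (hq a).sub (HasFDerivAt.fun_sum fun i _ =>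
      ((EuclideanSpace.proj i : E3 →L[ℝ] ℝ).hasFDerivAt).const_mul (c i))
  have hp1 : ContDiff ℝ 1 p := by
    rw [contDiff_one_iff_fderiv]
    refine ⟨fun a => (hpd a).differentiableAt, ?_⟩
    rw [funext fun a => (hpd a).fderiv]
    exact (h.contDiff_forceForm ht).continuous.sub continuous_const
  have hpj : ∀ j a, partialD j p a = forceForm d b t a (EuclideanSpace.single j 1) - c j := by
    intro j a
    rw [partialD, (hpd a).fderiv]
    simp
  have hcl : ∀ l, c l = 0 := by
    intro l
    have h1 := h.mean_acc t ht l
    have h2 : ∀ a, b (t, a) l = ∑ j, partialD j p a *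
        gradCross (position d t (l + 1)) (position d t (l + 2)) j a +
        ∑ j, c j * gradCross (position d t (l + 1)) (position d t (l + 2)) j a := by
      intro a
      rw [h.acceleration_eq ht, ← Finset.sum_add_distrib]
      refine Finset.sum_congr rfl fun j _ => ?_
      rw [hpj]
      ring
    have hgc := fun j => contDiff_gradCross (h.contDiff_position ht (l + 1))
      (h.contDiff_position ht (l + 2)) j
    have i1 : IntegrableOn (fun a => ∑ j, partialD j p a *
        gradCross (position d t (l + 1)) (position d t (l + 2)) j a) cell :=
      integrableOn_cell (continuous_finsetSum _ fun j _ =>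
        (continuous_partialD hp1 j).mul (hgc j).continuous)
    have i2 : ∀ j, IntegrableOn (fun a => c j *
        gradCross (position d t (l + 1)) (position d t (l + 2)) j a) cell := fun j =>
      (integrableOn_cell (hgc j).continuous).const_mul _
    have i3 : IntegrableOn (fun a => ∑ j, c j *
        gradCross (position d t (l + 1)) (position d t (l + 2)) j a) cell :=
      integrable_finsetSum _ fun j _ => i2 j
    simp only [h2] at h1
    rw [integral_add i1 i3, integral_grad_gradCross hp1 (h.contDiff_position ht _)
      (h.contDiff_position ht _) hpp (h.periodic_partialD_position ht _)
      (h.periodic_partialD_position ht _), zero_add, integral_finsetSum _ fun j _ => i2 j] at h1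
    simp only [integral_const_mul, h.integral_gradCross_position ht] at h1
    simpa [hpi, Real.pi_ne_zero] using h1
  refine ⟨q, ?_, hq⟩
  have : p = q := by
    funext a
    simp [hp, hcl]
  exact this ▸ hpp

end IsEulerFlow

/-- The pressure of the flow with displacement `d` and acceleration `b`. -/
def eulerPressure (d b : ℝ × E3 → E3) (t : ℝ) (y : E3) : ℝ :=
  -(Classical.epsilon fun q : E3 → ℝ => IsPeriodic q ∧ ∀ a, HasFDerivAt q (forceForm d b t a) a)
    (label d (t, y))

namespace IsEulerFlow

variable (h : IsEulerFlow R κ d u b)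

include h

/-- Composing `⟨b, dx⟩` with the differential of the inverse of `x` cancels `dx`. -/
theorem hasFDerivAt_eulerPressure {t : ℝ} (ht : t ∈ timeDisc R) (y : E3) :
    HasFDerivAt (eulerPressure d b t) (-innerSL ℝ (eulerian d b (t, y))) y := by
  have hq := (Classical.epsilon_spec (h.exists_periodic_potential ht)).2
  set q := Classical.epsilon fun q : E3 → ℝ =>
    IsPeriodic q ∧ ∀ a, HasFDerivAt q (forceForm d b t a) a with hqdef
  set a := label d (t, y) with ha
  have h1 : HasFDerivAt (fun y => label d (t, y)) (fderiv ℝ (fun y => label d (t, y)) y) y :=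
    (differentiableAt_space (h.contDiffAt_label (y := (t, y)) ht)).hasFDerivAt
  have h2 : HasFDerivAt (fun a => a + d (t, a))
      (ContinuousLinearMap.id ℝ E3 + fderiv ℝ (fun a => d (t, a)) a) a :=
    (hasFDerivAt_id a).add (differentiableAt_space (h.contDiffAt_disp (t, a) ht)).hasFDerivAt
  have h3 := HasFDerivAt.comp y (g := fun a => a + d (t, a)) h2 h1
  have h4 : (fun a => a + d (t, a)) ∘ (fun y => label d (t, y)) = id :=
    funext fun y => h.position_label ht y
  rw [h4] at h3
  have h5 := h3.unique (hasFDerivAt_id y)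
  have h6 := (HasFDerivAt.comp y (g := q) (hq a) h1).neg
  have h7 : (forceForm d b t a).comp (fderiv ℝ (fun y => label d (t, y)) y) =
      innerSL ℝ (eulerian d b (t, y)) := by
    rw [forceForm, ContinuousLinearMap.comp_assoc, h5, ContinuousLinearMap.comp_id]
    rfl
  rw [h7] at h6
  exact h6

theorem isEulerSolution {v₀ : E3 → E3} (hv : ∀ a, u (0, a) = v₀ a) (h0 : 0 < R) :
    IsEulerSolution v₀ R (fun t y => eulerian d u (t, y)) (eulerPressure d b) := by
  have hI : ∀ t ∈ timeInterval R, t ∈ timeDisc R := fun t ht => by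
    have := ht.2
    rwa [← abs_of_nonneg ht.1, ← Real.norm_eq_abs, ofReal_norm] at this
  have hm : (0 : ℝ) ∈ timeDisc R := by simpa [timeDisc] using h0
  refine ⟨?_, ?_, ?_, ?_, ?_, ?_, ?_⟩
  · rintro ⟨t, y⟩ ⟨ht, -⟩
    exact ((h.contDiffAt_eulerian h.contDiffAt_vel (y := (t, y)) (hI t ht)).of_le
      (by norm_num)).contDiffWithinAt
  · intro t ht
    rw [contDiff_one_iff_fderiv]
    refine ⟨fun y => (h.hasFDerivAt_eulerPressure (hI t ht) y).differentiableAt, ?_⟩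
    rw [funext fun y => (h.hasFDerivAt_eulerPressure (hI t ht) y).fderiv]
    refine ((innerSL ℝ).continuous.comp (continuous_iff_continuousAt.2 fun y => ?_)).neg
    exact (differentiableAt_space
      (h.contDiffAt_eulerian h.contDiffAt_acc (y := (t, y)) (hI t ht))).continuousAt
  · exact fun t ht => h.periodic_eulerian (hI t ht) (h.periodic_vel t)
  · intro t ht i y
    have hq := (Classical.epsilon_spec (h.exists_periodic_potential (hI t ht))).1
    rw [eulerPressure, eulerPressure, h.periodic_label (hI t ht), hq]
  · intro t ht y
    have h1 := (h.material_derivative (hI t ht) y).hasDerivWithinAt (s := timeInterval R)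
    refine h1.congr_deriv ?_
    rw [gradient, (h.hasFDerivAt_eulerPressure (hI t ht) y).fderiv, map_neg]
    have : (InnerProductSpace.toDual ℝ E3).symm (innerSL ℝ (eulerian d b (t, y))) =
        eulerian d b (t, y) := by
      rw [LinearIsometryEquiv.symm_apply_eq]
      rfl
    rw [this]
    abel
  · exact fun t ht y => h.divergence_eulerian (hI t ht) y
  · funext y
    have h1 := h.eulerian_position hm u y
    rw [h.initial, add_zero] at h1
    rw [h1, hv]

theorem isLagrangianMap : IsLagrangianMap R (fun t y => eulerian d u (t, y))
    (fun t a => a + d (t, a)) := by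
  refine ⟨fun a => by rw [h.initial, add_zero], fun a t ht => ?_⟩
  have hI : t ∈ timeDisc R := by
    have := ht.2
    rwa [← abs_of_nonneg ht.1, ← Real.norm_eq_abs, ofReal_norm] at this
  simp only [h.eulerian_position hI]
  exact ((h.deriv_disp t hI a).const_add a).hasDerivWithinAt

end IsEulerFlow

end

section

/-! ### Uniqueness of classical solutions -/

theorem isOpen_ofReal_lt (T : ℝ≥0∞) : IsOpen {t : ℝ | ENNReal.ofReal t < T} :=
  isOpen_lt ENNReal.continuous_ofReal continuous_const

theorem uniqueDiffOn_timeInterval (T : ℝ≥0∞) : UniqueDiffOn ℝ (timeInterval T) :=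
  (uniqueDiffOn_Ici 0).inter (isOpen_ofReal_lt T)

theorem timeInterval_mem_nhds {T : ℝ≥0∞} {t : ℝ} (ht : t ∈ timeInterval T) (h0 : 0 < t) :
    timeInterval T ∈ nhds t :=
  Filter.inter_mem (Ici_mem_nhds h0) ((isOpen_ofReal_lt T).mem_nhds ht.2)

theorem timeInterval_mem_nhdsGE {T : ℝ≥0∞} {t : ℝ} (ht : t ∈ timeInterval T) :
    timeInterval T ∈ nhdsWithin t (Ici t) :=
  Filter.inter_mem (Filter.mem_of_superset self_mem_nhdsWithin fun _ hs => ht.1.trans hs)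
    (nhdsWithin_le_nhds ((isOpen_ofReal_lt T).mem_nhds ht.2))

theorem Icc_subset_timeInterval {T : ℝ≥0∞} {t : ℝ} (ht : t ∈ timeInterval T) :
    Icc 0 t ⊆ timeInterval T := fun _ hs =>
  ⟨hs.1, (ENNReal.ofReal_le_ofReal hs.2).trans_lt ht.2⟩

theorem integral_fderiv_divergenceFree {f : E3 → E3} {g : E3 → ℝ} (hf : ContDiff ℝ 1 f)
    (hg : ContDiff ℝ 1 g) (pf : IsPeriodic f) (pg : IsPeriodic g) (hd : ∀ a, divergence f a = 0) :
    ∫ a in cell, fderiv ℝ g a (f a) = 0 := by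
  have hfl : ∀ l, ContDiff ℝ 1 fun a => f a l := fun l =>
    (EuclideanSpace.proj l : E3 →L[ℝ] ℝ).contDiff.comp hf
  have h1 : ∀ a, fderiv ℝ g a (f a) = ∑ j, partialD j (fun a => f a j * g a) a := fun a => by
    rw [fderiv_eq_sum_partialD]
    simp only [partialD_mul_real ((hfl _).differentiable (by simp) a)
      (hg.differentiable (by simp) a), Finset.sum_add_distrib, ← Finset.sum_mul,
      partialD_apply (hf.differentiable (by simp) a), smul_eq_mul]
    have := hd a
    rw [divergence] at this
    rw [this, zero_mul, zero_add]
  simp only [h1]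
  rw [integral_finsetSum _ fun j _ => integrableOn_cell (continuous_partialD ((hfl j).mul hg) j)]
  refine Finset.sum_eq_zero fun j _ => integral_cell_partialD ((hfl j).mul hg) (fun i a => ?_) j
  simp only [pf i a, pg i a]

theorem eq_zero_of_integral_norm_sq {f : E3 → E3} (hf : Continuous f) (pf : IsPeriodic f)
    (h : ∫ a in cell, ‖f a‖ ^ 2 = 0) (a : E3) : f a = 0 := by
  have hc : Continuous fun a => ‖f a‖ ^ 2 := by fun_prop
  have h1 := (setIntegral_eq_zero_iff_of_nonneg_ae (Filter.Eventually.of_forall fun a =>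
    sq_nonneg ‖f a‖) (integrableOn_cell hc)).1 h
  -- A continuous function vanishing almost everywhere on the cell vanishes on all of it, because
  -- the cell lies in the closure of its interior.
  have hint : cell ⊆ closure (interior cell) := by
    have hconv : Convex ℝ cell := by
      have : cell = ⋂ i : Fin 3, (EuclideanSpace.proj i : E3 →L[ℝ] ℝ) ⁻¹' Icc 0 (2 * π) := by
        ext a; simp [cell]
      rw [this]
      exact convex_iInter fun i => (convex_Icc _ _).linear_preimage _
    have hne : (interior cell).Nonempty := by
      refine ⟨WithLp.toLp 2 fun _ => π, mem_interior.2 ⟨⋂ i : Fin 3, (fun a : E3 => a i) ⁻¹'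
        Ioo 0 (2 * π), fun a ha i => ?_, isOpen_iInter_of_finite fun i =>
          isOpen_Ioo.preimage (by fun_prop), ?_⟩⟩
      · exact Ioo_subset_Icc_self (mem_iInter.1 ha i)
      · simp only [mem_iInter, mem_preimage, mem_Ioo]
        exact fun _ => ⟨Real.pi_pos, by linarith [Real.pi_pos]⟩
    rw [hconv.closure_interior_eq_closure_of_nonempty_interior hne]
    exact subset_closure
  have h2 := Measure.eqOn_of_ae_eq h1 hc.continuousOn continuousOn_const hint
  obtain ⟨a', ha', h3⟩ := exists_mem_cell a
  rw [← h3 f pf]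
  simpa using h2 ha'

namespace IsEulerSolution

variable {v₀ : E3 → E3} {T : ℝ≥0∞} {v : ℝ → E3 → E3} {p : ℝ → E3 → ℝ}
  (h : IsEulerSolution v₀ T v p)

include h

theorem hasFDerivAt_space {t : ℝ} (ht : t ∈ timeInterval T) (y : E3) :
    HasFDerivAt (v t) ((fderivWithin ℝ (fun y : ℝ × E3 => v y.1 y.2) (timeInterval T ×ˢ univ)
      (t, y)).comp (ContinuousLinearMap.inr ℝ ℝ E3)) y := by
  have h1 := ((h.velocity_C1 (t, y) ⟨ht, mem_univ y⟩).differentiableWithinAt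
    (by simp)).hasFDerivWithinAt
  have h2 := h1.comp (g := fun y : ℝ × E3 => v y.1 y.2) y
    ((hasFDerivAt_prodMk_right t y).hasFDerivWithinAt (s := univ)) fun z _ => ⟨ht, mem_univ _⟩
  exact hasFDerivWithinAt_univ.1 h2

theorem contDiff_space {t : ℝ} (ht : t ∈ timeInterval T) : ContDiff ℝ 1 (v t) := by
  rw [← contDiffOn_univ]
  exact h.velocity_C1.comp (contDiff_const.prodMk contDiff_id).contDiffOn fun y _ => ⟨ht, mem_univ y⟩

/-- Compactness of `[0, t₁]` times the cell, extended to all of space by periodicity. -/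
theorem exists_fderiv_bound {t₁ : ℝ} (ht₁ : t₁ ∈ timeInterval T) :
    ∃ K : ℝ, ∀ t ∈ Icc 0 t₁, ∀ y, ‖fderiv ℝ (v t) y‖ ≤ K := by
  have h1 : ContinuousOn (fderivWithin ℝ (fun y : ℝ × E3 => v y.1 y.2) (timeInterval T ×ˢ univ))
      (timeInterval T ×ˢ univ) :=
    h.velocity_C1.continuousOn_fderivWithin
      ((uniqueDiffOn_timeInterval T).prod uniqueDiffOn_univ) (by simp)
  have hsub := Icc_subset_timeInterval ht₁
  obtain ⟨K, hK⟩ := (isCompact_Icc.prod isCompact_cell).exists_bound_of_continuousOn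
    (h1.mono (prod_mono hsub (subset_univ cell)))
  refine ⟨K * ‖ContinuousLinearMap.inr ℝ ℝ E3‖, fun t ht y => ?_⟩
  obtain ⟨a, ha, h2⟩ := exists_mem_cell y
  rw [← h2 _ (h.velocity_periodic t (hsub ht)).fderiv, (h.hasFDerivAt_space (hsub ht) a).fderiv]
  exact (ContinuousLinearMap.opNorm_comp_le _ _).trans
    (mul_le_mul_of_nonneg_right (hK (t, a) ⟨ht, ha⟩) (norm_nonneg _))

theorem contDiffAt {t : ℝ} (ht : t ∈ timeInterval T) (h0 : 0 < t) (y : E3) :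
    ContDiffAt ℝ 1 (fun y : ℝ × E3 => v y.1 y.2) (t, y) :=
  h.velocity_C1.contDiffAt (prod_mem_nhds (timeInterval_mem_nhds ht h0) Filter.univ_mem)

theorem hasDerivAt {t : ℝ} (ht : t ∈ timeInterval T) (h0 : 0 < t) (y : E3) :
    HasDerivAt (fun τ => v τ y) (-(fderiv ℝ (v t) y (v t y)) - gradient (p t) y) t :=
  (h.momentum t ht y).hasDerivAt (timeInterval_mem_nhds ht h0)

/-- The pressure is not assumed continuous in time. The momentum equation identifies this expression
with `∂ₜv`, which is continuous because `v` is of class C¹ jointly. -/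
theorem continuousAt_force {t : ℝ} (ht : t ∈ timeInterval T) (h0 : 0 < t) (y : E3) :
    ContinuousAt (fun z : ℝ × E3 => -(fderiv ℝ (v z.1) z.2 (v z.1 z.2)) - gradient (p z.1) z.2)
      (t, y) := by
  have h1 : ContinuousAt (fun z => fderiv ℝ (fun y : ℝ × E3 => v y.1 y.2) z ((1, 0) : ℝ × E3))
      (t, y) :=
    ((h.contDiffAt ht h0 y).fderiv_right (m := 0) (by norm_num)).continuousAt.clm_apply
      continuousAt_const
  refine h1.congr ?_
  have h2 : {z : ℝ × E3 | z.1 ∈ timeInterval T ∧ 0 < z.1} ∈ nhds (t, y) :=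
    continuousAt_fst.preimage_mem_nhds (Filter.inter_mem (timeInterval_mem_nhds ht h0)
      (Ioi_mem_nhds h0))
  filter_upwards [h2] with z hz
  have h3 := ((h.contDiffAt hz.1 hz.2 z.2).differentiableAt (by simp)).hasFDerivAt
  have h4 : HasDerivAt (fun τ => ((τ, z.2) : ℝ × E3)) (1, 0) z.1 :=
    (hasDerivAt_id _).prodMk (hasDerivAt_const _ _)
  exact (HasFDerivAt.comp_hasDerivAt z.1 (l := fun y : ℝ × E3 => v y.1 y.2) h3 h4).unique
    (h.hasDerivAt hz.1 hz.2 z.2)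

variable {T' : ℝ≥0∞} {v' : ℝ → E3 → E3} {p' : ℝ → E3 → ℝ} (h' : IsEulerSolution v₀ T' v' p')

include h'

/-- The energy balance for the difference of two solutions. -/
theorem hasDerivAt_energy {t : ℝ} (ht : t ∈ timeInterval T) (ht' : t ∈ timeInterval T')
    (h0 : 0 < t) :
    HasDerivAt (fun t => ∫ y in cell, ‖v t y - v' t y‖ ^ 2)
      (∫ y in cell, -2 * inner ℝ (v t y - v' t y) (fderiv ℝ (v t) y (v t y - v' t y))) t := by
  set F : ℝ × E3 → E3 := fun z => -(fderiv ℝ (v z.1) z.2 (v z.1 z.2)) - gradient (p z.1) z.2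
  set F' : ℝ × E3 → E3 := fun z => -(fderiv ℝ (v' z.1) z.2 (v' z.1 z.2)) - gradient (p' z.1) z.2
  have hopen : {s | (s ∈ timeInterval T ∧ s ∈ timeInterval T') ∧ 0 < s} ∈ nhds t :=
    Filter.inter_mem (Filter.inter_mem (timeInterval_mem_nhds ht h0)
      (timeInterval_mem_nhds ht' h0)) (Ioi_mem_nhds h0)
  obtain ⟨ε, hε, hball⟩ := Metric.nhds_basis_closedBall.mem_iff.1 hopen
  set G : ℝ × E3 → ℝ := fun z => 2 * inner ℝ (v z.1 z.2 - v' z.1 z.2) (F z - F' z) with hG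
  have hGc : ∀ z : ℝ × E3, z.1 ∈ Metric.closedBall t ε → ContinuousAt G z := fun z hz => by
    obtain ⟨⟨hz1, hz2⟩, hz3⟩ := hball hz
    exact (((h.contDiffAt hz1 hz3 z.2).continuousAt.sub
      (h'.contDiffAt hz2 hz3 z.2).continuousAt).inner
      ((h.continuousAt_force hz1 hz3 z.2).sub (h'.continuousAt_force hz2 hz3 z.2))).const_mul 2
  obtain ⟨C, hC⟩ := ((isCompact_closedBall t ε).prod isCompact_cell).exists_bound_of_continuousOn
    (f := G) fun z hz => (hGc z hz.1).continuousWithinAt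
  have hcd : ∀ s ∈ Metric.closedBall t ε, ContDiff ℝ 1 fun y => v s y - v' s y := fun s hs =>
    (h.contDiff_space (hball hs).1.1).sub (h'.contDiff_space (hball hs).1.2)
  have htb : t ∈ Metric.closedBall t ε := Metric.mem_closedBall_self hε.le
  have hGt : Continuous fun y => G (t, y) := continuous_iff_continuousAt.2 fun y =>
    ContinuousAt.comp (g := G) (hGc (t, y) htb) (by fun_prop)
  have key := hasDerivAt_integral_of_dominated_loc_of_deriv_le (μ := volume.restrict cell)
    (F := fun s y => ‖v s y - v' s y‖ ^ 2) (F' := fun s y => G (s, y)) (bound := fun _ => C)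
    (s := Metric.ball t ε) (x₀ := t) (Metric.ball_mem_nhds t hε)
    (Filter.eventually_of_mem (Metric.closedBall_mem_nhds t hε) fun s hs =>
      ((hcd s hs).continuous.norm.pow 2).aestronglyMeasurable)
    (integrableOn_cell ((hcd t htb).continuous.norm.pow 2)) hGt.aestronglyMeasurable
    ((ae_restrict_iff' measurableSet_cell).2 (Filter.Eventually.of_forall fun y hy s hs =>
      hC (s, y) ⟨Metric.ball_subset_closedBall hs, hy⟩))
    (integrableOn_cell continuous_const)
    (Filter.Eventually.of_forall fun y s hs => by
      obtain ⟨⟨hz1, hz2⟩, hz3⟩ := hball (Metric.ball_subset_closedBall hs)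
      exact ((h.hasDerivAt hz1 hz3 y).sub (h'.hasDerivAt hz2 hz3 y)).norm_sq)
  refine key.2.congr_deriv ?_
  have hv := h.contDiff_space ht
  have hv' := h'.contDiff_space ht'
  have hδ := hcd t htb
  have hpv := h.velocity_periodic t ht
  have hpv' := h'.velocity_periodic t ht'
  have hpδ : IsPeriodic fun y => v t y - v' t y := fun i y => by simp only [hpv i y, hpv' i y]
  have hdδ : ∀ y, divergence (fun y => v t y - v' t y) y = 0 := fun y => by
    have h1 := h.incompressible t ht y
    have h2 := h'.incompressible t ht' y
    rw [divergence] at h1 h2 ⊢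
    have h3 : ∀ i, partialD i (fun y => v t y - v' t y) y i =
        partialD i (v t) y i - partialD i (v' t) y i := fun i => by
      rw [partialD, fderiv_fun_sub (hv.differentiable (by simp) y) (hv'.differentiable (by simp) y)]
      rfl
    simp only [h3, Finset.sum_sub_distrib, h1, h2, sub_zero]
  have hπ : ContDiff ℝ 1 fun y => p t y - p' t y := (h.pressure_C1 t ht).sub (h'.pressure_C1 t ht')
  have hpπ : IsPeriodic fun y => p t y - p' t y := fun i y => by
    simp only [h.pressure_periodic t ht i y, h'.pressure_periodic t ht' i y]
  have hsq : ContDiff ℝ 1 fun y => ‖v t y - v' t y‖ ^ 2 := hδ.norm_sq ℝ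
  have hpsq : IsPeriodic fun y => ‖v t y - v' t y‖ ^ 2 := fun i y => by simp only [hpv i y, hpv' i y]
  have z1 := integral_fderiv_divergenceFree hδ hπ hpδ hpπ hdδ
  have z2 := integral_fderiv_divergenceFree hv' hsq hpv' hpsq (h'.incompressible t ht')
  have c1 : Continuous fun y => fderiv ℝ (fun y => p t y - p' t y) y (v t y - v' t y) :=
    (hπ.continuous_fderiv one_ne_zero).clm_apply hδ.continuous
  have c2 : Continuous fun y => fderiv ℝ (fun y => ‖v t y - v' t y‖ ^ 2) y (v' t y) :=
    (hsq.continuous_fderiv one_ne_zero).clm_apply hv'.continuous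
  -- With `δ = v - v'`, the convective terms differ by `(δ·∇)v + (v'·∇)δ`. Paired with `2δ`, the
  -- second one is `v'·∇|δ|²`; it integrates to zero, as does the pressure term, since `v'` and `δ`
  -- are divergence-free.
  have hG2 : ∀ y, G (t, y) =
      -2 * inner ℝ (v t y - v' t y) (fderiv ℝ (v t) y (v t y - v' t y)) -
      (fderiv ℝ (fun y => ‖v t y - v' t y‖ ^ 2) y (v' t y) +
        2 * fderiv ℝ (fun y => p t y - p' t y) y (v t y - v' t y)) := by
    intro y
    have d1 := hv.differentiable (by simp) y
    have d2 := hv'.differentiable (by simp) y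
    have e1 := (d1.hasFDerivAt.sub d2.hasFDerivAt).norm_sq.fderiv
    have e2 := fderiv_fun_sub ((h.pressure_C1 t ht).differentiable (by simp) y)
      ((h'.pressure_C1 t ht').differentiable (by simp) y)
    have e3 : ∀ w, inner ℝ w (gradient (p t) y) = fderiv ℝ (p t) y w := fun w => by
      rw [real_inner_comm, gradient, InnerProductSpace.toDual_symm_apply]
    have e4 : ∀ w, inner ℝ w (gradient (p' t) y) = fderiv ℝ (p' t) y w := fun w => by
      rw [real_inner_comm, gradient, InnerProductSpace.toDual_symm_apply]
    have e5 : fderiv ℝ (fun y => ‖v t y - v' t y‖ ^ 2) y = _ := e1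
    rw [e5, e2]
    simp only [hG, F, F', inner_sub_right, inner_neg_right, e3, e4, map_sub]
    simp [inner_sub_left]
    ring
  have c3 : Continuous fun y => -2 * inner ℝ (v t y - v' t y) (fderiv ℝ (v t) y (v t y - v' t y)) :=
    (hδ.continuous.inner
      ((hv.continuous_fderiv one_ne_zero).clm_apply hδ.continuous)).const_mul _
  have c4 : Continuous fun y => fderiv ℝ (fun y => ‖v t y - v' t y‖ ^ 2) y (v' t y) +
      2 * fderiv ℝ (fun y => p t y - p' t y) y (v t y - v' t y) := c2.add (c1.const_mul 2)
  simp only [hG2]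
  rw [integral_sub (integrableOn_cell c3) (integrableOn_cell c4),
    integral_add (integrableOn_cell c2) (integrableOn_cell (c1.const_mul 2)), z2]
  simp only [integral_const_mul]
  rw [z1]
  simp

end IsEulerSolution

end

/-! ### Uniqueness by Gronwall's inequality, for velocities and for trajectories -/

section

variable {v₀ : E3 → E3} {T T' : ℝ≥0∞} {v v' : ℝ → E3 → E3} {p p' : ℝ → E3 → ℝ}

theorem IsEulerSolution.continuousWithinAt_energy (h : IsEulerSolution v₀ T v p)
    (h' : IsEulerSolution v₀ T' v' p') {t₁ : ℝ} (ht : t₁ ∈ timeInterval T)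
    (ht' : t₁ ∈ timeInterval T') :
    ContinuousOn (fun t => ∫ y in cell, ‖v t y - v' t y‖ ^ 2) (Icc 0 t₁) := by
  have hs := Icc_subset_timeInterval ht
  have hs' := Icc_subset_timeInterval ht'
  have hc : ContinuousOn (fun z : ℝ × E3 => ‖v z.1 z.2 - v' z.1 z.2‖ ^ 2) (Icc 0 t₁ ×ˢ univ) :=
    ((h.velocity_C1.continuousOn.mono (prod_mono hs subset_rfl)).sub
      (h'.velocity_C1.continuousOn.mono (prod_mono hs' subset_rfl))).norm.pow 2
  obtain ⟨C, hC⟩ := (isCompact_Icc.prod isCompact_cell).exists_bound_of_continuousOn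
    (hc.mono (prod_mono subset_rfl (subset_univ cell)))
  intro t ht
  refine continuousWithinAt_of_dominated (bound := fun _ => C) ?_ ?_
    (integrableOn_cell continuous_const) ?_
  · filter_upwards [self_mem_nhdsWithin] with s hs1
    exact (((h.contDiff_space (hs hs1)).continuous.sub
      (h'.contDiff_space (hs' hs1)).continuous).norm.pow 2).aestronglyMeasurable
  · filter_upwards [self_mem_nhdsWithin] with s hs1
    exact (ae_restrict_iff' measurableSet_cell).2 (Filter.Eventually.of_forall fun y hy =>
      hC (s, y) ⟨hs1, hy⟩)
  · exact Filter.Eventually.of_forall fun y =>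
      ContinuousWithinAt.comp (t := Icc 0 t₁ ×ˢ univ) (f := fun s => ((s, y) : ℝ × E3))
        (hc (t, y) ⟨ht, mem_univ y⟩) (by fun_prop) fun s hs => ⟨hs, mem_univ y⟩

/-- Classical periodic solutions of the Euler equations are unique. -/
theorem IsEulerSolution.unique (h : IsEulerSolution v₀ T v p) (h' : IsEulerSolution v₀ T' v' p')
    {t : ℝ} (ht : t ∈ timeInterval T) (ht' : t ∈ timeInterval T') : v t = v' t := by
  rcases ht.1.eq_or_lt with rfl | h0
  · rw [h.initial, h'.initial]
  have hs := Icc_subset_timeInterval ht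
  have hs' := Icc_subset_timeInterval ht'
  set E : ℝ → ℝ := fun t => ∫ y in cell, ‖v t y - v' t y‖ ^ 2 with hE
  have hE0 : E 0 = 0 := by simp [hE, h.initial, h'.initial]
  have hEnn : ∀ s, 0 ≤ E s := fun s => integral_nonneg fun y => sq_nonneg _
  have hEc := h.continuousWithinAt_energy h' ht ht'
  obtain ⟨K, hK⟩ := h.exists_fderiv_bound ht
  have hbound : ∀ s ∈ Ioc 0 t, ‖∫ y in cell, -2 * inner ℝ (v s y - v' s y)
      (fderiv ℝ (v s) y (v s y - v' s y))‖ ≤ 2 * K * ‖E s‖ + 0 := by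
    intro s hs1
    have hs2 : s ∈ Icc 0 t := ⟨hs1.1.le, hs1.2⟩
    have hv := h.contDiff_space (hs hs2)
    have hδ := hv.sub (h'.contDiff_space (hs' hs2))
    rw [add_zero, Real.norm_of_nonneg (hEnn s), hE, ← integral_const_mul]
    refine norm_integral_le_of_norm_le
      (integrableOn_cell ((hδ.continuous.norm.pow 2).const_mul _))
      (Filter.Eventually.of_forall fun y => ?_)
    rw [norm_mul, norm_neg, Real.norm_ofNat, mul_assoc]
    refine mul_le_mul_of_nonneg_left ?_ zero_le_two
    refine (norm_inner_le_norm _ _).trans ?_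
    have h1 := (ContinuousLinearMap.le_opNorm (fderiv ℝ (v s) y) (v s y - v' s y)).trans
      (mul_le_mul_of_nonneg_right (hK s hs2 y) (norm_nonneg _))
    calc ‖v s y - v' s y‖ * ‖fderiv ℝ (v s) y (v s y - v' s y)‖
        ≤ ‖v s y - v' s y‖ * (K * ‖v s y - v' s y‖) := by gcongr
      _ = _ := by ring
  -- The energy is known to be differentiable only at positive times, so Gronwall's inequality
  -- starts at `ε > 0`; then `ε → 0` by continuity of the energy.
  have hgr : ∀ ε ∈ Ioo 0 t, E t ≤ E ε * Real.exp (2 * K * (t - ε)) := by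
    intro ε hε
    have h1 := norm_le_gronwallBound_of_norm_deriv_right_le (f := E) (δ := E ε) (K := 2 * K) (ε := 0)
      (a := ε) (b := t) (hEc.mono (Icc_subset_Icc_left hε.1.le))
      (fun s hs1 => (h.hasDerivAt_energy h' (hs ⟨hε.1.le.trans hs1.1, hs1.2.le⟩)
        (hs' ⟨hε.1.le.trans hs1.1, hs1.2.le⟩) (hε.1.trans_le hs1.1)).hasDerivWithinAt)
      (le_of_eq (Real.norm_of_nonneg (hEnn ε)))
      (fun s hs1 => hbound s ⟨hε.1.trans_le hs1.1, hs1.2.le⟩) t (right_mem_Icc.2 hε.2.le)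
    rwa [gronwallBound_ε0, Real.norm_of_nonneg (hEnn t)] at h1
  have hEt : E t = 0 := by
    refine le_antisymm ?_ (hEnn t)
    have h1 : Filter.Tendsto (fun ε => E ε * Real.exp (2 * K * (t - ε)))
        (nhdsWithin 0 (Ioo 0 t)) (nhds (E 0 * Real.exp (2 * K * (t - 0)))) :=
      ((hEc 0 (left_mem_Icc.2 h0.le)).mono Ioo_subset_Icc_self).mul
        (Continuous.continuousWithinAt (f := fun ε => Real.exp (2 * K * (t - ε))) (by fun_prop))
    rw [hE0, zero_mul] at h1
    have h2 : (nhdsWithin (0 : ℝ) (Ioo 0 t)).NeBot := left_nhdsWithin_Ioo_neBot h0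
    exact ge_of_tendsto h1 (by filter_upwards [self_mem_nhdsWithin] with ε hε using hgr ε hε)
  funext y
  exact sub_eq_zero.1 (eq_zero_of_integral_norm_sq
    ((h.contDiff_space ht).continuous.sub (h'.contDiff_space ht').continuous)
    (fun i y => congrArg₂ (· - ·) (h.velocity_periodic t ht i y) (h'.velocity_periodic t ht' i y))
    hEt y)

/-- The Lagrangian maps of two classical solutions agree. -/
theorem IsLagrangianMap.unique {x x' : ℝ → E3 → E3} (h : IsEulerSolution v₀ T v p)
    (h' : IsEulerSolution v₀ T' v' p') (hx : IsLagrangianMap T v x) (hx' : IsLagrangianMap T' v' x')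
    {t : ℝ} (ht : t ∈ timeInterval T) (ht' : t ∈ timeInterval T') (a : E3) : x t a = x' t a := by
  have hs := Icc_subset_timeInterval ht
  have hs' := Icc_subset_timeInterval ht'
  obtain ⟨K, hK⟩ := h.exists_fderiv_bound ht
  have hLip : ∀ s ∈ Ico 0 t, LipschitzOnWith K.toNNReal (v s) univ := fun s hs1 => by
    rw [lipschitzOnWith_univ]
    refine lipschitzWith_of_nnnorm_fderiv_le
      ((h.contDiff_space (hs (Ico_subset_Icc_self hs1))).differentiable (by simp)) fun y => ?_
    rw [← NNReal.coe_le_coe, coe_nnnorm]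
    exact (hK s (Ico_subset_Icc_self hs1) y).trans (Real.le_coe_toNNReal K)
  have hc : ContinuousOn (fun s => x s a) (Icc 0 t) := fun s hs1 =>
    ((hx.trajectory a s (hs hs1)).continuousWithinAt).mono hs
  have hc' : ContinuousOn (fun s => x' s a) (Icc 0 t) := fun s hs1 =>
    ((hx'.trajectory a s (hs' hs1)).continuousWithinAt).mono hs'
  refine ODE_solution_unique_of_mem_Icc_right (v := v) (s := fun _ => univ) hLip hc
    (fun s hs1 => ?_) (fun s _ => mem_univ _) hc' (fun s hs1 => ?_) (fun s _ => mem_univ _)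
    ?_ (right_mem_Icc.2 ht.1)
  · have hs2 := Ico_subset_Icc_self hs1
    exact (hx.trajectory a s (hs hs2)).mono_of_mem_nhdsWithin (timeInterval_mem_nhdsGE (hs hs2))
  · have hs2 := Ico_subset_Icc_self hs1
    rw [h.unique h' (hs hs2) (hs' hs2)]
    exact (hx'.trajectory a s (hs' hs2)).mono_of_mem_nhdsWithin (timeInterval_mem_nhdsGE (hs' hs2))
  · rw [hx.initial, hx'.initial]

end

section

/-! ### Fourier coefficients of the initial velocity -/

theorem fourierCoef_neg_wave (f : E3 → ℝ) (p : Fin 3 → ℤ) :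
    fourierCoef f (-p) = (starRingEnd ℂ) (fourierCoef f p) := by
  rw [fourierCoef, fourierCoef, map_mul, ← integral_conj]
  congr 1
  · simp [map_ofNat, Complex.conj_ofReal]
  · refine integral_congr_ae (Filter.Eventually.of_forall fun a => ?_)
    simp [← Complex.exp_conj]

theorem fourierCoefVec_neg_wave (f : E3 → E3) (p : Fin 3 → ℤ) :
    fourierCoefVec f (-p) = conjC3 (fourierCoefVec f p) := by
  ext j
  exact fourierCoef_neg_wave _ p

theorem integrable_fourier {f : E3 → ℝ} (hf : Continuous f) (p : Fin 3 → ℤ) :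
    IntegrableOn (fun a : E3 => (f a : ℂ) *
      Complex.exp (-Complex.I * ∑ i, (p i : ℂ) * (a i : ℂ))) cell := by
  refine integrableOn_cell (((Complex.continuous_ofReal.comp hf)).mul ?_)
  fun_prop

theorem fourierCoef_sub {f g : E3 → ℝ} (hf : Continuous f) (hg : Continuous g) (p : Fin 3 → ℤ) :
    fourierCoef (fun a => f a - g a) p = fourierCoef f p - fourierCoef g p := by
  simp only [fourierCoef, Complex.ofReal_sub, sub_mul]
  rw [integral_sub (integrable_fourier hf p) (integrable_fourier hg p), mul_sub]

theorem fourierCoef_sum {f : Fin 3 → E3 → ℝ} (hf : ∀ j, Continuous (f j)) (p : Fin 3 → ℤ) :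
    fourierCoef (fun a => ∑ j, f j a) p = ∑ j, fourierCoef (f j) p := by
  simp only [fourierCoef, Complex.ofReal_sum, Finset.sum_mul]
  rw [integral_finsetSum _ fun j _ => integrable_fourier (hf j) p, Finset.mul_sum]

theorem fourierCoef_partialD_apply {f : E3 → E3} (hf : ContDiff ℝ 1 f) (pf : IsPeriodic f)
    (j l : Fin 3) (p : Fin 3 → ℤ) :
    fourierCoef (fun a => partialD j f a l) p = Complex.I * p j * fourierCoefVec f p l := by
  have h1 : ContDiff ℝ 1 fun a => f a l := (EuclideanSpace.proj l : E3 →L[ℝ] ℝ).contDiff.comp hf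
  have h2 := fourierCoef_partialD h1 (pf.comp fun w => w l) j p
  rw [← show partialD j (fun a => f a l) = fun a => partialD j f a l from
    funext fun a => partialD_apply (hf.differentiable (by simp) a) j l, h2]
  rfl

theorem continuous_partialD_apply {f : E3 → E3} (hf : ContDiff ℝ 1 f) (j l : Fin 3) :
    Continuous fun a => partialD j f a l :=
  (EuclideanSpace.proj l : E3 →L[ℝ] ℝ).continuous.comp (continuous_partialD hf j)

theorem gradGevreyNorm_eq {f : E3 → E3} (hf : ContDiff ℝ 1 f) (pf : IsPeriodic f) (σ : ℝ) :
    gradGevreyNorm σ f = gradNorm σ (fourierCoefVec f) := by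
  simp only [gradGevreyNorm, gradNorm, gevreyNorm, fourierCoef_partialD_apply hf pf]
  refine iSup_congr fun i => iSup_congr fun j => tsum_congr fun p => ?_
  rw [mul_assoc, ← ofReal_norm, norm_mul, Complex.norm_I, one_mul, ofReal_norm]

theorem dot_wave_fourierCoefVec {f : E3 → E3} (hf : ContDiff ℝ 1 f) (pf : IsPeriodic f)
    (hd : ∀ a, divergence f a = 0) (p : Fin 3 → ℤ) : dot (wave p) (fourierCoefVec f p) = 0 := by
  have h1 := fourierCoef_sum (fun j => continuous_partialD_apply hf j j) p
  have h2 : (fun a => ∑ j, partialD j f a j) = fun _ => 0 := funext hd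
  simp only [h2, fourierCoef_partialD_apply hf pf] at h1
  have h3 : Complex.I * dot (wave p) (fourierCoefVec f p) = 0 := by
    rw [dot, Finset.mul_sum]
    simp only [wave_apply, ← mul_assoc]
    rw [← h1]
    simp [fourierCoef]
  exact (mul_eq_zero.1 h3).resolve_left Complex.I_ne_zero

theorem fourierCoefVec_curl {f : E3 → E3} (hf : ContDiff ℝ 1 f) (pf : IsPeriodic f)
    (p : Fin 3 → ℤ) :
    fourierCoefVec (curl f) p = Complex.I • cross (wave p) (fourierCoefVec f p) := by
  have h1 : ∀ j a, curl f a j = partialD (j + 1) f a (j + 2) - partialD (j + 2) f a (j + 1) := by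
    intro j a
    fin_cases j <;> simp [curl]
  ext j
  rw [show fourierCoefVec (curl f) p j = fourierCoef (fun a => curl f a j) p from rfl]
  simp only [h1]
  rw [fourierCoef_sub (continuous_partialD_apply hf _ _) (continuous_partialD_apply hf _ _),
    fourierCoef_partialD_apply hf pf, fourierCoef_partialD_apply hf pf, PiLp.smul_apply,
    cross_apply, wave_apply, wave_apply, smul_eq_mul]
  ring

/-- Equality in the bound for cross products, by Lagrange's identity for orthogonal vectors. It
gives `|ω̂ₚ| = |p| |v̂ₚ|` for a divergence-free velocity. -/
theorem norm_cross_wave {p : Fin 3 → ℤ} {u : C3} (h : dot (wave p) u = 0) :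
    ‖cross (wave p) u‖ = waveLength p * ‖u‖ := by
  rw [← norm_wave]
  refine (sq_eq_sq₀ (norm_nonneg _) (by positivity)).1 ?_
  rw [mul_pow, norm_sq_C3, norm_sq_C3, norm_sq_C3]
  have h2 : Complex.normSq (dot (wave p) u) =
      (Complex.normSq (wave p 0) + Complex.normSq (wave p 1) + Complex.normSq (wave p 2)) *
        (Complex.normSq (u 0) + Complex.normSq (u 1) + Complex.normSq (u 2)) -
      (Complex.normSq (cross (wave p) u 0) + Complex.normSq (cross (wave p) u 1) +
        Complex.normSq (cross (wave p) u 2)) := by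
    simp only [cross_apply, Complex.normSq_apply, dot, Fin.sum_univ_three, wave_apply]
    simp
    ring
  rw [h, map_zero] at h2
  linarith

theorem vorticityGevrey_eq {v₀ : E3 → E3} (hf : ContDiff ℝ 1 v₀) (pf : IsPeriodic v₀)
    (hd : ∀ a, divergence v₀ a = 0) (σ : ℝ) :
    vorticityGevrey v₀ σ = waveGevrey (fourierCoefVec v₀) σ := by
  refine tsum_congr fun p => ?_
  rw [fourierCoefVec_curl hf pf, ← ofReal_norm, norm_smul, Complex.norm_I, one_mul,
    norm_cross_wave (dot_wave_fourierCoefVec hf pf hd p), ENNReal.ofReal_mul (waveLength_nonneg _),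
    ofReal_norm]

/-! ### Finiteness and continuity of the Gevrey norm -/

theorem exists_waveGevrey_lt_top {v₀ : E3 → E3} (hv : AnalyticOnNhd ℝ v₀ univ)
    (pv : IsPeriodic v₀) : ∃ σ, 0 < σ ∧ waveGevrey (fourierCoefVec v₀) σ < ∞ := by
  have h1 : ∀ j, ∃ C δ : ℝ, 0 ≤ C ∧ 0 < δ ∧ ∀ p, ‖fourierCoefVec v₀ p j‖ ≤
      C * Real.exp (-δ * waveLength p) := fun j =>
    exists_fourierCoef_decay (fun a ha =>
      ((EuclideanSpace.proj j : E3 →L[ℝ] ℝ).analyticAt _).comp (hv a ha)) (pv.comp fun w => w j)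
  choose C δ hC hδ h2 using h1
  obtain ⟨ε, hε, hεδ⟩ : ∃ ε, 0 < ε ∧ ∀ j, ε ≤ δ j := by
    refine ⟨min (δ 0) (min (δ 1) (δ 2)), lt_min (hδ 0) (lt_min (hδ 1) (hδ 2)), fun j => ?_⟩
    fin_cases j <;> simp
  have h3 : ∀ p, ‖fourierCoefVec v₀ p‖ ≤ (∑ j, C j) * Real.exp (-ε * waveLength p) := fun p => by
    have hw := waveLength_nonneg p
    have h4 : ‖fourierCoefVec v₀ p‖ ≤ ∑ j, ‖fourierCoefVec v₀ p j‖ := by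
      rw [EuclideanSpace.norm_eq]
      refine Real.sqrt_le_iff.2 ⟨Finset.sum_nonneg fun _ _ => norm_nonneg _, ?_⟩
      exact Finset.sum_sq_le_sq_sum_of_nonneg fun _ _ => norm_nonneg _
    rw [Finset.sum_mul]
    refine h4.trans (Finset.sum_le_sum fun j _ => (h2 j p).trans ?_)
    have := hεδ j
    have := hC j
    gcongr
  -- The decay rate is split in three: for the weight, for the factor `|p|`, and for summability.
  have hε3 : 0 < ε / 3 := by positivity
  refine ⟨ε / 3, hε3, ?_⟩
  have hCs : 0 ≤ ∑ j, C j := Finset.sum_nonneg fun j _ => hC j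
  have h4 : ∀ p : Fin 3 → ℤ, ENNReal.ofReal (Real.exp (ε / 3 * waveLength p)) *
      (ENNReal.ofReal (waveLength p) * ‖fourierCoefVec v₀ p‖ₑ) ≤
      ENNReal.ofReal ((∑ j, C j) * (ε / 3)⁻¹ * Real.exp (-(ε / 3) * waveLength p)) := fun p => by
    have hw := waveLength_nonneg p
    rw [← ofReal_norm, ← ENNReal.ofReal_mul hw, ← ENNReal.ofReal_mul (Real.exp_pos _).le]
    refine ENNReal.ofReal_le_ofReal ?_
    have h5 : waveLength p ≤ (ε / 3)⁻¹ * Real.exp (ε / 3 * waveLength p) := by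
      rw [← div_eq_inv_mul, le_div_iff₀ hε3, mul_comm]
      exact (le_add_of_nonneg_right zero_le_one).trans (Real.add_one_le_exp _)
    calc Real.exp (ε / 3 * waveLength p) * (waveLength p * ‖fourierCoefVec v₀ p‖)
        ≤ Real.exp (ε / 3 * waveLength p) * (((ε / 3)⁻¹ * Real.exp (ε / 3 * waveLength p)) *
          ((∑ j, C j) * Real.exp (-ε * waveLength p))) := by
          gcongr
          exact h3 p
      _ = (∑ j, C j) * (ε / 3)⁻¹ * (Real.exp (ε / 3 * waveLength p) *
          Real.exp (ε / 3 * waveLength p) * Real.exp (-ε * waveLength p)) := by ring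
      _ = _ := by
          rw [← Real.exp_add, ← Real.exp_add]
          ring_nf
  refine (ENNReal.tsum_le_tsum h4).trans_lt (lt_top_iff_ne_top.2 ?_)
  exact ((summable_exp_neg_waveLength hε3).mul_left _).tsum_ofReal_ne_top

variable (v : (Fin 3 → ℤ) → C3)

theorem waveGevrey_mono {σ σ' : ℝ} (h : σ ≤ σ') : waveGevrey v σ ≤ waveGevrey v σ' := by
  refine ENNReal.tsum_le_tsum fun p => ?_
  have := waveLength_nonneg p
  gcongr

/-- Convexity of the exponential between `0` and `σ|p|`, with the factor `1 - θ` bounded by one. -/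
theorem waveGevrey_convex {σ θ : ℝ} (h0 : 0 ≤ θ) (h1 : θ ≤ 1) :
    waveGevrey v (θ * σ) ≤ waveGevrey v 0 + ENNReal.ofReal θ * waveGevrey v σ := by
  rw [waveGevrey, waveGevrey, waveGevrey, ← ENNReal.tsum_mul_left, ← ENNReal.tsum_add]
  refine ENNReal.tsum_le_tsum fun p => ?_
  rw [← mul_assoc (ENNReal.ofReal θ), ← add_mul, ← ENNReal.ofReal_mul h0,
    ← ENNReal.ofReal_add (by positivity) (by positivity)]
  gcongr
  have h2 := convexOn_exp.2 (mem_univ 0) (mem_univ (σ * waveLength p)) (sub_nonneg.2 h1) h0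
    (by ring)
  simp only [smul_eq_mul, mul_zero, zero_add, Real.exp_zero, mul_one] at h2
  rw [zero_mul, Real.exp_zero, mul_assoc]
  linarith

theorem exists_gevrey_index {σ t : ℝ} (hσ : 0 < σ) (ht : 0 ≤ t) (h : waveGevrey v σ < ∞)
    (htR : ENNReal.ofReal t < criticalT / waveGevrey v 0) :
    ∃ σ' > 0, ENNReal.ofReal t * waveGevrey v σ' ≤ criticalT := by
  have h0 : waveGevrey v 0 < ∞ := (waveGevrey_mono v hσ.le).trans_lt h
  set g0 := (waveGevrey v 0).toReal with hg0
  set g := (waveGevrey v σ).toReal with hg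
  have e0 : waveGevrey v 0 = ENNReal.ofReal g0 := (ENNReal.ofReal_toReal h0.ne).symm
  have e1 : waveGevrey v σ = ENNReal.ofReal g := (ENNReal.ofReal_toReal h.ne).symm
  have hg0n : 0 ≤ g0 := ENNReal.toReal_nonneg
  have hgn : 0 ≤ g := ENNReal.toReal_nonneg
  set τ : ℝ := (8 - 5 * √2) / 3 with hτ
  have hτ0 : 0 < τ := by
    have : √2 < 8 / 5 := by rw [Real.sqrt_lt' (by norm_num)]; norm_num
    rw [hτ]
    linarith
  have h1 : t * g0 < τ := by
    rcases hg0n.eq_or_lt with h2 | h2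
    · rw [← h2, mul_zero]; exact hτ0
    · rw [e0, criticalT, ← hτ, ← ENNReal.ofReal_div_of_pos h2,
        ENNReal.ofReal_lt_ofReal_iff (by positivity)] at htR
      exact (lt_div_iff₀ h2).1 htR
  -- Chosen so that `t(g0 + θg) ≤ τ`. The summand 1 keeps the denominator positive, and `θ ≤ 1` is
  -- needed for convexity.
  set θ := min 1 ((τ - t * g0) / (t * g + 1)) with hθ
  have hpos : 0 < t * g + 1 := by positivity
  have hθ0 : 0 < θ := lt_min one_pos (div_pos (sub_pos.2 h1) hpos)
  refine ⟨θ * σ, mul_pos hθ0 hσ, ?_⟩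
  refine (mul_le_mul_right (waveGevrey_convex v hθ0.le (min_le_left _ _)) _).trans ?_
  rw [e0, e1, criticalT, ← hτ, ← ENNReal.ofReal_mul hθ0.le, ← ENNReal.ofReal_add hg0n (by positivity),
    ← ENNReal.ofReal_mul ht]
  refine ENNReal.ofReal_le_ofReal ?_
  have h2 : θ * (t * g + 1) ≤ τ - t * g0 := (le_div_iff₀ hpos).1 (min_le_right _ _)
  nlinarith

/-- The generating function carries a factor `|p|`, at least one unless `p = 0`. Among the modes
with `p = 0` only that of order one can be nonzero, and a single term does no harm. -/
theorem converges_xi {σ t : ℝ} (ht : 0 ≤ t) (h : modeGenFun (xi v) σ t < ∞) :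
    Converges (xi v) σ t := by
  have h1 : ∀ i : Mode, weight σ t i * modeSize (xi v) i =
      ENNReal.ofReal (Real.exp (σ * waveLength i.2) * t ^ i.1 * (waveLength i.2 * ‖xi v i‖)) := by
    intro i
    rw [modeSize_eq, weight, ← ENNReal.ofReal_pow ht, ← ENNReal.ofReal_mul (Real.exp_pos _).le,
      ← ENNReal.ofReal_mul (by positivity)]
  have h2 := ENNReal.summable_toReal h.ne
  have h3 : Summable fun i : Mode =>
      Real.exp (σ * waveLength i.2) * t ^ i.1 * (waveLength i.2 * ‖xi v i‖) := by
    refine h2.congr fun i => ?_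
    have := waveLength_nonneg i.2
    rw [h1, ENNReal.toReal_ofReal (by positivity)]
  have h4 : Summable fun i : Mode => if i = (1, 0) then
      Real.exp (σ * waveLength i.2) * t ^ i.1 * ‖xi v i‖ else 0 :=
    summable_of_ne_finset_zero (s := {(1, 0)}) fun i hi => if_neg (by simpa using hi)
  refine (h3.add h4).of_nonneg_of_le (fun i => by positivity) fun i => ?_
  have hw := waveLength_nonneg i.2
  by_cases hi : i.2 = 0
  · by_cases h5 : i.1 = 1
    · rw [if_pos (Prod.ext h5 hi)]
      exact le_add_of_nonneg_left (by positivity)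
    · have h6 : xi v i = 0 := by
        rw [← Prod.mk.eta (p := i), hi]
        exact xi_mean_zero h5
      rw [h6]
      simp
  · have h5 : 1 ≤ waveLength i.2 := by
      obtain ⟨j, hj⟩ := Function.ne_iff.1 hi
      refine le_trans ?_ (abs_le_waveLength i.2 j)
      exact_mod_cast Int.one_le_abs hj
    refine le_trans ?_ (le_add_of_nonneg_right (by split_ifs <;> positivity))
    gcongr
    exact le_mul_of_one_le_left (norm_nonneg _) h5

theorem admissible_xi {σ : ℝ} (hσ : 0 < σ) (h : waveGevrey v σ < ∞) :
    Admissible (xi v) (criticalT / waveGevrey v 0) := by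
  intro r hr hR
  obtain ⟨σ', hσ', h1⟩ := exists_gevrey_index v hσ hr.le h hR
  exact ⟨σ', hσ', converges_xi v hr.le
    ((modeGenFun_xi_le_of_le v hσ'.le h1).trans_lt ENNReal.ofReal_lt_top)⟩

end

/-! ### Taylor coefficients of a Lagrangian map, and proof of the theorem -/

section

theorem continuous_realField {c : Mode → C3} {R : ℝ≥0∞} (hc : Admissible c R) {t : ℝ}
    (ht : t ∈ timeDisc R) : Continuous fun a => realField c (t, a) :=
  continuous_iff_continuousAt.2 fun a =>
    (hc.contDiffAt (y := (t, a)) ht (n := 0)).continuousAt.comp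
      (Continuous.prodMk_right t).continuousAt

theorem eq_of_fourierCoefVec_eq {f g : E3 → E3} (hf : Continuous f) (hg : Continuous g)
    (pf : IsPeriodic f) (pg : IsPeriodic g) (h : ∀ p, fourierCoefVec f p = fourierCoefVec g p)
    (hs : Summable fun p => ‖fourierCoefVec f p‖) (a : E3) : f a = g a := by
  ext j
  have h1 : ∀ w : E3 → E3, ∀ p, fourierCoefC (fun a => (w a j : ℂ)) p = fourierCoefVec w p j :=
    fun w p => (fourierCoef_eq _ p).symm
  have h2 : Summable fun p => ‖fourierCoefC (fun a => (f a j : ℂ)) p‖ := by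
    simp only [h1]
    exact hs.of_nonneg_of_le (fun _ => norm_nonneg _) fun p => norm_apply_le _ _
  have h3 : Summable fun p => ‖fourierCoefC (fun a => (g a j : ℂ)) p‖ := by
    simpa only [h1, h] using h2
  have c1 : ∀ w : E3 → E3, Continuous w → Continuous fun a => (w a j : ℂ) := fun w hw =>
    Complex.continuous_ofReal.comp ((EuclideanSpace.proj j : E3 →L[ℝ] ℝ).continuous.comp hw)
  have h4 := hasSum_fourierCoefC (c1 f hf) (pf.comp fun w => (w j : ℂ)) h2 a
  have h5 := hasSum_fourierCoefC (c1 g hg) (pg.comp fun w => (w j : ℂ)) h3 a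
  simp only [h1, h] at h4 h5
  exact_mod_cast h4.unique h5

theorem iterate_dTime_zero (c : Mode → C3) (s : ℕ) (p : Fin 3 → ℤ) :
    dTime^[s] c (0, p) = (s ! : ℂ) • c (s, p) := by
  induction s generalizing c with
  | zero => simp
  | succ s ih =>
    rw [Function.iterate_succ_apply, ih, dTime, smul_smul, Nat.factorial_succ]
    push_cast
    rw [mul_comm]

theorem Admissible.iterate_dTime {c : Mode → C3} {R : ℝ≥0∞} (hc : Admissible c R) (s : ℕ) :
    Admissible (PeriodicEuler.dTime^[s] c) R := by
  induction s with
  | zero => exact hc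
  | succ s ih => rw [Function.iterate_succ_apply']; exact ih.dTime

theorem IsHermitianMode.iterate_dTime {c : Mode → C3} (hc : IsHermitianMode c) (s : ℕ) :
    IsHermitianMode (PeriodicEuler.dTime^[s] c) := by
  induction s with
  | zero => exact hc
  | succ s ih => rw [Function.iterate_succ_apply']; exact ih.dTime

theorem Admissible.iteratedDeriv_realField {c : Mode → C3} {R : ℝ≥0∞} (hc : Admissible c R) (s : ℕ)
    {t : ℝ} (ht : t ∈ timeDisc R) (a : E3) :
    iteratedDeriv s (fun t => realField c (t, a)) t = realField (PeriodicEuler.dTime^[s] c) (t, a) := by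
  induction s generalizing t with
  | zero => simp
  | succ s ih =>
    rw [iteratedDeriv_succ, Function.iterate_succ_apply']
    have h1 : iteratedDeriv s (fun t => realField c (t, a)) =ᶠ[nhds t]
        fun t => realField (PeriodicEuler.dTime^[s] c) (t, a) :=
      Filter.eventuallyEq_of_mem ((isOpen_timeDisc R).mem_nhds ht) fun t' ht' => ih ht'
    rw [h1.deriv_eq]
    exact ((hc.iterate_dTime s).hasDerivAt_time ht a).deriv

theorem IsHermitianMode.fourierCoefVec_iterate_dTime {c : Mode → C3} {R : ℝ≥0∞} (hH : IsHermitianMode c)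
    (hc : Admissible c R) (h0 : 0 < R) (s : ℕ) (p : Fin 3 → ℤ) :
    fourierCoefVec (fun a => realField (PeriodicEuler.dTime^[s] c) (0, a)) p = (s ! : ℂ) • c (s, p) := by
  obtain ⟨σ, r, hσ, h1, h2⟩ := (hc.iterate_dTime s).converges_real
    (t := 0) (by simpa [timeDisc] using h0)
  have h3 := (hH.iterate_dTime s).fourierCoefVec_realField hσ.le h2 h1.le p
  rw [← iterate_dTime_zero]
  refine h3.unique ?_
  have h4 := hasSum_single (f := fun m : ℕ => (((0 : ℝ) : ℂ) ^ m) • PeriodicEuler.dTime^[s] c (m, p)) 0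
    fun m hm => by simp [hm]
  simpa using h4

theorem xi_order_one (v : (Fin 3 → ℤ) → C3) (p : Fin 3 → ℤ) : xi v (1, p) = v p := by
  have h : trunc (xi v) 1 = 0 := by
    funext i
    rcases Nat.eq_zero_or_pos i.1 with hi | hi
    · exact trunc_xi_eq_zero v hi 1
    · exact if_neg (by omega)
  rw [xi_eq_trunc, h]
  simp [divSource, curlSource, quadDiv, quadCurl, cubDiv, cross_zero_left, dot_zero_right,
    det3, helmholtz_zero_source]

theorem fourierCoefVec_real_smul (r : ℝ) (f : E3 → E3) (p : Fin 3 → ℤ) :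
    fourierCoefVec (fun a => r • f a) p = (r : ℂ) • fourierCoefVec f p := by
  ext j
  simp only [fourierCoefVec, fourierCoef, PiLp.smul_apply, smul_eq_mul, Complex.ofReal_mul, mul_assoc]
  rw [integral_const_mul]
  ring

/-- The Taylor coefficients of a displacement which agrees near the initial time with the sum of
a Fourier–Taylor series. -/
theorem Admissible.displacementCoef_eq {c : Mode → C3} {R T : ℝ≥0∞} (hc : Admissible c R) (h0 : 0 < R)
    (hT : 0 < T) {x : ℝ → E3 → E3}
    (hx : ∀ t ∈ timeInterval T, ENNReal.ofReal t < R → ∀ a, x t a = a + realField c (t, a))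
    (s : ℕ) (a : E3) :
    displacementCoef T x s a =
      ((s ! : ℝ)⁻¹) • realField (PeriodicEuler.dTime^[s] c) (0, a) := by
  have hm : (0 : ℝ) ∈ timeInterval T := ⟨le_rfl, by simpa using hT⟩
  have hd : (0 : ℝ) ∈ timeDisc R := by simpa [timeDisc] using h0
  have h1 : (fun t => x t a - a) =ᶠ[nhdsWithin 0 (timeInterval T)] fun t => realField c (t, a) := by
    filter_upwards [self_mem_nhdsWithin, mem_nhdsWithin_of_mem_nhds
      ((isOpen_ofReal_lt R).mem_nhds (show (0 : ℝ) ∈ {t : ℝ | ENNReal.ofReal t < R} by simpa using h0))]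
      with t ht ht'
    rw [hx t ht ht', add_sub_cancel_left]
  have h2 : ContDiffAt ℝ s (fun t => realField c (t, a)) 0 :=
    ContDiffAt.comp (g := realField c) (f := fun t : ℝ => (t, a)) (0 : ℝ)
      (hc.contDiffAt (y := ((0 : ℝ), a)) hd (n := s)) (contDiffAt_id.prodMk contDiffAt_const)
  -- The series is smooth across `t = 0`, so the one-sided derivatives at the initial time are the
  -- two-sided ones.
  rw [displacementCoef, h1.iteratedDerivWithin_eq (h1.self_of_nhdsWithin hm),
    iteratedDerivWithin_eq_iteratedDeriv (uniqueDiffOn_timeInterval T) h2 hm,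
    hc.iteratedDeriv_realField s hd]

theorem modeGenFun_eq_fourierGenFun {c : Mode → C3} (hc : ∀ p, c (0, p) = 0) {f : ℕ → E3 → E3}
    (hf : ∀ s p, fourierCoefVec (f s) p = c (s, p)) (σ t : ℝ) :
    fourierGenFun f σ t = modeGenFun c σ t := by
  rw [modeGenFun, ENNReal.tsum_prod', tsum_eq_zero_add' ENNReal.summable, fourierGenFun]
  have h1 : ∑' p, weight σ t (0, p) * modeSize c (0, p) = 0 := by simp [modeSize, hc]
  rw [h1, zero_add]
  refine tsum_congr fun s => ?_
  rw [← ENNReal.tsum_mul_right]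
  refine tsum_congr fun p => ?_
  rw [hf, weight, modeSize, ENNReal.ofReal_mul (waveLength_nonneg _)]
  ring

theorem gradSeries_eq_gradGenFun {c : Mode → C3} (hc : ∀ p, c (0, p) = 0) {f : ℕ → E3 → E3}
    (hf : ∀ s p, fourierCoefVec (f s) p = c (s, p)) (h1 : ∀ s, ContDiff ℝ 1 (f s))
    (h2 : ∀ s, IsPeriodic (f s)) (σ t : ℝ) :
    gradGenFun f σ t = gradSeries c σ t := by
  have h0 : gradNorm σ (fun p => c (0, p)) = 0 := by simp [gradNorm, hc]
  rw [gradSeries, tsum_eq_zero_add' ENNReal.summable, h0, zero_mul, zero_add, gradGenFun]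
  refine tsum_congr fun s => ?_
  rw [gradGevreyNorm_eq (h1 _) (h2 _)]
  simp only [← hf]

/-- The data attached to the flow with initial velocity `v₀`: the Fourier–Taylor coefficients of
the displacement and the flow that they define. -/
theorem exists_displacement_coefficients {v₀ : E3 → E3} (hv : AnalyticOnNhd ℝ v₀ univ)
    (pv : IsPeriodic v₀) (dv : ∀ a, divergence v₀ a = 0) :
    Admissible (xi (fourierCoefVec v₀)) (criticalTime v₀ 0) ∧
    IsHermitianMode (xi (fourierCoefVec v₀)) ∧ 0 < criticalTime v₀ 0 ∧
    IsEulerFlow (criticalTime v₀ 0) (2 - √2) (realField (xi (fourierCoefVec v₀)))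
      (realField (dTime (xi (fourierCoefVec v₀))))
      (realField (dTime (dTime (xi (fourierCoefVec v₀))))) ∧
    ∀ a, realField (dTime (xi (fourierCoefVec v₀))) (0, a) = v₀ a := by
  have hc : ContDiff ℝ 1 v₀ := contDiff_of_analyticOnNhd hv
  have hΓ := vorticityGevrey_eq hc pv dv 0
  obtain ⟨σ, hσ, hfin⟩ := exists_waveGevrey_lt_top hv pv
  have hA : Admissible (xi (fourierCoefVec v₀)) (criticalTime v₀ 0) := by
    rw [criticalTime, hΓ]
    exact admissible_xi _ hσ hfin
  have hH := isHermitianMode_xi (fourierCoefVec_neg_wave v₀)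
  have hT : 0 < criticalTime v₀ 0 := by
    rw [criticalTime, hΓ]
    refine ENNReal.div_pos (ENNReal.ofReal_pos.2 ?_).ne'
      ((waveGevrey_mono _ hσ.le).trans_lt hfin).ne
    have : √2 < 8 / 5 := by rw [Real.sqrt_lt' (by norm_num)]; norm_num
    linarith
  have h0 : (0 : ℝ) ∈ timeDisc (criticalTime v₀ 0) := by simpa [timeDisc] using hT
  refine ⟨hA, hH, hT, isEulerFlow_realField hA hH (dot_wave_fourierCoefVec hc pv dv)
    fun t ht => modeGenFun_xi_le_of_le _ le_rfl ?_, fun a => ?_⟩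
  · rw [← hΓ, ← Real.norm_eq_abs, ofReal_norm]
    exact ENNReal.mul_le_of_le_div (show ‖t‖ₑ < criticalTime v₀ 0 from ht).le
  -- The constructed velocity at time zero and `v₀` have the same summable Fourier coefficients,
  -- hence coincide.
  · have h1 : ∀ p, fourierCoefVec (fun a => realField (dTime (xi (fourierCoefVec v₀))) (0, a)) p =
        fourierCoefVec v₀ p := fun p => by
      have := hH.fourierCoefVec_iterate_dTime hA hT 1 p
      simpa [xi_order_one] using this
    refine eq_of_fourierCoefVec_eq (continuous_realField hA.dTime h0) hc.continuous
      (isPeriodic_realField _ 0) pv h1 ?_ a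
    obtain ⟨σ', r, hσ', h2, h3⟩ := hA.converges_real h0
    have h4 := h3.comp_injective (i := fun p : Fin 3 → ℤ => ((1, p) : Mode))
      fun p q hpq => (Prod.ext_iff.1 hpq).2
    have hr : 0 < r := (abs_nonneg _).trans_lt h2
    refine (h4.mul_left r⁻¹).of_nonneg_of_le (fun _ => norm_nonneg _) fun p => ?_
    have := waveLength_nonneg p
    rw [h1, ← xi_order_one (fourierCoefVec v₀) p]
    simp only [Function.comp_apply, pow_one]
    rw [show r⁻¹ * (Real.exp (σ' * waveLength p) * r * ‖xi (fourierCoefVec v₀) (1, p)‖) =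
      Real.exp (σ' * waveLength p) * ‖xi (fourierCoefVec v₀) (1, p)‖ by field_simp]
    exact le_mul_of_one_le_left (norm_nonneg _) (Real.one_le_exp (by positivity))

/-- The complexified Lagrangian map. -/
def complexMap (v₀ : E3 → E3) (y : C3 × ℂ) : C3 := y.1 + series (xi (fourierCoefVec v₀)) y

theorem analyticOnNhd_complexMap {v₀ : E3 → E3} (hv : AnalyticOnNhd ℝ v₀ univ)
    (pv : IsPeriodic v₀) (dv : ∀ a, divergence v₀ a = 0) {σ : ℝ} (hσ : 0 < σ) :
    AnalyticOnNhd ℂ (complexMap v₀) (complexDomain v₀ σ) := by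
  rintro y ⟨h1, h2⟩
  refine analyticAt_fst.add ?_
  rw [← ofReal_norm] at h2
  obtain ⟨r, hr, h3⟩ := exists_real_btwn (norm_nonneg _) h2
  rw [criticalTime, vorticityGevrey_eq (contDiff_of_analyticOnNhd hv) pv dv] at h3
  exact analyticAt_series (converges_xi _ ((norm_nonneg _).trans hr.le)
    ((modeGenFun_xi_le_of_le _ hσ.le (ENNReal.mul_le_of_le_div h3.le)).trans_lt
      ENNReal.ofReal_lt_top)) h1 hr

end

end PeriodicEuler

end

theorem mainTheorem2 (v₀ : E3 → E3)
    (hv_analytic : AnalyticOnNhd ℝ v₀ univ)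
    (hv_periodic : IsPeriodic v₀)
    (hv_div : ∀ a, divergence v₀ a = 0) :
    -- the classical Euler flow and its Lagrangian map exist for `0 ≤ t < T_c / Γ₀`
    (∃ (v : ℝ → E3 → E3) (p : ℝ → E3 → ℝ) (x : ℝ → E3 → E3),
      IsEulerSolution v₀ (criticalTime v₀ 0) v p ∧ IsLagrangianMap (criticalTime v₀ 0) v x) ∧
    -- every Lagrangian map with this initial velocity has the stated properties
    ∀ (T : ℝ≥0∞) (v : ℝ → E3 → E3) (p : ℝ → E3 → ℝ) (x : ℝ → E3 → E3), 0 < T →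
      IsEulerSolution v₀ T v p → IsLagrangianMap T v x →
      -- the two inequalities for the generating functions, and boundedness of `ζ_σ`
      (∀ σ : ℝ, 0 < σ → vorticityGevrey v₀ σ < ∞ →
        (∀ t : ℝ, 0 ≤ t →
          gradGenFun (displacementCoef T x) σ t ≤
            6 * gradGenFun (displacementCoef T x) σ t ^ 3
              + 12 * gradGenFun (displacementCoef T x) σ t ^ 2
              + ENNReal.ofReal t * gradGevreyNorm σ v₀) ∧
        (∀ t : ℝ, 0 ≤ t →
          fourierGenFun (displacementCoef T x) σ t ≤
            fourierGenFun (displacementCoef T x) σ t ^ 3 / 6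
              + fourierGenFun (displacementCoef T x) σ t ^ 2 / ENNReal.ofReal (√2)
              + ENNReal.ofReal t * vorticityGevrey v₀ σ) ∧
        (∃ B : ℝ≥0∞, B < ∞ ∧ ∀ t : ℝ, 0 ≤ t → ENNReal.ofReal t < criticalTime v₀ σ →
          fourierGenFun (displacementCoef T x) σ t ≤ B)) ∧
      -- joint analyticity in space and time
      ∃ X : C3 × ℂ → C3,
        (∀ (a : E3) (t : ℝ), 0 ≤ t → ENNReal.ofReal t < T →
          ENNReal.ofReal t < criticalTime v₀ 0 → X (toC3 a, (t : ℂ)) = toC3 (x t a)) ∧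
        (∀ σ : ℝ, 0 < σ → vorticityGevrey v₀ σ < ∞ →
          AnalyticOnNhd ℂ X (complexDomain v₀ σ)) ∧
        (∀ (a : E3) (τ : ℂ), ‖τ‖ₑ < criticalTime v₀ 0 → AnalyticAt ℂ X (toC3 a, τ)) := by
  obtain ⟨hA, hH, hR, hF, hU⟩ :=
    exists_displacement_coefficients hv_analytic hv_periodic hv_div
  have hE := hF.isEulerSolution hU hR
  have hc : ContDiff ℝ 1 v₀ := contDiff_of_analyticOnNhd hv_analytic
  refine ⟨⟨_, _, _, hE, hF.isLagrangianMap⟩, fun T v p x hT hvp hx => ?_⟩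
  -- Uniqueness replaces the given Lagrangian map by the constructed one, on the common time
  -- interval.
  have hxd : ∀ t ∈ timeInterval T, ENNReal.ofReal t < criticalTime v₀ 0 → ∀ a,
      x t a = a + realField (xi (fourierCoefVec v₀)) (t, a) := fun t ht ht' a =>
    IsLagrangianMap.unique hvp hE hx hF.isLagrangianMap ht ⟨ht.1, ht'⟩ a
  have h0 : (0 : ℝ) ∈ timeDisc (criticalTime v₀ 0) := by simpa [timeDisc] using hR
  have hD := fun s => funext (hA.displacementCoef_eq hR hT hxd s)
  have hDf : ∀ s q, fourierCoefVec (displacementCoef T x s) q =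
      xi (fourierCoefVec v₀) (s, q) := fun s q => by
    have hs : ((s ! : ℝ) : ℂ) ≠ 0 := by exact_mod_cast s.factorial_ne_zero
    rw [hD, fourierCoefVec_real_smul, hH.fourierCoefVec_iterate_dTime hA hR, smul_smul,
      Complex.ofReal_inv, ← Complex.ofReal_natCast, inv_mul_cancel₀ hs, one_smul]
  have hD1 : ∀ s, ContDiff ℝ 1 (displacementCoef T x s) := fun s => by
    rw [hD]
    have h1 : ContDiff ℝ 1 fun a =>
        realField (PeriodicEuler.dTime^[s] (xi (fourierCoefVec v₀))) (0, a) :=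
      contDiff_iff_contDiffAt.2 fun a =>
        ContDiffAt.comp (g := realField (PeriodicEuler.dTime^[s] (xi (fourierCoefVec v₀))))
          (f := fun a : E3 => ((0 : ℝ), a)) a ((hA.iterate_dTime s).contDiffAt h0 (n := 1))
          (contDiffAt_const.prodMk contDiffAt_id)
    exact h1.const_smul _
  have hDp : ∀ s, IsPeriodic (displacementCoef T x s) := fun s => by
    rw [hD]
    exact (isPeriodic_realField _ 0).comp fun w => ((s ! : ℝ)⁻¹) • w
  have hz := xi_order_zero (fourierCoefVec v₀)
  refine ⟨fun σ hσ _ => ⟨fun t _ => ?_, fun t _ => ?_, ENNReal.ofReal (2 - √2),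
    ENNReal.ofReal_lt_top, fun t _ ht => ?_⟩, complexMap v₀, fun a t h1 h2 h3 => ?_,
    fun σ hσ _ => analyticOnNhd_complexMap hv_analytic hv_periodic hv_div hσ,
    fun a τ h => AnalyticAt.fun_add (f := Prod.fst) analyticAt_fst (hA.analyticAt a h)⟩
  · rw [gradSeries_eq_gradGenFun hz hDf hD1 hDp, gradGevreyNorm_eq hc hv_periodic]
    exact gradSeries_xi_le _ hσ.le t
  · rw [modeGenFun_eq_fourierGenFun hz hDf, vorticityGevrey_eq hc hv_periodic hv_div,
      div_eq_mul_inv, div_eq_mul_inv]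
    refine (modeGenFun_xi_le _ hσ.le t).trans_eq ?_
    ring
  · rw [modeGenFun_eq_fourierGenFun hz hDf]
    refine modeGenFun_xi_le_of_le _ hσ.le (ENNReal.mul_le_of_le_div ?_)
    rw [← vorticityGevrey_eq hc hv_periodic hv_div]
    exact ht.le
  · rw [complexMap, hxd t ⟨h1, h2⟩ h3, ← hH.toC3_realField, ← toC3L_apply, ← toC3L_apply,
      ← toC3L_apply, map_add]
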